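/- Let $\mathbf x(t)=(x_1(t),\dots,x_M(t))$ be real, zero-mean, finite-variance, jointly wide-sense stationary signals with integrable power spectral density $C_{\mathbf x}(f)$, and let $\mathbf s\in\mathbb R^N$ be a zero-mean, finite-variance random vector whose MMSE estimate is linear, $\tilde{\mathbf s}=\mathbb E[\mathbf s\mid\{\mathbf x(t)\}]=(\Gamma*\mathbf x)(0)$, with $\tilde{\mathbf s}$ not almost surely zero. Fix $\eta>0$, a sampling rate $f_s>0$ (with $T_s=1/f_s$), and $\Upsilon\in\mathbb N$ such that $C_{\mathbf x}(f)=0$ for $|f|>(\Upsilon+\tfrac12)f_s$. An acquisition system with $K\le M$ ADCs of resolution $b$ consists of an analog filter $H(f)\in\mathbb C^{K\times M}$ (a real linear filter with finite-variance output $\mathbf y=H*\mathbf x$), samples $y_k[n]=T_s\,y_k(nT_s)$, non-overloading nonsubtractively dithered mid-rise quantizers $z_k[n]=\Delta\left(\left\lfloor (y_k[n]+w_k[n])/\Delta\right\rfloor+\tfrac12\right)$ with step $\Delta=2\gamma/2^{b}$, where the dither $w_k[n]$ is i.i.d. with triangular density of width $2\Delta$, independent of $(\mathbf x,\mathbf s)$,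 and the dynamic range $\gamma>0$ satisfies $\gamma^2=\eta^2\max_k\mathbb E\{(y_k[n]+w_k[n])^2\}$, and a linear digital filter $G$ producing $\hat{\mathbf s}=\sum_{n\in\mathbb Z}G[-n]\,\mathbf z[n]$. Let $\mathrm{MSE}(K,b)$ be the infimum of $\mathbb E\|\mathbf s-\hat{\mathbf s}\|^2$ over all such $H$, $G$. Let $$\bar\Gamma(f)=\big[\Gamma(f-kf_s)\,C_{\mathbf x}^{1/2}(f-kf_s)\big]_{k=-\Upsilon,\dots,\Upsilon},\qquad L=\max_{f\in[-f_s/2,\,f_s/2]}\operatorname{rank}\bar\Gamma(f),$$ so that $L$ is the maximal rank of the aliased spatial power spectral density $\bar\Gamma(f)\bar\Gamma(f)^H$ of the output of the analog MMSE filter. Fix a rate budget $R$. Given a rule $K\mapsto b_K$, call $K$ admissible if $1\le K\le M$, $b_K\ge1$ and $\frac{2\eta^2}{3\cdot 2^{2b_K}}<1$ (so that a dynamic range exists), and call $K$ MSE-minimizing if it is admissible and $\mathrm{MSE}(K,b_K)\le\mathrm{MSE}(K',b_{K'})$ for every admissible $K'$. (a) If the budget is met exactly, $R=K f_s b$, i.e.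 $b_K=R/(Kf_s)$ (a real number), then every MSE-minimizing $K$ satisfies $K\le L$. (b) If the resolution is rounded down to an integer number of bits, $b_K=\lfloor R/(Kf_s)\rfloor$, then every MSE-minimizing $K$ satisfies $K\le L$ or $b_K=b_L$; that is, the bound can be exceeded only without loss of resolution compared to $L$ ADCs. -/

import Mathlib

open MeasureTheory ProbabilityTheory Filter Topology
open scoped ENNReal Matrix MatrixOrder ComplexOrder

namespace TaskADC

noncomputable section

variable {Ω : Type*} [MeasurableSpace Ω] {M N K : ℕ}

/-! ### Signal model -/

/-- The real signals `x 0, …, x (M - 1)` are zero-mean, have finite variance, and are jointly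
wide-sense stationary with joint power spectral density `C`, that is
`E[x_i(t + τ) x_j(t)] = ∫ C(f)_{ij} e^{2π i f τ} df`. -/
structure IsWSS (P : Measure Ω) (x : Fin M → ℝ → Ω → ℝ)
    (C : ℝ → Matrix (Fin M) (Fin M) ℂ) : Prop where
  measurable : ∀ m t, Measurable (x m t)
  memLp : ∀ m t, MemLp (x m t) 2 P
  mean_zero : ∀ m t, ∫ ω, x m t ω ∂P = 0
  posSemidef : ∀ f, (C f).PosSemidef
  integrable : ∀ i j, Integrable (fun f => C f i j)
  autocorr : ∀ (i j : Fin M) (t τ : ℝ),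
    ((∫ ω, x i (t + τ) ω * x j t ω ∂P : ℝ) : ℂ)
      = ∫ f : ℝ, C f i j * Complex.exp (2 * Real.pi * Complex.I * f * τ)

/-- The σ-algebra generated by the whole family of signals `{x_m(t)}`. -/
abbrev signalSigma (x : Fin M → ℝ → Ω → ℝ) : MeasurableSpace Ω :=
  ⨆ m : Fin M, ⨆ t : ℝ, MeasurableSpace.comap (x m t) inferInstance

/-! ### Linear filtering of a stationary process

A (real) tapped delay line is a finite real combination of samples of the signals. The output of
a general filter is the mean-square limit of tapped delay lines whose frequency responses
converge in `L²(C)`, i.e. the spectral stochastic integral `∫ g(f) e^{2π i f t} dZ_x(f)`. For an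
integrable real impulse response `h` this is the convolution `(h * x)(t)`, and `g` is the Fourier
transform of `h`. As only real taps are used, a response `g` that has an output is automatically
conjugate-symmetric and of finite output variance `∫ g C gᴴ` (in the sense of `L²(C)`). -/

/-- Output of the tapped delay line with tap `c (m, u)` on the sample `x_m(u)`. -/
def tapOutput (x : Fin M → ℝ → Ω → ℝ) (c : (Fin M × ℝ) →₀ ℝ) (ω : Ω) : ℝ :=
  c.sum fun p a => a * x p.1 p.2 ω

/-- Frequency response of a tapped delay line (a row vector indexed by the signals). -/
def tapResponse (c : (Fin M × ℝ) →₀ ℝ) (f : ℝ) (m : Fin M) : ℂ :=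
  c.sum fun p a => if p.1 = m then (a : ℂ) * Complex.exp (2 * Real.pi * Complex.I * f * p.2) else 0

/-- Squared `L²(C)`-norm `∫ v(f) C(f) v(f)ᴴ df` of a row-vector-valued frequency response. -/
def specNormSq (C : ℝ → Matrix (Fin M) (Fin M) ℂ) (v : ℝ → Fin M → ℂ) : ℝ≥0∞ :=
  ∫⁻ f : ℝ, ENNReal.ofReal (v f ⬝ᵥ (C f *ᵥ star (v f))).re

/-- `Y` is (a version of) the output at time `t` of the filter with scalar output and frequency
response `g` (a row vector), driven by the signals `x` with power spectral density `C`. -/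
def IsFilterOutput (P : Measure Ω) (x : Fin M → ℝ → Ω → ℝ) (C : ℝ → Matrix (Fin M) (Fin M) ℂ)
    (g : ℝ → Fin M → ℂ) (t : ℝ) (Y : Ω → ℝ) : Prop :=
  MemLp Y 2 P ∧
  ∃ c : ℕ → (Fin M × ℝ) →₀ ℝ,
    Tendsto (fun r => eLpNorm (fun ω => Y ω - tapOutput x (c r) ω) 2 P) atTop (𝓝 0) ∧
    Tendsto (fun r => specNormSq C (fun f m =>
      g f m * Complex.exp (2 * Real.pi * Complex.I * f * t) - tapResponse (c r) f m))
      atTop (𝓝 0)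

/-- The task `s` is a zero-mean random vector of finite variance whose minimum mean-square error
estimate from the signals is linear: `E[s | {x_m(t)}] = (Γ * x)(0)`. -/
structure IsLinearTask (P : Measure Ω) (x : Fin M → ℝ → Ω → ℝ)
    (C : ℝ → Matrix (Fin M) (Fin M) ℂ) (Γ : ℝ → Matrix (Fin N) (Fin M) ℂ)
    (s : Fin N → Ω → ℝ) : Prop where
  measurable : ∀ i, Measurable (s i)
  memLp : ∀ i, MemLp (s i) 2 P
  mean_zero : ∀ i, ∫ ω, s i ω ∂P = 0
  measurable_filter : ∀ i m, Measurable fun f => Γ f i m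
  mmse : ∀ i, IsFilterOutput P x C (fun f => Γ f i) 0 (P[s i | signalSigma x])

/-! ### Dithered quantization -/

/-- The triangular law with density `1 - |u|` on `[-1, 1]`. -/
def triangular : Measure ℝ :=
  volume.withDensity fun u => ENNReal.ofReal (1 - |u|)

/-- Normalized dither `w_k[n]`: i.i.d. in time and space, triangular on `[-1, 1]`, and independent
of the signals and the task. A quantizer with step `Δ` uses the dither `Δ w_k[n]`, whose density
is `(1/Δ) (1 - |w|/Δ)` on `[-Δ, Δ]`. -/
structure IsDither (P : Measure Ω) (x : Fin M → ℝ → Ω → ℝ) (s : Fin N → Ω → ℝ)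
    (w : ℕ → ℤ → Ω → ℝ) : Prop where
  measurable : ∀ k n, Measurable (w k n)
  law : ∀ k n, P.map (w k n) = triangular
  iIndep : iIndepFun (fun (p : ℕ × ℤ) => w p.1 p.2) P
  indep : IndepFun (fun ω (p : ℕ × ℤ) => w p.1 p.2 ω)
    (fun ω => ((fun (q : Fin M × ℝ) => x q.1 q.2 ω), fun i => s i ω)) P

/-- Quantization step `Δ = 2γ / 2^b` for dynamic range `γ` and resolution `b`. -/
def step (b γ : ℝ) : ℝ := 2 * γ / 2 ^ b

/-- Uniform mid-rise quantizer with step `Δ`, operating within its dynamic range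
(no overload). -/
def midRise (Δ v : ℝ) : ℝ := Δ * (⌊v / Δ⌋ + 1 / 2)

/-! ### The acquisition system with `K` ADCs, sampling rate `fs` and resolution `b` -/

/-- Samples `y_k[n] = T_s y_k(n T_s)`, with `T_s = 1 / fs`. -/
def samples (fs : ℝ) (y : Fin K → ℝ → Ω → ℝ) (k : Fin K) (n : ℤ) (ω : Ω) : ℝ :=
  fs⁻¹ * y k (n * fs⁻¹) ω

/-- Quantizer inputs `y_k[n] + Δ w_k[n]`. -/
def quantInput (w : ℕ → ℤ → Ω → ℝ) (fs b γ : ℝ) (y : Fin K → ℝ → Ω → ℝ)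
    (k : Fin K) (n : ℤ) (ω : Ω) : ℝ :=
  samples fs y k n ω + step b γ * w k n ω

/-- Quantizer outputs `z_k[n]`. -/
def quantOutput (w : ℕ → ℤ → Ω → ℝ) (fs b γ : ℝ) (y : Fin K → ℝ → Ω → ℝ)
    (k : Fin K) (n : ℤ) (ω : Ω) : ℝ :=
  midRise (step b γ) (quantInput w fs b γ y k n ω)

/-- An analog front end: analog filter `H` with output signals `y`, and dynamic range `γ > 0`,
which is `η` times the largest standard deviation of the quantizer inputs. -/
structure IsFrontEnd (P : Measure Ω) (x : Fin M → ℝ → Ω → ℝ) (C : ℝ → Matrix (Fin M) (Fin M) ℂ)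
    (w : ℕ → ℤ → Ω → ℝ) (η fs b : ℝ) (H : ℝ → Matrix (Fin K) (Fin M) ℂ)
    (y : Fin K → ℝ → Ω → ℝ) (γ : ℝ) : Prop where
  measurable_filter : ∀ k m, Measurable fun f => H f k m
  output : ∀ k t, IsFilterOutput P x C (fun f => H f k) t (y k t)
  range_pos : 0 < γ
  range_eq : ∀ n : ℤ, γ ^ 2 = η ^ 2 * ⨆ k : Fin K, ∫ ω, quantInput w fs b γ y k n ω ^ 2 ∂P

/-- `sHat` is the output at time `0` of the digital filter `G` with input `z`,
`sHat = ∑ n, G[-n] z[n]`, the series converging in mean square. -/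
def IsDigitalEstimate (P : Measure Ω) (z : Fin K → ℤ → Ω → ℝ)
    (G : ℤ → Matrix (Fin N) (Fin K) ℝ) (sHat : Fin N → Ω → ℝ) : Prop :=
  ∀ i, MemLp (sHat i) 2 P ∧
    Tendsto (fun F : Finset ℤ =>
      eLpNorm (fun ω => sHat i ω - ∑ n ∈ F, (G (-n) *ᵥ fun k => z k n ω) i) 2 P) atTop (𝓝 0)

/-- Mean-square error `E ‖s - sHat‖²`. -/
def mse (P : Measure Ω) (s sHat : Fin N → Ω → ℝ) : ℝ≥0∞ :=
  ∫⁻ ω, ENNReal.ofReal (∑ i, (s i ω - sHat i ω) ^ 2) ∂P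

/-- Minimum achievable mean-square error over all analog filters `H` and digital filters `G`, for
the ADC configuration `(K, fs, b)` (it is `⊤` if no system has this configuration). -/
def minMSE (P : Measure Ω) (x : Fin M → ℝ → Ω → ℝ) (C : ℝ → Matrix (Fin M) (Fin M) ℂ)
    (s : Fin N → Ω → ℝ) (w : ℕ → ℤ → Ω → ℝ) (η fs : ℝ) (K : ℕ) (b : ℝ) : ℝ≥0∞ :=
  sInf {e | ∃ (H : ℝ → Matrix (Fin K) (Fin M) ℂ) (y : Fin K → ℝ → Ω → ℝ) (γ : ℝ)
      (G : ℤ → Matrix (Fin N) (Fin K) ℝ) (sHat : Fin N → Ω → ℝ),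
    IsFrontEnd P x C w η fs b H y γ ∧
    IsDigitalEstimate P (quantOutput w fs b γ y) G sHat ∧
    e = mse P s sHat}

/-- `K` ADCs of resolution `b` are admissible for `M` signals: `1 ≤ K ≤ M`, `b ≥ 1`, and
`η` is such that a dynamic range exists, i.e. `1 - 2 η² / (3 · 2^{2b}) > 0`. -/
def Admissible (M : ℕ) (η : ℝ) (K : ℕ) (b : ℝ) : Prop :=
  1 ≤ K ∧ K ≤ M ∧ 1 ≤ b ∧ 2 * η ^ 2 / (3 * 2 ^ (2 * b)) < 1

/-- When `K` ADCs get the resolution `b K`, the number `K` of ADCs is admissible and minimizes the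
minimum achievable mean-square error among all admissible numbers of ADCs. -/
def IsMSEMinimizing (P : Measure Ω) (x : Fin M → ℝ → Ω → ℝ) (C : ℝ → Matrix (Fin M) (Fin M) ℂ)
    (s : Fin N → Ω → ℝ) (w : ℕ → ℤ → Ω → ℝ) (η fs : ℝ) (b : ℕ → ℝ) (K : ℕ) : Prop :=
  Admissible M η K (b K) ∧
  ∀ K' : ℕ, Admissible M η K' (b K') →
    minMSE P x C s w η fs K (b K) ≤ minMSE P x C s w η fs K' (b K')

/-! ### The aliased response of the analog MMSE filter -/

/-- `Γ̄(f) = [Γ_{-Υ}(f) L_{-Υ}(f), …, Γ_Υ(f) L_Υ(f)]` with `Γ_k(f) = Γ(f - k fs)` and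
`L_k(f) = C(f - k fs)^{1/2}`; the block with index `l : Fin (2Υ + 1)` is `k = l - Υ`. -/
def aliasedResponse (C : ℝ → Matrix (Fin M) (Fin M) ℂ) (Γ : ℝ → Matrix (Fin N) (Fin M) ℂ)
    (fs : ℝ) (Υ : ℕ) (f : ℝ) : Matrix (Fin N) (Fin (2 * Υ + 1) × Fin M) ℂ :=
  Matrix.of fun i p =>
    (Γ (f - ((p.1 : ℝ) - Υ) * fs) * CFC.sqrt (C (f - ((p.1 : ℝ) - Υ) * fs))) i p.2

/-- `max_{f ∈ [-fs/2, fs/2]} rank Γ̄(f)` (a supremum of a set of integers bounded by `N`). -/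
def maxRank (C : ℝ → Matrix (Fin M) (Fin M) ℂ) (Γ : ℝ → Matrix (Fin N) (Fin M) ℂ)
    (fs : ℝ) (Υ : ℕ) : ℕ :=
  sSup ((fun f => (aliasedResponse C Γ fs Υ f).rank) '' Set.Icc (-(fs / 2)) (fs / 2))

end

end TaskADC

open TaskADC

open MeasureTheory ProbabilityTheory Filter Topology
open scoped ENNReal Matrix MatrixOrder ComplexOrder

namespace TaskADC

noncomputable section

/-! ### The Hilbert space `L²(C)` of frequency responses -/

/-! Write `A` for the response of the analog filter (with the factor `T_s` included), `B` for the
`fs`-periodic response of a finite digital filter, and `g` for the sum of the squares of its taps.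
Triangular dither makes the quantization errors centred, of power `Δ² / 4`, and uncorrelated with
one another and with the signals and the task. Hence the mean-square error is exactly `c₀ + d + (Δ²
/ 4) g`, where `c₀` is the error of the best estimate from the signals and `d = ∫ ‖(Γ - B A)
C^{1/2}‖²` (`mse_finite`).

The dynamic range is tied to the strongest quantizer input, which gives `Δ² / 4 = κ(b) max_k E y_k²`
with `κ` the function `kappa`. The maximum is at least the average, so every system with `K`
channels and total power `e` has error at least `c₀ + d + (κ(b) / K) e g`. Conversely, an orthogonal
mixing of the channels, undone in the digital filter, equalizes the powers without changing `d`, `e`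
or `g` (`exists_orthogonal_diag_eq`); so this value is achievable whenever `e > 0`
(`minMSE_le_of_power`).

It remains to see that `d`, `e` and `g` need not grow when `K` channels are replaced by `L`. At
every frequency the columns of the aliased response span a space of dimension at most `L`.
Projecting the columns of `B` onto that space does not increase `d`, and the projected filter
factors as `B' V` through `L` channels with `V` a contraction and `‖B'‖ ≤ ‖B‖`. The factor `V` moves
into the analog filter (`isCompression_of_isPartialONB`, `exists_compression`).

Therefore `κ(b_L) / L < κ(b_K) / K` makes `L` channels better than `K`. Strictness has to survive
the infimum, so `e g` must stay away from zero. If `d` is clearly below `∫ ‖Γ C^{1/2}‖²`, then `e g`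
has a positive lower bound common to all systems (`exists_le_power_mul_coefSqMat`); all other
systems lose to one that estimates a single component of the task (`minMSE_le_of_component`). Both
cases are joined in `minMSE_lt_minMSE`.

Finally, for `L < K` the inequality between the `κ`'s follows from `K 4^{b_K} ≤ L 4^{b_L}`.
Exponential growth gives this for the exact rule, and for the rounded rule as soon as the two
resolutions differ. -/

open scoped Matrix.Norms.L2Operator in
theorem continuousOn_matrix_sqrt (M : ℕ) :
    ContinuousOn (CFC.sqrt : Matrix (Fin M) (Fin M) ℂ → _) {a | 0 ≤ a} :=
  CFC.continuousOn_sqrt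

/-- The square root is continuous on the positive semidefinite cone, so it preserves measurability.
-/
theorem measurable_sqrt_apply {α : Type*} [MeasurableSpace α] {M : ℕ}
    {C : α → Matrix (Fin M) (Fin M) ℂ} (hC : ∀ i j, Measurable fun f => C f i j)
    (hp : ∀ f, (C f).PosSemidef) (i j : Fin M) :
    Measurable fun f => CFC.sqrt (C f) i j := by
  let _ : MeasurableSpace (Matrix (Fin M) (Fin M) ℂ) :=
    inferInstanceAs (MeasurableSpace (Fin M → Fin M → ℂ))
  have _ : BorelSpace (Matrix (Fin M) (Fin M) ℂ) :=
    inferInstanceAs (BorelSpace (Fin M → Fin M → ℂ))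
  have hCm : Measurable C := measurable_pi_lambda _ fun i => measurable_pi_lambda _ fun j => hC i j
  have h1 : Continuous fun a : {a : Matrix (Fin M) (Fin M) ℂ | 0 ≤ a} => CFC.sqrt a.1 :=
    continuousOn_iff_continuous_domRestrict.1 (continuousOn_matrix_sqrt M)
  have h2 : Measurable fun f => CFC.sqrt (C f) :=
    h1.measurable.comp (hCm.subtype_mk (h := fun f => (hp f).nonneg))
  exact (measurable_pi_apply j).comp ((measurable_pi_apply i).comp h2)

/-- `C^{1/2}` is self-adjoint with square `C`. This realizes `L²(C)` inside an ordinary `L²` space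
of vector-valued functions, where the triangle inequality is available. -/
theorem quadForm_eq {M : ℕ} {C : Matrix (Fin M) (Fin M) ℂ} (hC : C.PosSemidef) (v : Fin M → ℂ) :
    (v ⬝ᵥ (C *ᵥ star v)).re = ‖WithLp.toLp 2 (v ᵥ* CFC.sqrt C)‖ ^ 2 := by
  have h1 : CFC.sqrt C * CFC.sqrt C = C := CFC.sqrt_mul_sqrt_self C hC.nonneg
  have h2 : (CFC.sqrt C)ᴴ = CFC.sqrt C := (CFC.sqrt_nonneg C).isSelfAdjoint
  have h3 : star (v ᵥ* CFC.sqrt C) = CFC.sqrt C *ᵥ star v := by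
    rw [Matrix.star_vecMul, h2]
  have h4 : v ⬝ᵥ (C *ᵥ star v) = (v ᵥ* CFC.sqrt C) ⬝ᵥ star (v ᵥ* CFC.sqrt C) := by
    rw [h3]
    nth_rewrite 1 [← h1]
    rw [← Matrix.mulVec_mulVec, Matrix.dotProduct_mulVec]
  rw [h4, EuclideanSpace.norm_sq_eq]
  simp only [dotProduct, Pi.star_apply, Complex.re_sum]
  refine Finset.sum_congr rfl fun m _ => ?_
  rw [RCLike.star_def, Complex.mul_conj, Complex.ofReal_re, Complex.normSq_eq_norm_sq]

/-- The weighted response `v(f) C(f)^{1/2}`, whose `L²` norm is the norm of `v` in `L²(C)`. -/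
def specVec {M : ℕ} (C : ℝ → Matrix (Fin M) (Fin M) ℂ) (v : ℝ → Fin M → ℂ) (f : ℝ) :
    EuclideanSpace ℂ (Fin M) :=
  WithLp.toLp 2 (v f ᵥ* CFC.sqrt (C f))

section

variable {M : ℕ} {C : ℝ → Matrix (Fin M) (Fin M) ℂ}

theorem specNormSq_eq_lintegral (hp : ∀ f, (C f).PosSemidef) (v : ℝ → Fin M → ℂ) :
    specNormSq C v = ∫⁻ f, ‖specVec C v f‖ₑ ^ 2 := by
  unfold specNormSq
  refine lintegral_congr fun f => ?_
  rw [quadForm_eq (hp f), ENNReal.ofReal_pow (norm_nonneg _), ofReal_norm]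
  rfl

theorem specNormSq_eq (hp : ∀ f, (C f).PosSemidef) (v : ℝ → Fin M → ℂ) :
    specNormSq C v = eLpNorm (specVec C v) 2 volume ^ 2 := by
  rw [specNormSq_eq_lintegral hp, eLpNorm_eq_lintegral_rpow_enorm_toReal (by simp) (by simp)]
  rw [← ENNReal.rpow_natCast, ← ENNReal.rpow_mul]
  simp

theorem specVec_add (v w : ℝ → Fin M → ℂ) :
    specVec C (fun f m => v f m + w f m) = specVec C v + specVec C w := by
  funext f
  simp only [specVec, Pi.add_apply, ← WithLp.toLp_add, ← Matrix.add_vecMul]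
  rfl

theorem specVec_sub (v w : ℝ → Fin M → ℂ) :
    specVec C (fun f m => v f m - w f m) = specVec C v - specVec C w := by
  funext f
  simp only [specVec, Pi.sub_apply, ← WithLp.toLp_sub, ← Matrix.sub_vecMul]
  rfl

theorem specVec_smul (a : ℝ → ℂ) (v : ℝ → Fin M → ℂ) (f : ℝ) :
    specVec C (fun f m => a f * v f m) f = a f • specVec C v f := by
  simp only [specVec, ← WithLp.toLp_smul, ← Matrix.smul_vecMul]
  rfl

theorem measurable_specVec (hC : ∀ i j, Measurable fun f => C f i j)
    (hp : ∀ f, (C f).PosSemidef) {v : ℝ → Fin M → ℂ} (hv : ∀ m, Measurable fun f => v f m) :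
    Measurable (specVec C v) := by
  refine (WithLp.measurable_toLp 2 _).comp (measurable_pi_lambda _ fun m => ?_)
  simp only [Matrix.vecMul, dotProduct]
  exact Finset.measurable_sum _ fun i _ => (hv i).mul (measurable_sqrt_apply hC hp i m)

end

/-! ### Tapped delay lines -/

section

variable {M : ℕ}

theorem tapResponse_add (c d : (Fin M × ℝ) →₀ ℝ) (f : ℝ) (m : Fin M) :
    tapResponse (c + d) f m = tapResponse c f m + tapResponse d f m := by
  unfold tapResponse
  refine Finsupp.sum_add_index' (fun p => by simp) fun p a b => ?_
  split_ifs <;> simp [add_mul]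

theorem tapResponse_smul (a : ℝ) (c : (Fin M × ℝ) →₀ ℝ) (f : ℝ) (m : Fin M) :
    tapResponse (a • c) f m = a * tapResponse c f m := by
  unfold tapResponse
  rw [Finsupp.sum_smul_index' fun p => by simp, Finsupp.sum, Finsupp.sum, Finset.mul_sum]
  refine Finset.sum_congr rfl fun p _ => ?_
  split_ifs <;> simp [mul_assoc]

theorem tapResponse_sub (c d : (Fin M × ℝ) →₀ ℝ) (f : ℝ) (m : Fin M) :
    tapResponse (c - d) f m = tapResponse c f m - tapResponse d f m := by
  have : c - d = c + (-1 : ℝ) • d := by simp [sub_eq_add_neg]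
  rw [this, tapResponse_add, tapResponse_smul]; simp [sub_eq_add_neg]

theorem tapOutput_add {Ω : Type*} (x : Fin M → ℝ → Ω → ℝ) (c d : (Fin M × ℝ) →₀ ℝ) (ω : Ω) :
    tapOutput x (c + d) ω = tapOutput x c ω + tapOutput x d ω :=
  Finsupp.sum_add_index' (fun p => by simp) fun p a b => by simp [add_mul]

theorem tapOutput_smul {Ω : Type*} (x : Fin M → ℝ → Ω → ℝ) (a : ℝ) (c : (Fin M × ℝ) →₀ ℝ) (ω : Ω) :
    tapOutput x (a • c) ω = a * tapOutput x c ω := by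
  unfold tapOutput
  rw [Finsupp.sum_smul_index' fun p => by simp, Finsupp.sum, Finsupp.sum, Finset.mul_sum]
  simp [mul_assoc]

theorem tapOutput_sub {Ω : Type*} (x : Fin M → ℝ → Ω → ℝ) (c d : (Fin M × ℝ) →₀ ℝ) (ω : Ω) :
    tapOutput x (c - d) ω = tapOutput x c ω - tapOutput x d ω := by
  have : c - d = c + (-1 : ℝ) • d := by simp [sub_eq_add_neg]
  rw [this, tapOutput_add, tapOutput_smul]; simp [sub_eq_add_neg]

theorem measurable_tapResponse (c : (Fin M × ℝ) →₀ ℝ) (m : Fin M) :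
    Measurable fun f => tapResponse c f m := by
  unfold tapResponse Finsupp.sum
  refine Finset.measurable_sum _ fun p _ => ?_
  beta_reduce
  split_ifs
  · fun_prop
  · exact measurable_const

/-- The tapped delay line whose taps are delayed by `t`. -/
def shiftTaps (t : ℝ) (c : (Fin M × ℝ) →₀ ℝ) : (Fin M × ℝ) →₀ ℝ :=
  c.mapDomain fun p => (p.1, p.2 + t)

theorem tapResponse_shiftTaps (t : ℝ) (c : (Fin M × ℝ) →₀ ℝ) (f : ℝ) (m : Fin M) :
    tapResponse (shiftTaps t c) f m
      = Complex.exp (2 * Real.pi * Complex.I * f * t) * tapResponse c f m := by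
  unfold tapResponse shiftTaps
  rw [Finsupp.sum_mapDomain_index (fun p => by simp)
    (fun p a b => by split_ifs <;> simp [add_mul]), Finsupp.sum, Finsupp.sum, Finset.mul_sum]
  refine Finset.sum_congr rfl fun p _ => ?_
  simp only
  split_ifs
  · push_cast
    rw [mul_add, Complex.exp_add]; ring
  · simp

variable {Ω : Type*} [MeasurableSpace Ω] {P : Measure Ω} {x : Fin M → ℝ → Ω → ℝ}
  {C : ℝ → Matrix (Fin M) (Fin M) ℂ}

theorem memLp_tapOutput (hx : IsWSS P x C) (c : (Fin M × ℝ) →₀ ℝ) :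
    MemLp (tapOutput x c) 2 P := by
  unfold tapOutput Finsupp.sum
  exact memLp_finsetSum _ fun p _ => (hx.memLp p.1 p.2).const_mul _

theorem integrable_mul_exp (hx : IsWSS P x C) (i j : Fin M) (τ : ℝ) :
    Integrable fun f : ℝ => C f i j * Complex.exp (2 * Real.pi * Complex.I * f * τ) := by
  refine (hx.integrable i j).mul_bdd (c := 1) (by fun_prop) ?_
  refine Eventually.of_forall fun f => ?_
  rw [show 2 * Real.pi * Complex.I * f * τ = ((2 * Real.pi * f * τ : ℝ) : ℂ) * Complex.I by
    push_cast; ring, Complex.norm_exp_ofReal_mul_I]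

theorem quadForm_tapResponse (C : Matrix (Fin M) (Fin M) ℂ) (c : (Fin M × ℝ) →₀ ℝ) (f : ℝ) :
    tapResponse c f ⬝ᵥ (C *ᵥ star (tapResponse c f))
      = ∑ p ∈ c.support, ∑ q ∈ c.support, (c p : ℂ) * c q *
        (C p.1 q.1 * Complex.exp (2 * Real.pi * Complex.I * f * ((p.2 - q.2 : ℝ) : ℂ))) := by
  have hstar : ∀ m, star (tapResponse c f) m = ∑ q ∈ c.support,
      if q.1 = m then (c q : ℂ) * Complex.exp (-(2 * Real.pi * Complex.I * f * q.2)) else 0 := by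
    intro m
    simp only [Pi.star_apply, tapResponse, Finsupp.sum, star_sum]
    refine Finset.sum_congr rfl fun q _ => ?_
    split_ifs
    · simp [RCLike.star_def, ← Complex.exp_conj, Complex.conj_ofNat]
    · simp
  have hC : ∀ i, (C *ᵥ star (tapResponse c f)) i = ∑ q ∈ c.support,
      C i q.1 * ((c q : ℂ) * Complex.exp (-(2 * Real.pi * Complex.I * f * q.2))) := by
    intro i
    simp only [Matrix.mulVec, dotProduct, hstar, Finset.mul_sum]
    rw [Finset.sum_comm]
    refine Finset.sum_congr rfl fun q _ => ?_
    simp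
  simp only [dotProduct, hC, tapResponse, Finsupp.sum, Finset.sum_mul]
  rw [Finset.sum_comm]
  refine Finset.sum_congr rfl fun p _ => ?_
  simp only [ite_mul, zero_mul, Finset.sum_ite_eq, Finset.mem_univ, if_true]
  rw [Finset.mul_sum]
  refine Finset.sum_congr rfl fun q _ => ?_
  push_cast
  rw [mul_sub, Complex.exp_sub, Complex.exp_neg]
  field_simp

/-- The spectral isometry on tapped delay lines: both sides expand into double sums over the taps,
and the autocorrelation formula matches them term by term. -/
theorem integral_tapOutput_sq (hx : IsWSS P x C) (c : (Fin M × ℝ) →₀ ℝ) :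
    ∫ ω, tapOutput x c ω ^ 2 ∂P
      = ∫ f, (tapResponse c f ⬝ᵥ (C f *ᵥ star (tapResponse c f))).re := by
  have h1 : ∫ ω, tapOutput x c ω ^ 2 ∂P = ∑ p ∈ c.support, ∑ q ∈ c.support,
      c p * c q * ∫ ω, x p.1 p.2 ω * x q.1 q.2 ω ∂P := by
    have : ∀ ω, tapOutput x c ω ^ 2 = ∑ p ∈ c.support, ∑ q ∈ c.support,
        c p * c q * (x p.1 p.2 ω * x q.1 q.2 ω) := by
      intro ω
      simp only [tapOutput, Finsupp.sum, sq, Finset.sum_mul_sum]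
      exact Finset.sum_congr rfl fun p _ => Finset.sum_congr rfl fun q _ => by ring
    simp_rw [this]
    have hi : ∀ p q : Fin M × ℝ, Integrable (fun ω => c p * c q * (x p.1 p.2 ω * x q.1 q.2 ω)) P :=
      fun p q => ((hx.memLp p.1 p.2).integrable_mul (hx.memLp q.1 q.2)).const_mul _
    rw [integral_finsetSum _ fun p _ => integrable_finsetSum _ fun q _ => hi p q]
    refine Finset.sum_congr rfl fun p _ => ?_
    rw [integral_finsetSum _ fun q _ => hi p q]
    exact Finset.sum_congr rfl fun q _ => integral_const_mul _ _
  have h2 : ∫ f, (tapResponse c f ⬝ᵥ (C f *ᵥ star (tapResponse c f)))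
      = ∑ p ∈ c.support, ∑ q ∈ c.support,
        (c p : ℂ) * c q * ((∫ ω, x p.1 p.2 ω * x q.1 q.2 ω ∂P : ℝ) : ℂ) := by
    simp_rw [quadForm_tapResponse]
    have hi : ∀ p q : Fin M × ℝ, Integrable (fun f : ℝ => (c p : ℂ) * c q * (C f p.1 q.1 *
        Complex.exp (2 * Real.pi * Complex.I * f * ((p.2 - q.2 : ℝ) : ℂ)))) :=
      fun p q => (integrable_mul_exp hx _ _ _).const_mul _
    rw [integral_finsetSum _ fun p _ => integrable_finsetSum _ fun q _ => hi p q]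
    refine Finset.sum_congr rfl fun p _ => ?_
    rw [integral_finsetSum _ fun q _ => hi p q]
    refine Finset.sum_congr rfl fun q _ => ?_
    rw [integral_const_mul, ← hx.autocorr p.1 q.1 q.2 (p.2 - q.2)]
    simp
  have h3 : Integrable fun f => tapResponse c f ⬝ᵥ (C f *ᵥ star (tapResponse c f)) := by
    simp_rw [quadForm_tapResponse]
    exact integrable_finsetSum _ fun p _ => integrable_finsetSum _ fun q _ =>
      (integrable_mul_exp hx _ _ _).const_mul _
  have h4 := integral_re h3
  simp only [RCLike.re_to_complex] at h4
  rw [h4, h2, h1]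
  simp only [Complex.re_sum, ← Complex.ofReal_mul, Complex.ofReal_re]

theorem specNormSq_tapResponse (hx : IsWSS P x C) (c : (Fin M × ℝ) →₀ ℝ) :
    specNormSq C (tapResponse c) = eLpNorm (tapOutput x c) 2 P ^ 2 := by
  have h3 : Integrable fun f => (tapResponse c f ⬝ᵥ (C f *ᵥ star (tapResponse c f))).re := by
    refine Integrable.re (𝕜 := ℂ)
      (f := fun f => tapResponse c f ⬝ᵥ (C f *ᵥ star (tapResponse c f))) ?_
    simp_rw [quadForm_tapResponse]
    exact integrable_finsetSum _ fun p _ => integrable_finsetSum _ fun q _ =>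
      (integrable_mul_exp hx _ _ _).const_mul _
  rw [specNormSq, ← ofReal_integral_eq_lintegral_ofReal h3
    (Eventually.of_forall fun f => by
      simp only [Pi.zero_apply]; rw [quadForm_eq (hx.posSemidef f)]; positivity),
    ← integral_tapOutput_sq hx,
    ofReal_integral_eq_lintegral_ofReal (memLp_tapOutput hx c).integrable_sq
      (Eventually.of_forall fun ω => sq_nonneg _),
    eLpNorm_eq_lintegral_rpow_enorm_toReal (by simp) (by simp), ← ENNReal.rpow_natCast,
    ← ENNReal.rpow_mul]
  simp only [ENNReal.toReal_ofNat, ENNReal.rpow_ofNat, Nat.cast_ofNat]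
  norm_num
  refine lintegral_congr fun ω => ?_
  rw [← sq_abs, ENNReal.ofReal_pow (abs_nonneg _), ← Real.norm_eq_abs, ofReal_norm]

theorem eLpNorm_tapOutput (hx : IsWSS P x C) (c : (Fin M × ℝ) →₀ ℝ) :
    eLpNorm (tapOutput x c) 2 P = eLpNorm (specVec C (tapResponse c)) 2 volume := by
  have h := (specNormSq_tapResponse hx c).symm.trans (specNormSq_eq hx.posSemidef _)
  exact (ENNReal.pow_right_strictMono two_ne_zero).injective h

end

/-! ### The spectral isometry -/

theorem measurable_signal {Ω : Type*} {M : ℕ} (x : Fin M → ℝ → Ω → ℝ) (m : Fin M) (t : ℝ) :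
    Measurable[signalSigma x] (x m t) := by
  rw [measurable_iff_comap_le]
  exact le_iSup_of_le m (le_iSup (fun t => MeasurableSpace.comap (x m t) inferInstance) t)

theorem stronglyMeasurable_tapOutput {Ω : Type*} {M : ℕ} (x : Fin M → ℝ → Ω → ℝ) (c : (Fin M × ℝ) →₀ ℝ) :
    StronglyMeasurable[signalSigma x] (tapOutput x c) := by
  refine Measurable.stronglyMeasurable ?_
  unfold tapOutput Finsupp.sum
  exact Finset.measurable_sum _ fun p _ => (measurable_signal x p.1 p.2).const_mul _

section

variable {Ω : Type*} [MeasurableSpace Ω] {P : Measure Ω} {M : ℕ} {x : Fin M → ℝ → Ω → ℝ}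
  {C : ℝ → Matrix (Fin M) (Fin M) ℂ}

/-- `Y` is the spectral stochastic integral of the response `v`. -/
def IsSpec (P : Measure Ω) (x : Fin M → ℝ → Ω → ℝ) (C : ℝ → Matrix (Fin M) (Fin M) ℂ)
    (v : ℝ → Fin M → ℂ) (Y : Ω → ℝ) : Prop :=
  MemLp Y 2 P ∧ ∃ c : ℕ → (Fin M × ℝ) →₀ ℝ,
    Tendsto (fun r => eLpNorm (Y - tapOutput x (c r)) 2 P) atTop (𝓝 0) ∧
    Tendsto (fun r => eLpNorm (specVec C v - specVec C (tapResponse (c r))) 2 volume) atTop (𝓝 0)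

/-- The time `t` becomes a phase in the response, and the squared norm in `L²(C)` becomes a norm. -/
theorem isFilterOutput_iff_isSpec (hp : ∀ f, (C f).PosSemidef) {g : ℝ → Fin M → ℂ} {t : ℝ}
    {Y : Ω → ℝ} :
    IsFilterOutput P x C g t Y ↔
      IsSpec P x C (fun f m => Complex.exp (2 * Real.pi * Complex.I * f * t) * g f m) Y := by
  unfold IsFilterOutput IsSpec
  refine and_congr_right fun _ => exists_congr fun c => and_congr_right fun _ => ?_
  simp_rw [specNormSq_eq hp]
  have h : ∀ r, specVec C (fun f m =>
      g f m * Complex.exp (2 * Real.pi * Complex.I * f * t) - tapResponse (c r) f m)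
      = specVec C (fun f m => Complex.exp (2 * Real.pi * Complex.I * f * t) * g f m)
        - specVec C (tapResponse (c r)) := by
    intro r
    rw [← specVec_sub]
    simp_rw [mul_comm]
  simp_rw [h]
  constructor
  · intro h
    have h2 := ((ENNReal.continuous_rpow_const (y := (1 / 2 : ℝ))).tendsto 0).comp h
    simp only [Function.comp_def, ← ENNReal.rpow_natCast, ← ENNReal.rpow_mul] at h2
    simpa using h2
  · intro h
    simpa [Function.comp_def] using ((ENNReal.continuous_pow 2).tendsto 0).comp h

theorem IsSpec.memLp {v : ℝ → Fin M → ℂ} {Y : Ω → ℝ} (h : IsSpec P x C v Y) : MemLp Y 2 P := h.1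

theorem isSpec_zero : IsSpec P x C (fun _ _ => 0) (0 : Ω → ℝ) := by
  refine ⟨MemLp.zero', fun _ => 0, ?_, ?_⟩
  · have : (0 : Ω → ℝ) - tapOutput x 0 = 0 := by funext ω; simp [tapOutput]
    simp [this]
  · have : tapResponse (0 : (Fin M × ℝ) →₀ ℝ) = fun _ _ => 0 := by
      funext f m; simp [tapResponse]
    simp [this]

theorem IsSpec.add (hx : IsWSS P x C) (hC : ∀ i j, Measurable fun f => C f i j)
    {v w : ℝ → Fin M → ℂ} {Y Z : Ω → ℝ}
    (hv : ∀ m, Measurable fun f => v f m) (hw : ∀ m, Measurable fun f => w f m)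
    (h : IsSpec P x C v Y) (h' : IsSpec P x C w Z) :
    IsSpec P x C (fun f m => v f m + w f m) (Y + Z) := by
  obtain ⟨hY, c, hc1, hc2⟩ := h
  obtain ⟨hZ, d, hd1, hd2⟩ := h'
  refine ⟨hY.add hZ, fun r => c r + d r, ?_, ?_⟩
  · refine tendsto_of_tendsto_of_tendsto_of_le_of_le tendsto_const_nhds
      (by simpa using hc1.add hd1) (fun _ => bot_le) fun r => ?_
    have : Y + Z - tapOutput x (c r + d r) = (Y - tapOutput x (c r)) + (Z - tapOutput x (d r)) := by
      funext ω; simp [tapOutput_add]; ring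
    simp only [this]
    exact eLpNorm_add_le (hY.sub (memLp_tapOutput hx _)).1 (hZ.sub (memLp_tapOutput hx _)).1
      (by norm_num)
  · refine tendsto_of_tendsto_of_tendsto_of_le_of_le tendsto_const_nhds
      (by simpa using hc2.add hd2) (fun _ => bot_le) fun r => ?_
    have : specVec C (fun f m => v f m + w f m) - specVec C (tapResponse (c r + d r))
        = (specVec C v - specVec C (tapResponse (c r)))
          + (specVec C w - specVec C (tapResponse (d r))) := by
      have h2 : tapResponse (c r + d r)
          = fun f m => tapResponse (c r) f m + tapResponse (d r) f m := by
        funext f m; exact tapResponse_add _ _ _ _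
      rw [h2, specVec_add, specVec_add]; abel
    simp only [this]
    have hm := fun {v} hv => measurable_specVec (v := v) hC hx.posSemidef hv
    exact eLpNorm_add_le
      ((hm hv).sub (hm (measurable_tapResponse _))).aestronglyMeasurable
      ((hm hw).sub (hm (measurable_tapResponse _))).aestronglyMeasurable (by norm_num)

theorem IsSpec.const_mul {v : ℝ → Fin M → ℂ} {Y : Ω → ℝ} (a : ℝ) (h : IsSpec P x C v Y) :
    IsSpec P x C (fun f m => a * v f m) (a • Y) := by
  obtain ⟨hY, c, hc1, hc2⟩ := h
  have ha : (‖a‖ₑ : ℝ≥0∞) ≠ ∞ := by simp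
  refine ⟨hY.const_smul a, fun r => a • c r, ?_, ?_⟩
  · have h1 : ∀ r, a • Y - tapOutput x (a • c r) = a • (Y - tapOutput x (c r)) := by
      intro r; funext ω; simp [tapOutput_smul]; ring
    simp_rw [h1, eLpNorm_const_smul]
    simpa using ENNReal.Tendsto.const_mul hc1 (Or.inr ha)
  · have h1 : ∀ r, specVec C (fun f m => (a : ℂ) * v f m) - specVec C (tapResponse (a • c r))
        = (a : ℂ) • (specVec C v - specVec C (tapResponse (c r))) := by
      intro r
      have h2 : tapResponse (a • c r) = fun f m => (a : ℂ) * tapResponse (c r) f m := by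
        funext f m; exact tapResponse_smul _ _ _ _
      funext f
      rw [h2, Pi.sub_apply, specVec_smul, specVec_smul, ← smul_sub]; rfl
    simp_rw [h1, eLpNorm_const_smul]
    simpa using ENNReal.Tendsto.const_mul hc2 (Or.inr (by simp : ‖(a : ℂ)‖ₑ ≠ ∞))

theorem IsSpec.sum (hx : IsWSS P x C) (hC : ∀ i j, Measurable fun f => C f i j) {ι : Type*}
    (s : Finset ι) {v : ι → ℝ → Fin M → ℂ} {Y : ι → Ω → ℝ} (a : ι → ℝ)
    (hv : ∀ i m, Measurable fun f => v i f m) (h : ∀ i ∈ s, IsSpec P x C (v i) (Y i)) :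
    IsSpec P x C (fun f m => ∑ i ∈ s, a i * v i f m) (∑ i ∈ s, a i • Y i) := by
  classical
  induction s using Finset.induction_on with
  | empty => simpa using isSpec_zero
  | insert i s hi ih =>
    simp_rw [Finset.sum_insert hi]
    refine IsSpec.add hx hC (fun m => (hv i m).const_mul _)
      (fun m => Finset.measurable_sum _ fun j _ => (hv j m).const_mul _) ?_ ?_
    · exact (h i (Finset.mem_insert_self _ _)).const_mul _
    · exact ih fun j hj => h j (Finset.mem_insert_of_mem hj)

theorem IsSpec.sub (hx : IsWSS P x C) (hC : ∀ i j, Measurable fun f => C f i j)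
    {v w : ℝ → Fin M → ℂ} {Y Z : Ω → ℝ}
    (hv : ∀ m, Measurable fun f => v f m) (hw : ∀ m, Measurable fun f => w f m)
    (h : IsSpec P x C v Y) (h' : IsSpec P x C w Z) :
    IsSpec P x C (fun f m => v f m - w f m) (Y - Z) := by
  have := IsSpec.add hx hC hv (fun m => (hw m).const_mul _) h (h'.const_mul (-1))
  convert this using 1
  · funext f m; simp [sub_eq_add_neg]
  · simp [sub_eq_add_neg]

/-- The isometry passes from tapped delay lines to their limits, by the triangle inequality in both
directions. -/
theorem IsSpec.eLpNorm_eq (hx : IsWSS P x C) (hC : ∀ i j, Measurable fun f => C f i j)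
    {v : ℝ → Fin M → ℂ} {Y : Ω → ℝ} (hv : ∀ m, Measurable fun f => v f m)
    (h : IsSpec P x C v Y) : eLpNorm Y 2 P = eLpNorm (specVec C v) 2 volume := by
  obtain ⟨hY, c, hc1, hc2⟩ := h
  have hm := fun {v} hv => measurable_specVec (v := v) hC hx.posSemidef hv
  have hlim := hc1.add hc2
  rw [add_zero] at hlim
  apply le_antisymm
  · refine ge_of_tendsto' (x := atTop) (by simpa using hlim.add_const _) fun r => ?_
    calc eLpNorm Y 2 P = eLpNorm ((Y - tapOutput x (c r)) + tapOutput x (c r)) 2 P := by simp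
      _ ≤ eLpNorm (Y - tapOutput x (c r)) 2 P + eLpNorm (tapOutput x (c r)) 2 P :=
        eLpNorm_add_le (hY.sub (memLp_tapOutput hx _)).1 (memLp_tapOutput hx _).1 (by norm_num)
      _ = eLpNorm (Y - tapOutput x (c r)) 2 P
          + eLpNorm (specVec C v - (specVec C v - specVec C (tapResponse (c r)))) 2 volume := by
        rw [eLpNorm_tapOutput hx, sub_sub_cancel]
      _ ≤ eLpNorm (Y - tapOutput x (c r)) 2 P + (eLpNorm (specVec C v) 2 volume
          + eLpNorm (specVec C v - specVec C (tapResponse (c r))) 2 volume) := by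
        gcongr
        exact eLpNorm_sub_le (hm hv).aestronglyMeasurable
          ((hm hv).sub (hm (measurable_tapResponse _))).aestronglyMeasurable (by norm_num)
      _ = _ := by ring
  · refine ge_of_tendsto' (x := atTop) (by simpa using hlim.add_const _) fun r => ?_
    calc eLpNorm (specVec C v) 2 volume
        = eLpNorm ((specVec C v - specVec C (tapResponse (c r)))
          + specVec C (tapResponse (c r))) 2 volume := by simp
      _ ≤ eLpNorm (specVec C v - specVec C (tapResponse (c r))) 2 volume
          + eLpNorm (specVec C (tapResponse (c r))) 2 volume :=
        eLpNorm_add_le ((hm hv).sub (hm (measurable_tapResponse _))).aestronglyMeasurable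
          (hm (measurable_tapResponse _)).aestronglyMeasurable (by norm_num)
      _ = eLpNorm (specVec C v - specVec C (tapResponse (c r))) 2 volume
          + eLpNorm (Y - (Y - tapOutput x (c r))) 2 P := by
        rw [← eLpNorm_tapOutput hx, sub_sub_cancel]
      _ ≤ eLpNorm (specVec C v - specVec C (tapResponse (c r))) 2 volume
          + (eLpNorm Y 2 P + eLpNorm (Y - tapOutput x (c r)) 2 P) := by
        gcongr
        exact eLpNorm_sub_le hY.1 (hY.sub (memLp_tapOutput hx _)).1 (by norm_num)
      _ = _ := by ring

theorem enorm_exp_two_pi_mul (f t : ℝ) :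
    ‖Complex.exp (2 * Real.pi * Complex.I * f * t)‖ₑ = 1 := by
  rw [← ofReal_norm, show 2 * Real.pi * Complex.I * f * t
    = ((2 * Real.pi * f * t : ℝ) : ℂ) * Complex.I by push_cast; ring,
    Complex.norm_exp_ofReal_mul_I]; simp

theorem eLpNorm_specVec_exp_mul (v : ℝ → Fin M → ℂ) (t : ℝ) :
    eLpNorm (specVec C fun f m => Complex.exp (2 * Real.pi * Complex.I * f * t) * v f m) 2 volume
      = eLpNorm (specVec C v) 2 volume := by
  refine eLpNorm_congr_enorm_ae (Eventually.of_forall fun f => ?_)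
  rw [specVec_smul, enorm_smul, enorm_exp_two_pi_mul, one_mul]

theorem measurable_exp_mul {v : ℝ → Fin M → ℂ} (hv : ∀ m, Measurable fun f => v f m) (t : ℝ)
    (m : Fin M) :
    Measurable fun f : ℝ => Complex.exp (2 * Real.pi * Complex.I * f * t) * v f m :=
  Measurable.mul (by fun_prop) (hv m)

/-- Delaying all taps multiplies the response by a unimodular phase, so the delayed outputs stay as
close to each other as the original ones and converge in `L²`. A front end must have an output at
every time, and this supplies it. -/
theorem IsSpec.exists_shift (hx : IsWSS P x C)
    {v : ℝ → Fin M → ℂ} {Y : Ω → ℝ} (h : IsSpec P x C v Y) (t : ℝ) :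
    ∃ Z, IsSpec P x C (fun f m => Complex.exp (2 * Real.pi * Complex.I * f * t) * v f m) Z := by
  obtain ⟨hY, c, hc1, hc2⟩ := h
  have hsh : ∀ c : (Fin M × ℝ) →₀ ℝ, tapResponse (shiftTaps t c)
      = fun (f : ℝ) m => Complex.exp (2 * Real.pi * Complex.I * f * t) * tapResponse c f m := by
    intro c; funext f m; exact tapResponse_shiftTaps _ _ _ _
  -- extract a subsequence that converges geometrically
  have hev : ∀ k : ℕ, ∃ r, ∀ r' ≥ r, eLpNorm (Y - tapOutput x (c r')) 2 P < (2⁻¹ : ℝ≥0∞) ^ (k + 1) :=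
    fun k => eventually_atTop.1 ((tendsto_order.1 hc1).2 _
      (ENNReal.pow_pos (by simp) _))
  choose r hr using hev
  -- The sum dominates `r j` for every `j ≤ k`, and the summand `k` makes the sequence tend to
  -- infinity.
  let ns : ℕ → ℕ := fun k => k + ∑ j ∈ Finset.range (k + 1), r j
  have hns : ∀ k, ∀ k' ≥ k, r k ≤ ns k' := by
    intro k k' hk
    have := Finset.single_le_sum (f := r) (s := Finset.range (k' + 1)) (fun _ _ => Nat.zero_le _)
      (Finset.mem_range.2 (by omega : k < k' + 1))
    simp only [ns]; omega
  have hnst : Tendsto ns atTop atTop :=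
    tendsto_atTop_mono (fun k => by simp only [ns, id]; omega) tendsto_id
  have hdist : ∀ a b, eLpNorm (tapOutput x (shiftTaps t (c a)) - tapOutput x (shiftTaps t (c b))) 2 P
      = eLpNorm (tapOutput x (c a) - tapOutput x (c b)) 2 P := by
    intro a b
    have e1 : tapOutput x (shiftTaps t (c a)) - tapOutput x (shiftTaps t (c b))
        = tapOutput x (shiftTaps t (c a) - shiftTaps t (c b)) := by
      funext ω; simp [tapOutput_sub]
    have e2 : tapOutput x (c a) - tapOutput x (c b) = tapOutput x (c a - c b) := by
      funext ω; simp [tapOutput_sub]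
    have e3 : tapResponse (shiftTaps t (c a) - shiftTaps t (c b))
        = fun (f : ℝ) m => Complex.exp (2 * Real.pi * Complex.I * f * t) * tapResponse (c a - c b) f m := by
      funext f m
      simp only [tapResponse_sub, tapResponse_shiftTaps]; ring
    rw [e1, e2, eLpNorm_tapOutput hx, eLpNorm_tapOutput hx, e3, eLpNorm_specVec_exp_mul]
  obtain ⟨Z, hZ, hZlim⟩ := Lp.cauchy_complete_eLpNorm (p := 2) (μ := P) (by norm_num)
    (f := fun k => tapOutput x (shiftTaps t (c (ns k))))
    (fun k => memLp_tapOutput hx _) (B := fun k => (2⁻¹ : ℝ≥0∞) ^ k)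
    (by rw [ENNReal.tsum_geometric]; simp) (by
      intro N n m hn hm'
      rw [hdist]
      calc eLpNorm (tapOutput x (c (ns n)) - tapOutput x (c (ns m))) 2 P
          = eLpNorm ((Y - tapOutput x (c (ns m))) - (Y - tapOutput x (c (ns n)))) 2 P := by
            congr 1; abel
        _ ≤ eLpNorm (Y - tapOutput x (c (ns m))) 2 P + eLpNorm (Y - tapOutput x (c (ns n))) 2 P :=
          eLpNorm_sub_le (hY.sub (memLp_tapOutput hx _)).1 (hY.sub (memLp_tapOutput hx _)).1
            (by norm_num)
        _ < (2⁻¹ : ℝ≥0∞) ^ (N + 1) + (2⁻¹ : ℝ≥0∞) ^ (N + 1) :=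
          ENNReal.add_lt_add (hr N _ (hns N m hm')) (hr N _ (hns N n hn))
        _ = (2⁻¹ : ℝ≥0∞) ^ N := by
          rw [pow_succ, ← mul_add, ENNReal.inv_two_add_inv_two, mul_one])
  refine ⟨Z, hZ, fun k => shiftTaps t (c (ns k)), ?_, ?_⟩
  · refine hZlim.congr fun k => ?_
    rw [← eLpNorm_neg, neg_sub]
  · refine (hc2.comp hnst).congr fun k => ?_
    simp only [Function.comp]
    rw [hsh, ← specVec_sub, ← specVec_sub, ← eLpNorm_specVec_exp_mul _ t]
    congr 2
    funext f m; ring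

theorem signalSigma_le (hx : IsWSS P x C) : signalSigma x ≤ (inferInstance : MeasurableSpace Ω) :=
  iSup_le fun m => iSup_le fun t => (hx.measurable m t).comap_le

/-- Conditioning fixes tap outputs and contracts `L¹`, hence it also fixes their limits. Filter
outputs thus inherit independence from the dither, and orthogonality to the error of the best
estimate. -/
theorem IsSpec.ae_eq_condExp [IsProbabilityMeasure P] (hx : IsWSS P x C) {v : ℝ → Fin M → ℂ}
    {Y : Ω → ℝ} (h : IsSpec P x C v Y) : Y =ᵐ[P] P[Y | signalSigma x] := by
  obtain ⟨hY, c, hc1, -⟩ := h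
  have hle := signalSigma_le hx
  have hYi : Integrable Y P := hY.integrable (by norm_num)
  have key : eLpNorm (Y - P[Y | signalSigma x]) 1 P ≤ 0 := by
    refine ge_of_tendsto' (x := atTop) (f := fun r => 2 * eLpNorm (Y - tapOutput x (c r)) 2 P)
      (by simpa using ENNReal.Tendsto.const_mul hc1 (Or.inr (by simp : (2 : ℝ≥0∞) ≠ ∞))) fun r => ?_
    have hT := memLp_tapOutput hx (c r)
    have hTi : Integrable (tapOutput x (c r)) P := hT.integrable (by norm_num)
    have hce : P[Y - tapOutput x (c r) | signalSigma x]
        =ᵐ[P] P[Y | signalSigma x] - tapOutput x (c r) := by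
      refine (condExp_sub hYi hTi _).trans ?_
      rw [condExp_of_stronglyMeasurable hle (stronglyMeasurable_tapOutput x _) hTi]
    have h1 : eLpNorm (Y - tapOutput x (c r)) 1 P ≤ eLpNorm (Y - tapOutput x (c r)) 2 P :=
      eLpNorm_le_eLpNorm_of_exponent_le (by norm_num) (hYi.sub hTi).1
    calc eLpNorm (Y - P[Y | signalSigma x]) 1 P
        = eLpNorm ((Y - tapOutput x (c r)) - (P[Y | signalSigma x] - tapOutput x (c r))) 1 P := by
          congr 1; abel
      _ ≤ eLpNorm (Y - tapOutput x (c r)) 1 P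
          + eLpNorm (P[Y | signalSigma x] - tapOutput x (c r)) 1 P :=
        eLpNorm_sub_le (hYi.sub hTi).1 (integrable_condExp.sub hTi).1 le_rfl
      _ ≤ eLpNorm (Y - tapOutput x (c r)) 1 P + eLpNorm (Y - tapOutput x (c r)) 1 P := by
        gcongr
        rw [← eLpNorm_congr_ae hce]
        exact eLpNorm_condExp_le_eLpNorm _ le_rfl
      _ ≤ 2 * eLpNorm (Y - tapOutput x (c r)) 2 P := by
        rw [two_mul]; gcongr
  have h0 := (eLpNorm_eq_zero_iff (hYi.sub integrable_condExp).1 one_ne_zero).1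
    (le_antisymm key (bot_le))
  filter_upwards [h0] with ω hω
  exact sub_eq_zero.1 hω

end

/-! ### Modifying the spectral density on a null set -/

/-- The spectral density `C` with its values on `Z` replaced by zero. -/
def zeroOn {M : ℕ} (Z : Set ℝ) (C : ℝ → Matrix (Fin M) (Fin M) ℂ) (f : ℝ) :
    Matrix (Fin M) (Fin M) ℂ :=
  open Classical in if f ∈ Z then 0 else C f

section

variable {M : ℕ} {C : ℝ → Matrix (Fin M) (Fin M) ℂ} {Z : Set ℝ}

theorem zeroOn_of_mem {f : ℝ} (h : f ∈ Z) : zeroOn Z C f = 0 := if_pos h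

theorem zeroOn_of_notMem {f : ℝ} (h : f ∉ Z) : zeroOn Z C f = C f := if_neg h

theorem zeroOn_ae_eq (hZ : volume Z = 0) : zeroOn Z C =ᵐ[volume] C := by
  have : ∀ᵐ f, f ∉ Z := by simpa [ae_iff] using hZ
  filter_upwards [this] with f hf using zeroOn_of_notMem hf

theorem zeroOn_eq_indicator (i j : Fin M) :
    (fun f => zeroOn Z C f i j) = Zᶜ.indicator fun f => C f i j := by
  funext f
  by_cases h : f ∈ Z
  · simp [zeroOn_of_mem h, h]
  · simp [zeroOn_of_notMem h, h]

theorem zeroOn_posSemidef (hp : ∀ f, (C f).PosSemidef) (f : ℝ) : (zeroOn Z C f).PosSemidef := by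
  by_cases h : f ∈ Z
  · rw [zeroOn_of_mem h]; exact Matrix.PosSemidef.zero
  · rw [zeroOn_of_notMem h]; exact hp f

/-- Zeroing on a null set, rather than taking an arbitrary measurable representative, keeps the
matrices positive semidefinite everywhere and cannot raise the rank of the aliased response. -/
theorem exists_measurable_zeroOn (hC : ∀ i j, AEStronglyMeasurable (fun f => C f i j) volume) :
    ∃ Z : Set ℝ, MeasurableSet Z ∧ volume Z = 0 ∧
      ∀ i j, Measurable fun f => zeroOn Z C f i j := by
  let Z := toMeasurable volume {f | ¬ ∀ i j, C f i j = (hC i j).mk _ f}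
  have hZ : MeasurableSet Z := measurableSet_toMeasurable _ _
  refine ⟨Z, hZ, ?_, fun i j => ?_⟩
  · rw [measure_toMeasurable, ← ae_iff]
    exact ae_all_iff.2 fun i => ae_all_iff.2 fun j => (hC i j).ae_eq_mk
  · rw [zeroOn_eq_indicator]
    have : Zᶜ.indicator (fun f => C f i j) = Zᶜ.indicator ((hC i j).mk _) := by
      refine Set.indicator_congr fun f hf => ?_
      by_contra h
      exact hf (subset_toMeasurable _ _ fun h' => h (h' i j))
    rw [this]
    exact (hC i j).stronglyMeasurable_mk.measurable.indicator hZ.compl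

end

section

variable {Ω : Type*} [MeasurableSpace Ω] {P : Measure Ω} {M : ℕ} {x : Fin M → ℝ → Ω → ℝ}
  {C C' : ℝ → Matrix (Fin M) (Fin M) ℂ}

theorem IsWSS.congr (h : IsWSS P x C) (hCC : C =ᵐ[volume] C') (hp : ∀ f, (C' f).PosSemidef) :
    IsWSS P x C' where
  measurable := h.measurable
  memLp := h.memLp
  mean_zero := h.mean_zero
  posSemidef := hp
  integrable i j := (h.integrable i j).congr (by filter_upwards [hCC] with f hf using by rw [hf])
  autocorr i j t τ := by
    rw [h.autocorr]
    exact integral_congr_ae (by filter_upwards [hCC] with f hf using by rw [hf])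

theorem specNormSq_congr (hCC : C =ᵐ[volume] C') (v : ℝ → Fin M → ℂ) :
    specNormSq C v = specNormSq C' v :=
  lintegral_congr_ae (by filter_upwards [hCC] with f hf using by rw [hf])

theorem isFilterOutput_congr (hCC : C =ᵐ[volume] C') {g : ℝ → Fin M → ℂ} {t : ℝ} {Y : Ω → ℝ} :
    IsFilterOutput P x C g t Y ↔ IsFilterOutput P x C' g t Y := by
  unfold IsFilterOutput
  simp_rw [specNormSq_congr hCC]

theorem isFrontEnd_congr (hCC : C =ᵐ[volume] C') {K : ℕ} {w : ℕ → ℤ → Ω → ℝ} {η fs b γ : ℝ}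
    {H : ℝ → Matrix (Fin K) (Fin M) ℂ} {y : Fin K → ℝ → Ω → ℝ} :
    IsFrontEnd P x C w η fs b H y γ ↔ IsFrontEnd P x C' w η fs b H y γ :=
  ⟨fun h => ⟨h.1, fun k t => (isFilterOutput_congr hCC).1 (h.2 k t), h.3, h.4⟩,
    fun h => ⟨h.1, fun k t => (isFilterOutput_congr hCC).2 (h.2 k t), h.3, h.4⟩⟩

theorem minMSE_congr (hCC : C =ᵐ[volume] C') {N : ℕ} (s : Fin N → Ω → ℝ) (w : ℕ → ℤ → Ω → ℝ)
    (η fs : ℝ) (K : ℕ) (b : ℝ) :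
    minMSE P x C s w η fs K b = minMSE P x C' s w η fs K b := by
  unfold minMSE
  simp_rw [isFrontEnd_congr hCC]

theorem IsLinearTask.congr (hCC : C =ᵐ[volume] C') {N : ℕ} {s : Fin N → Ω → ℝ}
    {Γ : ℝ → Matrix (Fin N) (Fin M) ℂ} (h : IsLinearTask P x C Γ s) :
    IsLinearTask P x C' Γ s :=
  ⟨h.1, h.2, h.3, h.4, fun i => (isFilterOutput_congr hCC).1 (h.5 i)⟩

end

/-! ### Conjugate symmetry -/

theorem charFun_withDensity_eq {g : ℝ → ℝ} (hg : Integrable g) (t : ℝ) :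
    charFun (volume.withDensity fun f => ENNReal.ofReal (g f)) t
      = ∫ f : ℝ, ((max (g f) 0 : ℝ) : ℂ) * Complex.exp (t * f * Complex.I) := by
  rw [charFun_apply_real, integral_withDensity_eq_integral_toReal_smul₀ hg.1.aemeasurable.ennreal_ofReal
    (by simp)]
  refine integral_congr_ae (Eventually.of_forall fun f => ?_)
  simp [ENNReal.toReal_ofReal', Complex.real_smul]

/-- The positive and negative parts of `g` are densities of finite measures with the same
characteristic function. The parts therefore agree almost everywhere, and at each point at least one
of them is zero. -/
theorem ae_eq_zero_of_fourier_eq_zero_real {g : ℝ → ℝ} (hg : Integrable g)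
    (h : ∀ t : ℝ, ∫ f : ℝ, (g f : ℂ) * Complex.exp (t * f * Complex.I) = 0) : g =ᵐ[volume] 0 := by
  have hi : ∀ {g : ℝ → ℝ}, Integrable g → ∀ t : ℝ,
      Integrable fun f : ℝ => (g f : ℂ) * Complex.exp (t * f * Complex.I) := by
    intro g hg t
    refine (hg.ofReal (𝕜 := ℂ)).mul_bdd (c := 1) (by fun_prop) (Eventually.of_forall fun f => ?_)
    rw [← Complex.ofReal_mul, Complex.norm_exp_ofReal_mul_I]
  have hfin : ∀ {g : ℝ → ℝ}, Integrable g →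
      IsFiniteMeasure (volume.withDensity fun f => ENNReal.ofReal (g f)) := fun hg =>
    isFiniteMeasure_withDensity_ofReal hg.2
  have := hfin hg
  have := hfin hg.neg
  have heq : volume.withDensity (fun f => ENNReal.ofReal (g f))
      = volume.withDensity (fun f => ENNReal.ofReal ((-g) f)) := by
    refine Measure.ext_of_charFun (funext fun t => ?_)
    rw [charFun_withDensity_eq hg, charFun_withDensity_eq hg.neg, ← sub_eq_zero,
      ← integral_sub (hi hg.pos_part t) (hi hg.neg.pos_part t), ← h t]
    refine integral_congr_ae (Eventually.of_forall fun f => ?_)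
    simp only [Pi.neg_apply]
    rw [← sub_mul, ← Complex.ofReal_sub]
    congr 2
    rcases le_total (g f) 0 with h | h
    · rw [max_eq_right h, max_eq_left (by linarith)]; ring
    · rw [max_eq_left h, max_eq_right (by linarith)]; ring
  have hlt : ∀ {g : ℝ → ℝ}, Integrable g → ∫⁻ f, ENNReal.ofReal (g f) ≠ ∞ := fun hg =>
    (lt_of_le_of_lt (lintegral_mono fun f => Real.ofReal_le_enorm _) hg.2).ne
  have hae := (withDensity_eq_iff hg.1.aemeasurable.ennreal_ofReal
    hg.neg.1.aemeasurable.ennreal_ofReal (hlt hg)).1 heq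
  filter_upwards [hae] with f hf
  rcases lt_trichotomy (g f) 0 with h | h | h
  · rw [ENNReal.ofReal_of_nonpos h.le] at hf
    have := (ENNReal.ofReal_eq_zero.1 hf.symm)
    simp only [Pi.neg_apply] at this; linarith
  · exact h
  · rw [ENNReal.ofReal_of_nonpos (p := (-g) f) (by simp; exact h.le)] at hf
    have := (ENNReal.ofReal_eq_zero.1 hf); linarith

/-- The transform of the conjugate vanishes too (conjugate at `-t`), so the real case applies to the
real and imaginary parts. -/
theorem ae_eq_zero_of_fourier_eq_zero {g : ℝ → ℂ} (hg : Integrable g)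
    (h : ∀ t : ℝ, ∫ f : ℝ, g f * Complex.exp (t * f * Complex.I) = 0) : g =ᵐ[volume] 0 := by
  have hi : ∀ {g : ℝ → ℂ}, Integrable g → ∀ t : ℝ,
      Integrable fun f : ℝ => g f * Complex.exp (t * f * Complex.I) := by
    intro g hg t
    refine hg.mul_bdd (c := 1) (by fun_prop) (Eventually.of_forall fun f => ?_)
    rw [← Complex.ofReal_mul, Complex.norm_exp_ofReal_mul_I]
  have hc : Integrable fun f => (starRingEnd ℂ) (g f) :=
    hg.congr' (Complex.continuous_conj.comp_aestronglyMeasurable hg.1) (by simp)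
  have hconj : ∀ t : ℝ, ∫ f : ℝ, (starRingEnd ℂ) (g f) * Complex.exp (t * f * Complex.I) = 0 := by
    intro t
    have := congrArg (starRingEnd ℂ) (h (-t))
    rw [← integral_conj, map_zero] at this
    rw [← this]
    refine integral_congr_ae (Eventually.of_forall fun f => ?_)
    simp [← Complex.exp_conj]
  have hre : (fun f => (g f).re) =ᵐ[volume] 0 := by
    refine ae_eq_zero_of_fourier_eq_zero_real hg.re fun t => ?_
    have h1 : ∀ f, (((g f).re : ℝ) : ℂ) * Complex.exp (t * f * Complex.I)
        = (1 / 2) * (g f * Complex.exp (t * f * Complex.I)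
          + (starRingEnd ℂ) (g f) * Complex.exp (t * f * Complex.I)) := fun f => by
      rw [Complex.re_eq_add_conj]; ring
    simp_rw [h1]
    rw [integral_const_mul, integral_add (hi hg t) (hi hc t), h, hconj]; simp
  have him : (fun f => (g f).im) =ᵐ[volume] 0 := by
    refine ae_eq_zero_of_fourier_eq_zero_real hg.im fun t => ?_
    have h1 : ∀ f, (((g f).im : ℝ) : ℂ) * Complex.exp (t * f * Complex.I)
        = (1 / (2 * Complex.I)) * (g f * Complex.exp (t * f * Complex.I)
          - (starRingEnd ℂ) (g f) * Complex.exp (t * f * Complex.I)) := fun f => by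
      rw [Complex.im_eq_sub_conj]; ring
    simp_rw [h1]
    rw [integral_const_mul, integral_sub (hi hg t) (hi hc t), h, hconj]; simp
  filter_upwards [hre, him] with f h1 h2
  exact Complex.ext h1 h2

section

variable {Ω : Type*} [MeasurableSpace Ω] {P : Measure Ω} {M : ℕ} {x : Fin M → ℝ → Ω → ℝ}
  {C : ℝ → Matrix (Fin M) (Fin M) ℂ}

/-- The autocorrelation is real, so `C(-f)` and the conjugate of `C(f)` have the same Fourier
transform. -/
theorem IsWSS.ae_conj_symm (hx : IsWSS P x C) (i j : Fin M) :
    ∀ᵐ f : ℝ, C (-f) i j = (starRingEnd ℂ) (C f i j) := by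
  have hneg : Integrable fun f => C (-f) i j := (hx.integrable i j).comp_neg
  have hc : Integrable fun f => (starRingEnd ℂ) (C f i j) :=
    (hx.integrable i j).congr' (Complex.continuous_conj.comp_aestronglyMeasurable
      (hx.integrable i j).1) (by simp)
  have hi : ∀ {g : ℝ → ℂ}, Integrable g → ∀ t : ℝ,
      Integrable fun f : ℝ => g f * Complex.exp (t * f * Complex.I) := by
    intro g hg t
    refine hg.mul_bdd (c := 1) (by fun_prop) (Eventually.of_forall fun f => ?_)
    rw [← Complex.ofReal_mul, Complex.norm_exp_ofReal_mul_I]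
  have key := ae_eq_zero_of_fourier_eq_zero (hneg.sub hc) fun t => by
    simp only [Pi.sub_apply, sub_mul]
    rw [integral_sub (hi hneg t) (hi hc t), sub_eq_zero]
    -- This lag turns the kernel `e^{2πifτ}` into `e^{-itf}`.
    have ha := hx.autocorr i j 0 (-t / (2 * Real.pi))
    have e : ∀ f : ℝ, C f i j * Complex.exp (2 * Real.pi * Complex.I * f * ((-t / (2 * Real.pi) : ℝ) : ℂ))
        = C f i j * Complex.exp (-(t * f * Complex.I)) := by
      intro f
      congr 2
      push_cast
      have : (Real.pi : ℂ) ≠ 0 := by exact_mod_cast Real.pi_ne_zero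
      field_simp
    simp_rw [e] at ha
    have h1 : ∫ f : ℝ, C (-f) i j * Complex.exp (t * f * Complex.I)
        = ∫ f : ℝ, C f i j * Complex.exp (-(t * f * Complex.I)) := by
      rw [← integral_neg_eq_self]
      simp
    have h2 : ∫ f : ℝ, (starRingEnd ℂ) (C f i j) * Complex.exp (t * f * Complex.I)
        = (starRingEnd ℂ) (∫ f : ℝ, C f i j * Complex.exp (-(t * f * Complex.I))) := by
      rw [← integral_conj]
      refine integral_congr_ae (Eventually.of_forall fun f => ?_)
      simp [← Complex.exp_conj]
    rw [h1, h2, ← ha, Complex.conj_ofReal]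
  filter_upwards [key] with f hf
  exact sub_eq_zero.1 hf

theorem tapResponse_neg (c : (Fin M × ℝ) →₀ ℝ) (f : ℝ) (m : Fin M) :
    tapResponse c (-f) m = (starRingEnd ℂ) (tapResponse c f m) := by
  simp only [tapResponse, Finsupp.sum, map_sum]
  refine Finset.sum_congr rfl fun q _ => ?_
  split_ifs
  · simp [← Complex.exp_conj, Complex.conj_ofNat]
  · simp

theorem specNormSq_conj_neg (hsym : ∀ᵐ f, ∀ i j, C (-f) i j = (starRingEnd ℂ) (C f i j))
    (v : ℝ → Fin M → ℂ) :
    specNormSq C (fun f m => (starRingEnd ℂ) (v (-f) m)) = specNormSq C v := by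
  unfold specNormSq
  rw [← lintegral_neg_eq_self]
  refine lintegral_congr_ae ?_
  filter_upwards [hsym] with f hf
  have : (fun m => (starRingEnd ℂ) (v f m)) ⬝ᵥ (C (-f) *ᵥ star fun m => (starRingEnd ℂ) (v f m))
      = (starRingEnd ℂ) (v f ⬝ᵥ (C f *ᵥ star (v f))) := by
    simp [dotProduct, Matrix.mulVec, hf]
  simp only [neg_neg]
  rw [this, Complex.conj_re]

/-- Real taps have conjugate-symmetric responses, and conjugation combined with `f ↦ -f` is an
isometry of `L²(C)`, so limits are symmetric as well. The response is only determined modulo the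
kernel of `C`, whence the factor `C^{1/2}` inside `specVec`. -/
theorem IsSpec.ae_conj_symm (hx : IsWSS P x C) (hC : ∀ i j, Measurable fun f => C f i j)
    (hsym : ∀ᵐ f, ∀ i j, C (-f) i j = (starRingEnd ℂ) (C f i j))
    {v : ℝ → Fin M → ℂ} (hv : ∀ m, Measurable fun f => v f m) {Y : Ω → ℝ}
    (h : IsSpec P x C v Y) :
    ∀ᵐ f, specVec C (fun f m => (starRingEnd ℂ) (v (-f) m)) f = specVec C v f := by
  obtain ⟨-, c, -, hc⟩ := h
  have hv' : ∀ m, Measurable fun f => (starRingEnd ℂ) (v (-f) m) := fun m =>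
    Complex.continuous_conj.measurable.comp ((hv m).comp measurable_neg)
  have hm := fun {v} hv => measurable_specVec (v := v) hC hx.posSemidef hv
  have h1 : ∀ r, eLpNorm (specVec C (fun f m => (starRingEnd ℂ) (v (-f) m))
      - specVec C (tapResponse (c r))) 2 volume
      = eLpNorm (specVec C v - specVec C (tapResponse (c r))) 2 volume := by
    intro r
    refine (ENNReal.pow_right_strictMono two_ne_zero).injective ?_
    beta_reduce
    rw [← specVec_sub, ← specVec_sub, ← specNormSq_eq hx.posSemidef, ← specNormSq_eq hx.posSemidef,
      ← specNormSq_conj_neg hsym]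
    congr 1
    funext f m
    simp [tapResponse_neg]
  have key : eLpNorm (specVec C (fun f m => (starRingEnd ℂ) (v (-f) m)) - specVec C v) 2 volume
      ≤ 0 := by
    refine ge_of_tendsto' (x := atTop) (by simpa using hc.add hc) fun r => ?_
    rw [← sub_sub_sub_cancel_right _ _ (specVec C (tapResponse (c r)))]
    refine (eLpNorm_sub_le ((hm hv').sub (hm (measurable_tapResponse _))).aestronglyMeasurable
      ((hm hv).sub (hm (measurable_tapResponse _))).aestronglyMeasurable (by norm_num)).trans ?_
    rw [h1]
  have h0 := (eLpNorm_eq_zero_iff ((hm hv').sub (hm hv)).aestronglyMeasurable two_ne_zero).1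
    (le_antisymm key bot_le)
  filter_upwards [h0] with f hf
  exact sub_eq_zero.1 hf

end

/-! ### The triangular law -/

theorem integral_triangular (g : ℝ → ℝ) :
    ∫ u, g u ∂triangular = ∫ u in (-1)..1, (1 - |u|) * g u := by
  unfold triangular
  rw [integral_withDensity_eq_integral_toReal_smul₀ (by fun_prop) (by simp),
    intervalIntegral.integral_of_le (by norm_num)]
  rw [← setIntegral_eq_integral_of_forall_compl_eq_zero (s := Set.Ioc (-1 : ℝ) 1)]
  · refine setIntegral_congr_fun measurableSet_Ioc fun u hu => ?_
    have : 0 ≤ 1 - |u| := by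
      rw [sub_nonneg, abs_le]; exact ⟨hu.1.le, hu.2⟩
    simp [ENNReal.toReal_ofReal this]
  · intro u hu
    have : 1 - |u| ≤ 0 := by
      by_contra! h
      have := abs_lt.1 (by linarith : |u| < 1)
      exact hu ⟨this.1, this.2.le⟩
    simp [ENNReal.ofReal_of_nonpos this]

theorem ae_abs_le_one_triangular : ∀ᵐ u ∂triangular, |u| ≤ 1 := by
  unfold triangular
  rw [ae_withDensity_iff (by fun_prop)]
  refine Eventually.of_forall fun u hu => ?_
  by_contra! h
  exact hu (ENNReal.ofReal_of_nonpos (by linarith))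

/-- As `|u| ≤ 1`, the floor takes only three values, up to null sets; the factors are their
probabilities. -/
theorem integral_triangular_floor (a : ℝ) (h : ℤ → ℝ) :
    ∫ u, h ⌊a + u⌋ ∂triangular
      = h (⌊a⌋ - 1) * ((1 - Int.fract a) ^ 2 / 2) + h ⌊a⌋ * (1 / 2 + Int.fract a - Int.fract a ^ 2)
        + h (⌊a⌋ + 1) * (Int.fract a ^ 2 / 2) := by
  set r := Int.fract a with hr
  set m := ⌊a⌋ with hm
  have h0 : 0 ≤ r := Int.fract_nonneg a
  have h1 : r < 1 := Int.fract_lt_one a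
  have ha : a = m + r := (Int.floor_add_fract a).symm
  rw [integral_triangular]
  -- The points `-r`, `0` and `1 - r` cut `[-1, 1]` into four intervals on whose interiors the floor
  -- is constant and the density is affine.
  have key : ∀ (p q : ℝ) (j : ℤ) (c d : ℝ), p ≤ q → (∀ u ∈ Set.Ioo p q, ⌊a + u⌋ = j) →
      (∀ u ∈ Set.Ioo p q, 1 - |u| = c + d * u) →
      IntervalIntegrable (fun u => (1 - |u|) * h ⌊a + u⌋) volume p q ∧
      ∫ u in p..q, (1 - |u|) * h ⌊a + u⌋ = h j * (c * (q - p) + d * ((q ^ 2 - p ^ 2) / 2)) := by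
    intro p q j c d hpq hj hc
    have hcongr : ∀ u ∈ Set.Ioo p q, (c + d * u) * h j = (1 - |u|) * h ⌊a + u⌋ :=
      fun u hu => by rw [hj u hu, hc u hu]
    have hcont : IntervalIntegrable (fun u => (c + d * u) * h j) volume p q :=
      Continuous.intervalIntegrable (by fun_prop) _ _
    constructor
    · rw [intervalIntegrable_iff_integrableOn_Ioo_of_le hpq] at hcont ⊢
      exact hcont.congr_fun hcongr measurableSet_Ioo
    · rw [intervalIntegral.integral_of_le hpq, integral_Ioc_eq_integral_Ioo,
        ← setIntegral_congr_fun measurableSet_Ioo hcongr, ← integral_Ioc_eq_integral_Ioo,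
        ← intervalIntegral.integral_of_le hpq, intervalIntegral.integral_mul_const,
        intervalIntegral.integral_add (by simp) (Continuous.intervalIntegrable (by fun_prop) _ _),
        intervalIntegral.integral_const_mul, integral_id]
      simp; ring
  have k1 := key (-1) (-r) (m - 1) 1 1 (by linarith)
    (fun u hu => by rw [Int.floor_eq_iff]; push_cast; constructor <;> linarith [hu.1, hu.2])
    (fun u hu => by rw [abs_of_neg (by linarith [hu.2])]; ring)
  have k2 := key (-r) 0 m 1 1 (by linarith)
    (fun u hu => by rw [Int.floor_eq_iff]; constructor <;> linarith [hu.1, hu.2])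
    (fun u hu => by rw [abs_of_neg (by linarith [hu.2])]; ring)
  have k3 := key 0 (1 - r) m 1 (-1) (by linarith)
    (fun u hu => by rw [Int.floor_eq_iff]; constructor <;> linarith [hu.1, hu.2])
    (fun u hu => by rw [abs_of_pos (by linarith [hu.1])]; ring)
  have k4 := key (1 - r) 1 (m + 1) 1 (-1) (by linarith)
    (fun u hu => by rw [Int.floor_eq_iff]; push_cast; constructor <;> linarith [hu.1, hu.2])
    (fun u hu => by rw [abs_of_pos (by linarith [hu.1])]; ring)
  rw [← intervalIntegral.integral_add_adjacent_intervals (k1.1.trans (k2.1.trans k3.1)) k4.1,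
    ← intervalIntegral.integral_add_adjacent_intervals k1.1 (k2.1.trans k3.1),
    ← intervalIntegral.integral_add_adjacent_intervals k2.1 k3.1, k1.2, k2.2, k3.2, k4.2]
  ring

/-- Error of the dithered mid-rise quantizer with unit step. -/
def ditherError (a u : ℝ) : ℝ := ⌊a + u⌋ + 1 / 2 - a

theorem measurable_ditherError : Measurable fun p : ℝ × ℝ => ditherError p.1 p.2 := by
  unfold ditherError
  have : Measurable fun p : ℝ × ℝ => ((⌊p.1 + p.2⌋ : ℤ) : ℝ) :=
    (measurable_from_top (f := fun n : ℤ => (n : ℝ))).comp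
      (Int.measurable_floor.comp (measurable_fst.add measurable_snd))
  exact (this.add_const _).sub measurable_fst

theorem abs_ditherError_le (a u : ℝ) : |ditherError a u| ≤ 1 / 2 + |u| := by
  unfold ditherError
  have h1 := Int.floor_le (a + u)
  have h2 := Int.lt_floor_add_one (a + u)
  have h3 := neg_abs_le u
  have h4 := le_abs_self u
  rw [abs_le]; constructor <;> linarith

theorem integral_ditherError (a : ℝ) : ∫ u, ditherError a u ∂triangular = 0 := by
  unfold ditherError
  rw [integral_triangular_floor a fun n => n + 1 / 2 - a]
  have ha : a = ⌊a⌋ + Int.fract a := (Int.floor_add_fract a).symm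
  push_cast
  generalize Int.fract a = r at *
  generalize (⌊a⌋ : ℝ) = m at *
  subst ha; ring

/-- The decisive point is that the value does not depend on `a`: the error power is the same for
every input, which is what the triangular shape achieves. -/
theorem integral_ditherError_sq (a : ℝ) : ∫ u, ditherError a u ^ 2 ∂triangular = 1 / 4 := by
  unfold ditherError
  rw [integral_triangular_floor a fun n => (n + 1 / 2 - a) ^ 2]
  have ha : a = ⌊a⌋ + Int.fract a := (Int.floor_add_fract a).symm
  push_cast
  generalize Int.fract a = r at *
  generalize (⌊a⌋ : ℝ) = m at *
  subst ha; ring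

attribute [irreducible] ditherError

theorem integral_triangular_abs_sub (g : ℝ → ℝ) (hg : Continuous g) :
    ∫ u, g u ∂triangular
      = (∫ u in (-1)..0, (1 + u) * g u) + ∫ u in (0)..1, (1 - u) * g u := by
  rw [integral_triangular, ← intervalIntegral.integral_add_adjacent_intervals (b := 0)
    (Continuous.intervalIntegrable (by fun_prop) _ _)
    (Continuous.intervalIntegrable (by fun_prop) _ _)]
  congr 1
  · refine intervalIntegral.integral_congr fun u hu => ?_
    rw [Set.uIcc_of_le (by norm_num)] at hu
    simp only [abs_of_nonpos hu.2]; ring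
  · refine intervalIntegral.integral_congr fun u hu => ?_
    rw [Set.uIcc_of_le (by norm_num)] at hu
    simp only [abs_of_nonneg hu.1]

theorem integral_id_triangular : ∫ u, u ∂triangular = 0 := by
  rw [integral_triangular_abs_sub (fun u => u) continuous_id]
  have h1 : ∀ u : ℝ, (1 + u) * u = u + u ^ 2 := fun u => by ring
  have h2 : ∀ u : ℝ, (1 - u) * u = u - u ^ 2 := fun u => by ring
  simp_rw [h1, h2]
  rw [intervalIntegral.integral_add (Continuous.intervalIntegrable (by fun_prop) _ _)
    (Continuous.intervalIntegrable (by fun_prop) _ _),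
    intervalIntegral.integral_sub (Continuous.intervalIntegrable (by fun_prop) _ _)
    (Continuous.intervalIntegrable (by fun_prop) _ _)]
  simp only [integral_id, integral_pow]
  norm_num

theorem integral_sq_triangular : ∫ u, u ^ 2 ∂triangular = 1 / 6 := by
  rw [integral_triangular_abs_sub _ (by fun_prop)]
  have h1 : ∀ u : ℝ, (1 + u) * u ^ 2 = u ^ 2 + u ^ 3 := fun u => by ring
  have h2 : ∀ u : ℝ, (1 - u) * u ^ 2 = u ^ 2 - u ^ 3 := fun u => by ring
  simp_rw [h1, h2]
  rw [intervalIntegral.integral_add (Continuous.intervalIntegrable (by fun_prop) _ _)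
    (Continuous.intervalIntegrable (by fun_prop) _ _),
    intervalIntegral.integral_sub (Continuous.intervalIntegrable (by fun_prop) _ _)
    (Continuous.intervalIntegrable (by fun_prop) _ _)]
  simp only [integral_pow]
  norm_num

/-! ### Dither that is independent of the quantizer input -/

theorem ae_abs_le_one_of_law {Ω : Type*} [MeasurableSpace Ω] {P : Measure Ω} {W : Ω → ℝ}
    (hW : Measurable W) (hlaw : P.map W = triangular) :
    ∀ᵐ ω ∂P, |W ω| ≤ 1 :=
  ae_of_ae_map hW.aemeasurable (hlaw ▸ ae_abs_le_one_triangular)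

section

variable {Ω : Type*} [MeasurableSpace Ω] {P : Measure Ω} [IsProbabilityMeasure P]
  {W Y h : Ω → ℝ}

theorem memLp_of_law (hW : Measurable W) (hlaw : P.map W = triangular) : MemLp W 2 P :=
  MemLp.of_bound hW.aestronglyMeasurable 1
    (by simpa using ae_abs_le_one_of_law hW hlaw)

theorem memLp_ditherError (hW : Measurable W) (hlaw : P.map W = triangular)
    (hY : AEMeasurable Y P) : MemLp (fun ω => ditherError (Y ω) (W ω)) 2 P := by
  refine MemLp.of_bound (C := 3 / 2)
    (measurable_ditherError.comp_aemeasurable (hY.prodMk hW.aemeasurable)).aestronglyMeasurable ?_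
  filter_upwards [ae_abs_le_one_of_law hW hlaw] with ω hω
  have := abs_ditherError_le (Y ω) (W ω)
  rw [Real.norm_eq_abs]; linarith

/-- Fubini for the product law of `W` and `(Y, h)`: the dither is integrated first, with the data
frozen. -/
theorem integral_comp_indep (hW : Measurable W) (hlaw : P.map W = triangular)
    (hY : Measurable Y) (hh : Measurable h) (hind : IndepFun W (fun ω => (Y ω, h ω)) P)
    {F : ℝ → ℝ → ℝ → ℝ} (hF : Measurable fun p : ℝ × ℝ × ℝ => F p.1 p.2.1 p.2.2)
    (hint : Integrable (fun ω => F (W ω) (Y ω) (h ω)) P) :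
    ∫ ω, F (W ω) (Y ω) (h ω) ∂P = ∫ ω, ∫ u, F u (Y ω) (h ω) ∂triangular ∂P := by
  have hYh : Measurable fun ω => (Y ω, h ω) := hY.prodMk hh
  have hprod := hind.map_prod_eq_prod_map_map hW.aemeasurable hYh.aemeasurable
  have : IsProbabilityMeasure (triangular) := hlaw ▸ Measure.isProbabilityMeasure_map hW.aemeasurable
  have : IsProbabilityMeasure (P.map fun ω => (Y ω, h ω)) :=
    Measure.isProbabilityMeasure_map hYh.aemeasurable
  have hint' : Integrable (fun p : ℝ × ℝ × ℝ => F p.1 p.2.1 p.2.2)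
      (P.map fun ω => (W ω, (Y ω, h ω))) :=
    (integrable_map_measure hF.aestronglyMeasurable (hW.prodMk hYh).aemeasurable).2 hint
  have e1 : ∫ ω, F (W ω) (Y ω) (h ω) ∂P
      = ∫ p, F p.1 p.2.1 p.2.2 ∂(P.map fun ω => (W ω, (Y ω, h ω))) :=
    (integral_map (hW.prodMk hYh).aemeasurable hF.aestronglyMeasurable).symm
  rw [hprod, hlaw] at hint'
  rw [e1, hprod, hlaw, integral_prod_symm _ hint',
    integral_map hYh.aemeasurable hint'.integral_prod_right.1]

theorem integral_ditherError_mul (hW : Measurable W) (hlaw : P.map W = triangular)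
    (hY : Measurable Y) (hh : Measurable h) (hind : IndepFun W (fun ω => (Y ω, h ω)) P) :
    ∫ ω, ditherError (Y ω) (W ω) * h ω ∂P = 0 := by
  -- Without integrability the integral is zero by convention, so no moment condition on `h` is
  -- needed.
  by_cases hint : Integrable (fun ω => ditherError (Y ω) (W ω) * h ω) P
  · rw [integral_comp_indep hW hlaw hY hh hind (F := fun u y h => ditherError y u * h) ?_ hint]
    · simp_rw [integral_mul_const, integral_ditherError]; simp
    · exact (measurable_ditherError.comp ((measurable_fst.comp measurable_snd).prodMk
        measurable_fst)).mul (measurable_snd.comp measurable_snd)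
  · exact integral_undef hint

theorem integral_ditherError_sq_of_indep (hW : Measurable W) (hlaw : P.map W = triangular)
    (hY : Measurable Y) (hind : IndepFun W Y P) :
    ∫ ω, ditherError (Y ω) (W ω) ^ 2 ∂P = 1 / 4 := by
  have hind' : IndepFun W (fun ω => (Y ω, Y ω)) P :=
    hind.comp measurable_id (measurable_id.prodMk measurable_id)
  rw [integral_comp_indep hW hlaw hY hY hind' (F := fun u y _ => ditherError y u ^ 2) ?_
    (memLp_ditherError hW hlaw hY.aemeasurable).integrable_sq]
  · simp_rw [integral_ditherError_sq]; simp
  · exact (measurable_ditherError.comp ((measurable_fst.comp measurable_snd).prodMk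
        measurable_fst)).pow_const 2

theorem integral_add_dither_sq (hW : Measurable W) (hlaw : P.map W = triangular)
    (hY : Measurable Y) (hY2 : MemLp Y 2 P) (hind : IndepFun W Y P) (c : ℝ) :
    ∫ ω, (Y ω + c * W ω) ^ 2 ∂P = ∫ ω, Y ω ^ 2 ∂P + c ^ 2 / 6 := by
  have hW2 := memLp_of_law hW hlaw
  have h1 : ∫ ω, W ω * Y ω ∂P = 0 := by
    have hE : ∫ ω, W ω ∂P = 0 := by
      rw [← integral_id_triangular, ← hlaw, integral_map hW.aemeasurable (by fun_prop)]
    have := hind.integral_mul_eq_mul_integral hW.aestronglyMeasurable hY.aestronglyMeasurable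
    simp only [Pi.mul_apply] at this
    rw [this, hE, zero_mul]
  have h2 : ∫ ω, W ω ^ 2 ∂P = 1 / 6 := by
    rw [← integral_sq_triangular, ← hlaw, integral_map hW.aemeasurable (by fun_prop)]
  have e : ∀ ω, (Y ω + c * W ω) ^ 2 = Y ω ^ 2 + (2 * c * (W ω * Y ω) + c ^ 2 * W ω ^ 2) :=
    fun ω => by ring
  have i1 : Integrable (fun ω => W ω * Y ω) P := hW2.integrable_mul hY2
  simp_rw [e]
  have i2 : Integrable (fun ω => 2 * c * (W ω * Y ω)) P := i1.const_mul _
  have i3 : Integrable (fun ω => c ^ 2 * W ω ^ 2) P := hW2.integrable_sq.const_mul _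
  have i4 : Integrable (fun ω => 2 * c * (W ω * Y ω) + c ^ 2 * W ω ^ 2) P := i2.add i3
  rw [integral_add hY2.integrable_sq i4, integral_add i2 i3, integral_const_mul,
    integral_const_mul, h1, h2]
  ring

/-- If `W` and `V` are independent and the pair is independent of `D`, then `W` is independent of
`(V, D)`. -/
theorem indepFun_prodMk_right {α β : Type*} [MeasurableSpace α] [MeasurableSpace β]
    {V : Ω → α} {D : Ω → β} (hW : Measurable W) (hV : Measurable V) (hD : Measurable D)
    (h1 : IndepFun W V P) (h2 : IndepFun (fun ω => (W ω, V ω)) D P) :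
    IndepFun W (fun ω => (V ω, D ω)) P := by
  have h3 : IndepFun V D P := h2.comp measurable_snd measurable_id
  have hp1 := h1.map_prod_eq_prod_map_map hW.aemeasurable hV.aemeasurable
  have hp2 := h2.map_prod_eq_prod_map_map (hW.prodMk hV).aemeasurable hD.aemeasurable
  have hp3 := h3.map_prod_eq_prod_map_map hV.aemeasurable hD.aemeasurable
  have : IsProbabilityMeasure (P.map W) := Measure.isProbabilityMeasure_map hW.aemeasurable
  have : IsProbabilityMeasure (P.map V) := Measure.isProbabilityMeasure_map hV.aemeasurable
  have : IsProbabilityMeasure (P.map D) := Measure.isProbabilityMeasure_map hD.aemeasurable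
  rw [indepFun_iff_map_prod_eq_prod_map_map hW.aemeasurable (hV.prodMk hD).aemeasurable, hp3,
    ← (measurePreserving_prodAssoc (P.map W) (P.map V) (P.map D)).map_eq, ← hp1, ← hp2,
    Measure.map_map MeasurableEquiv.prodAssoc.measurable ((hW.prodMk hV).prodMk hD)]
  rfl

end

/-! ### Second moments of the quantization errors -/

theorem measurable_ditherError_snd_fst {α : Type*} [MeasurableSpace α] {φ : α → ℝ}
    (hφ : Measurable φ) : Measurable fun v : ℝ × α => ditherError (φ v.2) v.1 :=
  measurable_ditherError.comp ((hφ.comp measurable_snd).prodMk measurable_fst)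

section

variable {Ω α ι : Type*} [MeasurableSpace Ω] [MeasurableSpace α] {P : Measure Ω} {W : ι → Ω → ℝ} {D : Ω → α}

theorem indepFun_dither_data (hind : IndepFun (fun ω p => W p ω) D P) (p : ι) {φ : α → ℝ}
    (hφ : Measurable φ) : IndepFun (W p) (φ ∘ D) P :=
  hind.comp (φ := fun v : ι → ℝ => v p) (measurable_pi_apply p) hφ

theorem integral_ditherError_mul_data [IsProbabilityMeasure P] (hW : ∀ p, Measurable (W p))
    (hlaw : ∀ p, P.map (W p) = triangular) (hD : Measurable D)
    (hind : IndepFun (fun ω p => W p ω) D P) {φ ρ : α → ℝ} (hφ : Measurable φ)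
    (hρ : Measurable ρ) (p : ι) :
    ∫ ω, ditherError (φ (D ω)) (W p ω) * ρ (D ω) ∂P = 0 :=
  integral_ditherError_mul (hW p) (hlaw p) (hφ.comp hD) (hρ.comp hD)
    (hind.comp (φ := fun v : ι → ℝ => v p) (measurable_pi_apply p) (hφ.prodMk hρ))

/-- `W p` is independent of the pair formed by `W q` and the data, so the second error plays the
role of a data variable for the first dither. -/
theorem integral_ditherError_mul_ditherError [IsProbabilityMeasure P] (hW : ∀ p, Measurable (W p))
    (hlaw : ∀ p, P.map (W p) = triangular) (hD : Measurable D) (hiind : iIndepFun W P)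
    (hind : IndepFun (fun ω p => W p ω) D P) {φ ψ : α → ℝ} (hφ : Measurable φ)
    (hψ : Measurable ψ) {p q : ι} (hpq : p ≠ q) :
    ∫ ω, ditherError (φ (D ω)) (W p ω) * ditherError (ψ (D ω)) (W q ω) ∂P = 0 := by
  have hpair : Measurable fun v : ι → ℝ => (v p, v q) :=
    (measurable_pi_apply p).prodMk (measurable_pi_apply q)
  have h0 : IndepFun (fun ω => (W p ω, W q ω)) D P := hind.comp hpair measurable_id
  have h1 : IndepFun (W p) (fun ω => (W q ω, D ω)) P :=
    indepFun_prodMk_right (hW p) (hW q) hD (hiind.indepFun hpq) h0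
  have hg : Measurable fun v : ℝ × α => (φ v.2, ditherError (ψ v.2) v.1) :=
    (hφ.comp measurable_snd).prodMk (measurable_ditherError_snd_fst hψ)
  have h2 : IndepFun (W p) (fun ω => (φ (D ω), ditherError (ψ (D ω)) (W q ω))) P :=
    h1.comp measurable_id hg
  have h3 : Measurable fun ω => ditherError (ψ (D ω)) (W q ω) := (measurable_ditherError_snd_fst hψ).comp ((hW q).prodMk hD)
  exact integral_ditherError_mul (Y := fun ω => φ (D ω)) (hW p) (hlaw p) (hφ.comp hD) h3 h2

/-- Quantization errors of step `Δ` add the power `Δ² / 4` each. -/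
theorem integral_sub_ditherError_sq [IsProbabilityMeasure P] (hW : ∀ p, Measurable (W p))
    (hlaw : ∀ p, P.map (W p) = triangular) (hD : Measurable D) (hiind : iIndepFun W P)
    (hind : IndepFun (fun ω p => W p ω) D P) {φ : ι → α → ℝ} (hφ : ∀ p, Measurable (φ p))
    {ρ : α → ℝ} (hρ : Measurable ρ) (hρ2 : MemLp (ρ ∘ D) 2 P) (F : Finset ι) (c : ι → ℝ) :
    ∫ ω, (ρ (D ω) - ∑ p ∈ F, c p * ditherError (φ p (D ω)) (W p ω)) ^ 2 ∂P
      = ∫ ω, ρ (D ω) ^ 2 ∂P + 1 / 4 * ∑ p ∈ F, c p ^ 2 := by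
  classical
  have he : ∀ p, MemLp (fun ω => ditherError (φ p (D ω)) (W p ω)) 2 P := fun p =>
    memLp_ditherError (hW p) (hlaw p) ((hφ p).comp hD).aemeasurable
  have hr : ∀ F : Finset ι,
      MemLp (fun ω => ρ (D ω) - ∑ p ∈ F, c p * ditherError (φ p (D ω)) (W p ω)) 2 P := fun F =>
    hρ2.sub (memLp_finsetSum _ fun p _ => (he p).const_mul _)
  induction F using Finset.induction_on with
  | empty => simp
  | insert p F hp ih =>
    set e := fun ω => ditherError (φ p (D ω)) (W p ω) with hedef
    set r := fun ω => ρ (D ω) - ∑ p ∈ F, c p * ditherError (φ p (D ω)) (W p ω) with hrdef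
    have h1 : ∀ ω, (ρ (D ω) - ∑ p ∈ insert p F, c p * ditherError (φ p (D ω)) (W p ω)) ^ 2
        = r ω ^ 2 + (-(2 * c p) * (e ω * r ω) + c p ^ 2 * e ω ^ 2) := by
      intro ω
      rw [Finset.sum_insert hp, hrdef]
      ring
    -- The new error is orthogonal to the data and to all errors already in the sum, so the squares
    -- add.
    have hcross : ∫ ω, e ω * r ω ∂P = 0 := by
      have h2 : ∀ ω, e ω * r ω = e ω * ρ (D ω)
          - ∑ q ∈ F, c q * (e ω * ditherError (φ q (D ω)) (W q ω)) := by
        intro ω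
        simp only [hrdef, mul_sub, Finset.mul_sum]
        congr 1
        exact Finset.sum_congr rfl fun q _ => by ring
      have i1 : Integrable (fun ω => e ω * ρ (D ω)) P := (he p).integrable_mul hρ2
      have i2 : ∀ q, Integrable (fun ω => c q * (e ω * ditherError (φ q (D ω)) (W q ω))) P :=
        fun q => ((he p).integrable_mul (he q)).const_mul _
      simp_rw [h2]
      rw [integral_sub i1 (integrable_finsetSum _ fun q _ => i2 q),
        integral_ditherError_mul_data hW hlaw hD hind (hφ p) hρ,
        integral_finsetSum _ fun q _ => i2 q, zero_sub, neg_eq_zero]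
      refine Finset.sum_eq_zero fun q hq => ?_
      rw [integral_const_mul, integral_ditherError_mul_ditherError hW hlaw hD hiind hind (hφ p)
        (hφ q) (by rintro rfl; exact hp hq), mul_zero]
    have i1 : Integrable (fun ω => -(2 * c p) * (e ω * r ω)) P :=
      ((he p).integrable_mul (hr F)).const_mul _
    have i2 : Integrable (fun ω => c p ^ 2 * e ω ^ 2) P := (he p).integrable_sq.const_mul _
    have i3 : Integrable (fun ω => -(2 * c p) * (e ω * r ω) + c p ^ 2 * e ω ^ 2) P := i1.add i2
    have hsq : ∫ ω, e ω ^ 2 ∂P = 1 / 4 :=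
      integral_ditherError_sq_of_indep (hW p) (hlaw p) ((hφ p).comp hD)
        (indepFun_dither_data hind p (hφ p))
    simp_rw [h1]
    rw [integral_add (hr F).integrable_sq i3, integral_add i1 i2, integral_const_mul,
      integral_const_mul, hcross, ih, Finset.sum_insert hp, hsq]
    ring

end

/-! ### The mean-square error of a finite digital filter -/

section

variable {Ω : Type*} [MeasurableSpace Ω] {P : Measure Ω} {M N : ℕ}
  {x : Fin M → ℝ → Ω → ℝ} {C : ℝ → Matrix (Fin M) (Fin M) ℂ} {Γ : ℝ → Matrix (Fin N) (Fin M) ℂ}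
  {s : Fin N → Ω → ℝ} {w : ℕ → ℤ → Ω → ℝ}

/-- The signals and the task, as one random element. -/
def dataMap (x : Fin M → ℝ → Ω → ℝ) (s : Fin N → Ω → ℝ) (ω : Ω) :
    (Fin M × ℝ → ℝ) × (Fin N → ℝ) :=
  (fun q => x q.1 q.2 ω, fun i => s i ω)

theorem measurable_dataMap (hx : IsWSS P x C) (hs : IsLinearTask P x C Γ s) :
    Measurable (dataMap x s) :=
  (measurable_pi_lambda _ fun q : Fin M × ℝ => hx.measurable q.1 q.2).prodMk
    (measurable_pi_lambda _ fun i => hs.measurable i)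

/-- A square-integrable variable that is determined by the signals and the task. -/
def IsData (P : Measure Ω) (x : Fin M → ℝ → Ω → ℝ) (s : Fin N → Ω → ℝ) (Y : Ω → ℝ) : Prop :=
  MemLp Y 2 P ∧ ∃ φ : (Fin M × ℝ → ℝ) × (Fin N → ℝ) → ℝ, Measurable φ ∧ Y =ᵐ[P] φ ∘ dataMap x s

/-- An output equals its conditional expectation almost surely, and the latter factors through
`dataMap` by the Doob–Dynkin lemma. -/
theorem IsSpec.isData [IsProbabilityMeasure P] (hx : IsWSS P x C) {v : ℝ → Fin M → ℂ} {Y : Ω → ℝ} (h : IsSpec P x C v Y)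
    (s : Fin N → Ω → ℝ) : IsData P x s Y := by
  refine ⟨h.1, ?_⟩
  have h1 : signalSigma x ≤ MeasurableSpace.comap (dataMap x s) inferInstance := by
    refine iSup_le fun m => iSup_le fun t => ?_
    rw [← measurable_iff_comap_le]
    have h2 : Measurable fun v : (Fin M × ℝ → ℝ) × (Fin N → ℝ) => v.1 (m, t) :=
      (measurable_pi_apply (m, t)).comp measurable_fst
    exact h2.comp (comap_measurable (dataMap x s))
  have h2 : Measurable[MeasurableSpace.comap (dataMap x s) inferInstance] (P[Y | signalSigma x]) :=
    stronglyMeasurable_condExp.measurable.mono h1 le_rfl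
  obtain ⟨φ, hφ, hφ'⟩ := h2.exists_eq_measurable_comp
  exact ⟨φ, hφ, hφ' ▸ h.ae_eq_condExp hx⟩

theorem isData_task (hs : IsLinearTask P x C Γ s) (i : Fin N) : IsData P x s (s i) :=
  ⟨hs.memLp i, fun v => v.2 i, (measurable_pi_apply i).comp measurable_snd, EventuallyEq.rfl⟩

theorem IsData.sub_sum {ι : Type*} {Y : Ω → ℝ} {Z : ι → Ω → ℝ} (hY : IsData P x s Y)
    (hZ : ∀ p, IsData P x s (Z p)) (F : Finset ι) (c : ι → ℝ) :
    IsData P x s fun ω => Y ω - ∑ p ∈ F, c p * Z p ω := by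
  obtain ⟨hY2, φ, hφ, hYφ⟩ := hY
  choose hZ2 ψ hψ hZψ using hZ
  refine ⟨hY2.sub (memLp_finsetSum _ fun p _ => (hZ2 p).const_mul _),
    fun v => φ v - ∑ p ∈ F, c p * ψ p v,
    hφ.sub (Finset.measurable_sum _ fun p _ => (hψ p).const_mul _), ?_⟩
  have : ∀ᵐ ω ∂P, ∀ p ∈ F, Z p ω = ψ p (dataMap x s ω) :=
    (ae_ball_iff F.countable_toSet).2 fun p _ => hZψ p
  filter_upwards [hYφ, this] with ω h1 h2
  simp only [Function.comp_apply] at h1 ⊢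
  rw [h1, Finset.sum_congr rfl fun p hp => by rw [h2 p hp]]

theorem midRise_eq {Δ : ℝ} (hΔ : Δ ≠ 0) (y u : ℝ) :
    midRise Δ (y + Δ * u) = y + Δ * ditherError (y / Δ) u := by
  have : (y + Δ * u) / Δ = y / Δ + u := by field_simp
  rw [midRise, ditherError, this]
  field_simp
  ring

/-- `E (s_i - ∑ c z)² = E (s_i - ∑ c y)² + (Δ²/4) ∑ c²` for quantizer outputs `z`. -/
theorem integral_sub_midRise_sq [IsProbabilityMeasure P] (hx : IsWSS P x C) (hs : IsLinearTask P x C Γ s)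
    (hw : IsDither P x s w) {Δ : ℝ} (hΔ : Δ ≠ 0) {Y : ℕ × ℤ → Ω → ℝ}
    (hY : ∀ p, IsData P x s (Y p)) {S : Ω → ℝ} (hS : IsData P x s S) (F : Finset (ℕ × ℤ))
    (c : ℕ × ℤ → ℝ) :
    ∫ ω, (S ω - ∑ p ∈ F, c p * midRise Δ (Y p ω + Δ * w p.1 p.2 ω)) ^ 2 ∂P
      = ∫ ω, (S ω - ∑ p ∈ F, c p * Y p ω) ^ 2 ∂P + Δ ^ 2 / 4 * ∑ p ∈ F, c p ^ 2 := by
  obtain ⟨hR2, ρ, hρ, hRρ⟩ := hS.sub_sum hY F c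
  choose hY2 φ hφ hYφ using hY
  have hall : ∀ᵐ ω ∂P, ∀ p ∈ F, Y p ω = φ p (dataMap x s ω) :=
    (ae_ball_iff F.countable_toSet).2 fun p _ => hYφ p
  have hD := measurable_dataMap hx hs
  have key := integral_sub_ditherError_sq (P := P) (W := fun p : ℕ × ℤ => w p.1 p.2)
    (fun p => hw.measurable p.1 p.2) (fun p => hw.law p.1 p.2) hD hw.iIndep hw.indep
    (φ := fun p v => φ p v / Δ) (fun p => (hφ p).div_const _) hρ (hR2.ae_eq hRρ) F
    (fun p => c p * Δ)
  have e1 : ∫ ω, (S ω - ∑ p ∈ F, c p * Y p ω) ^ 2 ∂P = ∫ ω, ρ (dataMap x s ω) ^ 2 ∂P := by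
    refine integral_congr_ae ?_
    filter_upwards [hRρ] with ω hω
    simp only [Function.comp_apply] at hω
    rw [hω]
  rw [e1, Finset.mul_sum]
  rw [Finset.mul_sum] at key
  convert key using 1
  · refine integral_congr_ae ?_
    filter_upwards [hRρ, hall] with ω h1 h2
    simp only [Function.comp_apply] at h1
    rw [← h1, sub_sub, ← Finset.sum_add_distrib]
    congr 2
    refine Finset.sum_congr rfl fun p hp => ?_
    rw [midRise_eq hΔ, ← h2 p hp]
    ring
  · congr 1
    exact Finset.sum_congr rfl fun p _ => by ring

theorem integral_add_dither_sq_of_isData [IsProbabilityMeasure P] (hx : IsWSS P x C) (hs : IsLinearTask P x C Γ s)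
    (hw : IsDither P x s w) {Y : Ω → ℝ} (hY : IsData P x s Y) (k : ℕ) (n : ℤ) (c : ℝ) :
    ∫ ω, (Y ω + c * w k n ω) ^ 2 ∂P = ∫ ω, Y ω ^ 2 ∂P + c ^ 2 / 6 := by
  obtain ⟨hY2, φ, hφ, hYφ⟩ := hY
  have hD := measurable_dataMap hx hs
  have hi : IndepFun (w k n) (φ ∘ dataMap x s) P :=
    indepFun_dither_data (W := fun p : ℕ × ℤ => w p.1 p.2) hw.indep (k, n) hφ
  have := integral_add_dither_sq (hw.measurable k n) (hw.law k n) (hφ.comp hD)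
    (hY2.ae_eq hYφ) hi c
  have e : ∫ ω, Y ω ^ 2 ∂P = ∫ ω, (φ ∘ dataMap x s) ω ^ 2 ∂P :=
    integral_congr_ae (by filter_upwards [hYφ] with ω h; rw [h])
  rw [e, ← this]
  exact integral_congr_ae (by filter_upwards [hYφ] with ω h; rw [h])

/-- The estimation error splits orthogonally at the conditional expectation. -/
theorem integral_sub_sq_of_isSpec [IsProbabilityMeasure P] (hx : IsWSS P x C) (hs : IsLinearTask P x C Γ s) (i : Fin N)
    {v : ℝ → Fin M → ℂ} {Y : Ω → ℝ} (hY : IsSpec P x C v Y) :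
    ∫ ω, (s i ω - Y ω) ^ 2 ∂P = ∫ ω, (s i ω - (P[s i | signalSigma x]) ω) ^ 2 ∂P
      + ∫ ω, ((P[s i | signalSigma x]) ω - Y ω) ^ 2 ∂P := by
  have hle := signalSigma_le hx
  set E := P[s i | signalSigma x] with hE
  have hsi : Integrable (s i) P := (hs.memLp i).integrable (by norm_num)
  have hE2 : MemLp E 2 P := (hs.memLp i).condExp (by norm_num)
  have hYE := hY.ae_eq_condExp hx
  set Y' := P[Y | signalSigma x] with hY'
  have hY'2 : MemLp Y' 2 P := hY.1.condExp (by norm_num)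
  have hA : MemLp (fun ω => s i ω - E ω) 2 P := (hs.memLp i).sub hE2
  have hB : MemLp (fun ω => E ω - Y' ω) 2 P := hE2.sub hY'2
  have hcross : ∫ ω, (E ω - Y' ω) * (s i ω - E ω) ∂P = 0 := by
    have hBm : StronglyMeasurable[signalSigma x] (E - Y') :=
      stronglyMeasurable_condExp.sub stronglyMeasurable_condExp
    have h1 : P[(E - Y') * (s i - E) | signalSigma x] =ᵐ[P] (E - Y') * P[s i - E | signalSigma x] :=
      condExp_mul_of_stronglyMeasurable_left hBm (hB.integrable_mul hA)
        (hA.integrable (by norm_num))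
    have h2 : P[s i - E | signalSigma x] =ᵐ[P] 0 := by
      refine (condExp_sub hsi (hE2.integrable (by norm_num)) _).trans ?_
      rw [condExp_of_stronglyMeasurable hle stronglyMeasurable_condExp
        (hE2.integrable (by norm_num))]
      simp
    have h3 : ∫ ω, ((E - Y') * (s i - E)) ω ∂P = 0 := by
      rw [← integral_condExp hle, integral_congr_ae h1]
      rw [integral_congr_ae (g := 0) (by filter_upwards [h2] with ω h; simp [h])]
      simp
    simpa using h3
  have e1 : ∫ ω, (s i ω - Y ω) ^ 2 ∂P = ∫ ω, (s i ω - Y' ω) ^ 2 ∂P :=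
    integral_congr_ae (by filter_upwards [hYE] with ω h; rw [h])
  have e2 : ∫ ω, (E ω - Y ω) ^ 2 ∂P = ∫ ω, (E ω - Y' ω) ^ 2 ∂P :=
    integral_congr_ae (by filter_upwards [hYE] with ω h; rw [h])
  rw [e1, e2]
  have e3 : ∀ ω, (s i ω - Y' ω) ^ 2
      = (s i ω - E ω) ^ 2 + (2 * ((E ω - Y' ω) * (s i ω - E ω)) + (E ω - Y' ω) ^ 2) :=
    fun ω => by ring
  have i1 : Integrable (fun ω => 2 * ((E ω - Y' ω) * (s i ω - E ω))) P :=
    (hB.integrable_mul hA).const_mul 2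
  have i2 : Integrable (fun ω => 2 * ((E ω - Y' ω) * (s i ω - E ω)) + (E ω - Y' ω) ^ 2) P :=
    i1.add hB.integrable_sq
  simp_rw [e3]
  rw [integral_add hA.integrable_sq i2, integral_add i1 hB.integrable_sq, integral_const_mul,
    hcross]
  ring

end

/-! ### Orthogonal families of vectors of norm zero or one -/

section

variable {E ι : Type*} [NormedAddCommGroup E] [InnerProductSpace ℂ E] [Fintype ι]

/-- Pairwise orthogonal vectors of norm zero or one. -/
def IsPartialONB (g : ι → E) : Prop :=
  (∀ i j, i ≠ j → inner ℂ (g i) (g j) = 0) ∧ ∀ i, g i = 0 ∨ ‖g i‖ = 1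

theorem IsPartialONB.inner_sum {g : ι → E} (hg : IsPartialONB g) (a : ι → ℂ) (i : ι) :
    inner ℂ (g i) (∑ j, a j • g j) = a i * inner ℂ (g i) (g i) := by
  classical
  rw [_root_.inner_sum, Finset.sum_eq_single i]
  · rw [inner_smul_right]
  · intro j _ hj
    rw [inner_smul_right, hg.1 i j hj.symm, mul_zero]
  · simp

theorem IsPartialONB.norm_sum_sq_le {g : ι → E} (hg : IsPartialONB g) (a : ι → ℂ) :
    ‖∑ j, a j • g j‖ ^ 2 ≤ ∑ j, ‖a j‖ ^ 2 := by
  have h : inner ℂ (∑ j, a j • g j) (∑ j, a j • g j)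
      = ∑ j, (((‖a j‖ ^ 2 * ‖g j‖ ^ 2 : ℝ)) : ℂ) := by
    rw [sum_inner]
    refine Finset.sum_congr rfl fun i _ => ?_
    rw [inner_smul_left, hg.inner_sum, inner_self_eq_norm_sq_to_K, ← mul_assoc,
      mul_comm _ (a i), Complex.mul_conj, Complex.normSq_eq_norm_sq]
    push_cast; rfl
  have h2 : ‖∑ j, a j • g j‖ ^ 2 = ∑ j, ‖a j‖ ^ 2 * ‖g j‖ ^ 2 := by
    have := congrArg Complex.re h
    rw [inner_self_eq_norm_sq_to_K] at this
    rw [← Complex.ofReal_sum, Complex.ofReal_re] at this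
    rw [← this]
    norm_cast
  rw [h2]
  refine Finset.sum_le_sum fun j _ => ?_
  rcases hg.2 j with h | h <;> rw [h] <;> simp

theorem IsPartialONB.sum_eq_of_mem {g : ι → E} (hg : IsPartialONB g) {v : E}
    (hv : v ∈ Submodule.span ℂ (Set.range g)) : ∑ j, inner ℂ (g j) v • g j = v := by
  obtain ⟨c, rfl⟩ := (Submodule.mem_span_range_iff_exists_fun ℂ).1 hv
  refine Finset.sum_congr rfl fun i _ => ?_
  rw [hg.inner_sum]
  rcases hg.2 i with h | h
  · simp [h]
  · rw [inner_self_eq_norm_sq_to_K, h]; simp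

theorem IsPartialONB.inner_sub_sum {g : ι → E} (hg : IsPartialONB g) (v : E) (i : ι) :
    inner ℂ (g i) (v - ∑ j, inner ℂ (g j) v • g j) = 0 := by
  rw [inner_sub_right, hg.inner_sum]
  rcases hg.2 i with h | h
  · simp [h]
  · rw [inner_self_eq_norm_sq_to_K, h]; simp

/-- Pythagoras: the sum is the orthogonal projection of `v` on the span of the family, and `γ` lies
in that span. -/
theorem IsPartialONB.norm_sq_eq {g : ι → E} (hg : IsPartialONB g) (γ : E)
    (hγ : γ ∈ Submodule.span ℂ (Set.range g)) (v : E) :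
    ‖γ - v‖ ^ 2 = ‖γ - ∑ j, inner ℂ (g j) v • g j‖ ^ 2 + ‖v - ∑ j, inner ℂ (g j) v • g j‖ ^ 2 := by
  set p := ∑ j, inner ℂ (g j) v • g j with hp
  have hpm : p ∈ Submodule.span ℂ (Set.range g) :=
    Submodule.sum_mem _ fun j _ => Submodule.smul_mem _ _ (Submodule.subset_span ⟨j, rfl⟩)
  have hperp : ∀ u ∈ Submodule.span ℂ (Set.range g), inner ℂ u (v - p) = 0 := by
    intro u hu
    obtain ⟨c, rfl⟩ := (Submodule.mem_span_range_iff_exists_fun ℂ).1 hu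
    rw [sum_inner]
    refine Finset.sum_eq_zero fun i _ => ?_
    rw [inner_smul_left, hg.inner_sub_sum, mul_zero]
  have h1 : γ - v = (γ - p) - (v - p) := by abel
  have h2 := hperp _ (Submodule.sub_mem _ hγ hpm)
  rw [h1, norm_sub_sq (𝕜 := ℂ), h2]; simp

theorem IsPartialONB.norm_sub_le {g : ι → E} (hg : IsPartialONB g) (γ : E)
    (hγ : γ ∈ Submodule.span ℂ (Set.range g)) (v : E) :
    ‖γ - ∑ j, inner ℂ (g j) v • g j‖ ^ 2 ≤ ‖γ - v‖ ^ 2 := by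
  rw [hg.norm_sq_eq γ hγ v]; nlinarith [sq_nonneg ‖v - ∑ j, inner ℂ (g j) v • g j‖]

theorem IsPartialONB.bessel {g : ι → E} (hg : IsPartialONB g) (v : E) :
    ∑ j, ‖inner ℂ (g j) v‖ ^ 2 ≤ ‖v‖ ^ 2 := by
  have h1 := hg.norm_sq_eq 0 (Submodule.zero_mem _) v
  have h2 : ‖∑ j, inner ℂ (g j) v • g j‖ ^ 2 = ∑ j, ‖inner ℂ (g j) v‖ ^ 2 := by
    have h3 : (inner ℂ (∑ j, inner ℂ (g j) v • g j) (∑ j, inner ℂ (g j) v • g j) : ℂ)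
        = ∑ j, ((‖inner ℂ (g j) v‖ ^ 2 : ℝ) : ℂ) := by
      rw [sum_inner]
      refine Finset.sum_congr rfl fun i _ => ?_
      rw [inner_smul_left, hg.inner_sum, ← mul_assoc, mul_comm _ (inner ℂ (g i) v),
        Complex.mul_conj, Complex.normSq_eq_norm_sq]
      rcases hg.2 i with h | h
      · simp [h]
      · rw [inner_self_eq_norm_sq_to_K, h]; simp
    have := congrArg Complex.re h3
    rw [inner_self_eq_norm_sq_to_K, ← Complex.ofReal_sum, Complex.ofReal_re] at this
    rw [← this]; norm_cast
  simp only [zero_sub, norm_neg] at h1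
  rw [h1, h2]; nlinarith [sq_nonneg ‖v - ∑ j, inner ℂ (g j) v • g j‖]

end

/-! ### Gram–Schmidt as a measurable map -/

section

variable {n : ℕ} {E : Type*} [NormedAddCommGroup E] [InnerProductSpace ℂ E]

open InnerProductSpace

/-- Gram–Schmidt yields zero at every dependent vector. This is why norm zero is allowed: the family
keeps a fixed size while the rank varies with the frequency. -/
theorem isPartialONB_gramSchmidtNormed (f : Fin n → E) :
    IsPartialONB (gramSchmidtNormed ℂ f) := by
  constructor
  · intro i j hij
    simp only [gramSchmidtNormed, inner_smul_left, inner_smul_right,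
      gramSchmidt_orthogonal ℂ f hij, mul_zero]
  · intro i
    by_cases h : gramSchmidtNormed ℂ f i = 0
    · exact Or.inl h
    · exact Or.inr (gramSchmidtNormed_unit_length' h)

variable [MeasurableSpace E] [BorelSpace E] [SecondCountableTopology E]
  {α : Type*} [MeasurableSpace α]

theorem measurable_gramSchmidt {f : α → Fin n → E} (hf : ∀ l, Measurable fun x => f x l)
    (l : Fin n) : Measurable fun x => gramSchmidt ℂ (f x) l := by
  induction l using WellFoundedLT.induction with
  | _ l ih =>
    have : ∀ x, gramSchmidt ℂ (f x) l = f x l - ∑ i ∈ Finset.Iio l,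
        (inner ℂ (gramSchmidt ℂ (f x) i) (f x l) / ((‖gramSchmidt ℂ (f x) i‖ : ℂ) ^ 2)) •
          gramSchmidt ℂ (f x) i := by
      intro x
      rw [gramSchmidt_def]
      simp only [Submodule.starProjection_singleton]
      push_cast
      rfl
    simp_rw [this]
    refine (hf l).sub (Finset.measurable_sum _ fun i hi => ?_)
    have hi' := ih i (Finset.mem_Iio.1 hi)
    exact ((hi'.inner (hf l)).div ((Complex.measurable_ofReal.comp hi'.norm).pow_const 2)).smul hi'

theorem measurable_gramSchmidtNormed {f : α → Fin n → E} (hf : ∀ l, Measurable fun x => f x l)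
    (l : Fin n) : Measurable fun x => gramSchmidtNormed ℂ (f x) l := by
  unfold gramSchmidtNormed
  have h := measurable_gramSchmidt hf l
  exact (Complex.measurable_ofReal.comp h.norm).inv.smul h

end

/-! ### Compression of the rows of a digital filter -/

/-- Squared Euclidean norm. -/
def vecSq {n : ℕ} (v : Fin n → ℂ) : ℝ := ∑ i, ‖v i‖ ^ 2

/-- Squared Frobenius norm. -/
def froSq {m n : ℕ} (X : Matrix (Fin m) (Fin n) ℂ) : ℝ := ∑ i, ∑ j, ‖X i j‖ ^ 2

theorem vecSq_eq {n : ℕ} (v : Fin n → ℂ) : vecSq v = ‖WithLp.toLp 2 v‖ ^ 2 := by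
  rw [EuclideanSpace.norm_sq_eq]; rfl

/-- `B' V` with a contraction `V` approximates all vectors in the range of `S` at least as well as
`B` does, and `B'` is not larger than `B`. -/
structure IsCompression {N K L : ℕ} (S : Matrix (Fin N) (Fin N) ℂ) (B : Matrix (Fin N) (Fin K) ℂ)
    (V : Matrix (Fin L) (Fin K) ℂ) (B' : Matrix (Fin N) (Fin L) ℂ) : Prop where
  contraction : ∀ a, vecSq (V *ᵥ a) ≤ vecSq a
  froSq_le : froSq B' ≤ froSq B
  dist_le : ∀ c a, vecSq (S *ᵥ c - B' *ᵥ (V *ᵥ a)) ≤ vecSq (S *ᵥ c - B *ᵥ a)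

section

variable {N K L : ℕ}

open InnerProductSpace

/-- The vectors `B^H g_l`. -/
def pullVec (B : Matrix (Fin N) (Fin K) ℂ) (g : Fin L → EuclideanSpace ℂ (Fin N)) (l : Fin L) :
    EuclideanSpace ℂ (Fin K) :=
  WithLp.toLp 2 fun k => ∑ i, g l i * (starRingEnd ℂ) (B i k)

theorem inner_pullVec (B : Matrix (Fin N) (Fin K) ℂ) (g : Fin L → EuclideanSpace ℂ (Fin N))
    (l : Fin L) (a : Fin K → ℂ) :
    inner ℂ (pullVec B g l) (WithLp.toLp 2 a) = inner ℂ (g l) (WithLp.toLp 2 (B *ᵥ a)) := by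
  simp only [PiLp.inner_apply, pullVec, Matrix.mulVec, dotProduct, RCLike.inner_apply, map_sum,
    map_mul, Complex.conj_conj, Finset.mul_sum, Finset.sum_mul]
  rw [Finset.sum_comm]
  exact Finset.sum_congr rfl fun i _ => Finset.sum_congr rfl fun k _ => by ring

/-- Let `Π` be the projection on the span of `g` and `t l = B^H g_l`. The rows of `V` are the
conjugates of the vectors `q` that Gram–Schmidt makes from `t`, and `B' = Π B V^H`. Since `V^H V`
fixes every `t l`, one gets `B' V = Π B`, and a projection on a space containing the range of `S`
brings `B a` closer to that range. Bessel's inequality, for `g` and for `q`, bounds `B'`. -/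
theorem isCompression_of_isPartialONB {S : Matrix (Fin N) (Fin N) ℂ}
    (B : Matrix (Fin N) (Fin K) ℂ) {g : Fin L → EuclideanSpace ℂ (Fin N)} (hg : IsPartialONB g)
    (hS : ∀ j, WithLp.toLp 2 (fun i => S i j) ∈ Submodule.span ℂ (Set.range g)) :
    IsCompression S B
      (Matrix.of fun j k => (starRingEnd ℂ) (gramSchmidtNormed ℂ (pullVec B g) j k))
      (Matrix.of fun i j => ∑ l, g l i *
        inner ℂ (pullVec B g l) (gramSchmidtNormed ℂ (pullVec B g) j)) := by
  set t := pullVec B g with ht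
  set q := gramSchmidtNormed ℂ t with hq
  have hqo : IsPartialONB q := isPartialONB_gramSchmidtNormed t
  set V : Matrix (Fin L) (Fin K) ℂ := Matrix.of fun j k => (starRingEnd ℂ) (q j k) with hV
  set B' : Matrix (Fin N) (Fin L) ℂ := Matrix.of fun i j => ∑ l, g l i * inner ℂ (t l) (q j) with hB'
  have hVa : ∀ (a : Fin K → ℂ) j, (V *ᵥ a) j = inner ℂ (q j) (WithLp.toLp 2 a) := by
    intro a j
    simp only [hV, Matrix.mulVec, dotProduct, Matrix.of_apply, PiLp.inner_apply, RCLike.inner_apply]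
    exact Finset.sum_congr rfl fun k _ => mul_comm _ _
  have hB'b : ∀ b : Fin L → ℂ, WithLp.toLp 2 (B' *ᵥ b)
      = ∑ l, inner ℂ (t l) (∑ j, b j • q j) • g l := by
    intro b
    ext i
    simp only [hB', Matrix.mulVec, dotProduct, Matrix.of_apply, WithLp.ofLp_sum, WithLp.ofLp_smul,
      Finset.sum_apply, Pi.smul_apply, smul_eq_mul, inner_sum, inner_smul_right, Finset.sum_mul]
    rw [Finset.sum_comm]
    exact Finset.sum_congr rfl fun l _ => Finset.sum_congr rfl fun j _ => by ring
  refine ⟨fun a => ?_, ?_, fun c a => ?_⟩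
  · rw [vecSq_eq a]
    refine le_trans (le_of_eq ?_) (hqo.bessel _)
    simp only [vecSq, hVa]
  · have h1 : froSq B' = ∑ j, ‖∑ l, inner ℂ (t l) (q j) • g l‖ ^ 2 := by
      rw [froSq, Finset.sum_comm]
      refine Finset.sum_congr rfl fun j _ => ?_
      rw [EuclideanSpace.norm_sq_eq]
      refine Finset.sum_congr rfl fun i _ => ?_
      simp only [hB', Matrix.of_apply, WithLp.ofLp_sum, WithLp.ofLp_smul, Finset.sum_apply,
        Pi.smul_apply, smul_eq_mul]
      congr 2
      exact Finset.sum_congr rfl fun l _ => mul_comm _ _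
    have h2 : ∀ k, WithLp.toLp 2 (B *ᵥ Pi.single k 1) = WithLp.toLp 2 fun i => B i k := by
      intro k; rw [Matrix.mulVec_single_one]; rfl
    calc froSq B' = ∑ j, ‖∑ l, inner ℂ (t l) (q j) • g l‖ ^ 2 := h1
      _ ≤ ∑ j, ∑ l, ‖inner ℂ (t l) (q j)‖ ^ 2 :=
        Finset.sum_le_sum fun j _ => hg.norm_sum_sq_le _
      _ = ∑ l, ∑ j, ‖inner ℂ (q j) (t l)‖ ^ 2 := by
        rw [Finset.sum_comm]
        exact Finset.sum_congr rfl fun l _ => Finset.sum_congr rfl fun j _ => by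
          rw [norm_inner_symm]
      _ ≤ ∑ l, ‖t l‖ ^ 2 := Finset.sum_le_sum fun l _ => hqo.bessel _
      _ = ∑ l, ∑ k, ‖inner ℂ (g l) (WithLp.toLp 2 fun i => B i k)‖ ^ 2 := by
        refine Finset.sum_congr rfl fun l _ => ?_
        rw [EuclideanSpace.norm_sq_eq]
        refine Finset.sum_congr rfl fun k _ => ?_
        rw [← h2, ← inner_pullVec]
        congr 1
        rw [← ht, ← norm_star]
        congr 1
        simp [PiLp.inner_apply]
      _ ≤ froSq B := by
        rw [Finset.sum_comm, froSq, Finset.sum_comm (γ := Fin N)]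
        refine Finset.sum_le_sum fun k _ => (hg.bessel _).trans (le_of_eq ?_)
        rw [EuclideanSpace.norm_sq_eq]
  · have hSc : WithLp.toLp 2 (S *ᵥ c) ∈ Submodule.span ℂ (Set.range g) := by
      have : WithLp.toLp 2 (S *ᵥ c) = ∑ j, c j • WithLp.toLp 2 (fun i => S i j) := by
        ext i
        simp [Matrix.mulVec, dotProduct, mul_comm]
      rw [this]
      exact Submodule.sum_mem _ fun j _ => Submodule.smul_mem _ _ (hS j)
    have hkey : WithLp.toLp 2 (B' *ᵥ (V *ᵥ a))
        = ∑ l, inner ℂ (g l) (WithLp.toLp 2 (B *ᵥ a)) • g l := by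
      rw [hB'b]
      refine Finset.sum_congr rfl fun l _ => ?_
      congr 1
      have htl : t l ∈ Submodule.span ℂ (Set.range q) := by
        rw [hq, span_gramSchmidtNormed_range, span_gramSchmidt]
        exact Submodule.subset_span ⟨l, rfl⟩
      have h1 := hqo.sum_eq_of_mem htl
      rw [← inner_pullVec, ← ht]
      simp only [hVa]
      conv_rhs => rw [← h1]
      rw [inner_sum, sum_inner]
      refine Finset.sum_congr rfl fun j _ => ?_
      rw [inner_smul_right, inner_smul_left, inner_conj_symm, mul_comm]
    rw [vecSq_eq, vecSq_eq, WithLp.toLp_sub, WithLp.toLp_sub, hkey]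
    exact hg.norm_sub_le _ hSc _

/-- Carries a compression at `θ` to one at `-θ`, where real filters have the conjugate response. -/
theorem IsCompression.conj {S : Matrix (Fin N) (Fin N) ℂ} {B : Matrix (Fin N) (Fin K) ℂ}
    {V : Matrix (Fin L) (Fin K) ℂ} {B' : Matrix (Fin N) (Fin L) ℂ} (h : IsCompression S B V B') :
    IsCompression (S.map (starRingEnd ℂ)) (B.map (starRingEnd ℂ)) (V.map (starRingEnd ℂ))
      (B'.map (starRingEnd ℂ)) := by
  have hv : ∀ {n : ℕ} (v : Fin n → ℂ), vecSq (fun i => (starRingEnd ℂ) (v i)) = vecSq v := by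
    intro n v; simp [vecSq]
  have hm : ∀ {m n : ℕ} (X : Matrix (Fin m) (Fin n) ℂ) (v : Fin n → ℂ),
      X.map (starRingEnd ℂ) *ᵥ v
        = fun i => (starRingEnd ℂ) ((X *ᵥ fun j => (starRingEnd ℂ) (v j)) i) := by
    intro m n X v; funext i; simp [Matrix.mulVec, dotProduct]
  refine ⟨fun a => ?_, ?_, fun c a => ?_⟩
  · rw [hm, hv, ← hv a]; exact h.contraction _
  · simpa [froSq] using h.froSq_le
  · have := h.dist_le (fun j => (starRingEnd ℂ) (c j)) (fun j => (starRingEnd ℂ) (a j))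
    rw [← hv, ← hv (_ - B *ᵥ _)] at this
    convert this using 2
    · funext i; simp [hm]
    · funext i; simp [hm]

/-! ### Compression depending measurably on the frequency -/

variable {α : Type*} [MeasurableSpace α]

theorem exists_measurable_glue {ι β : Type*} [MeasurableSpace β] (A : ι → Set α)
    (hA : ∀ i, MeasurableSet (A i)) (F : ι → α → β) (hF : ∀ i, Measurable (F i)) (i₀ : ι)
    (s : Finset ι) :
    ∃ G : α → β, Measurable G ∧ ∀ i ∈ s, ∀ x ∈ A i, ∃ j, x ∈ A j ∧ G x = F j x := by
  classical
  induction s using Finset.induction_on with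
  | empty => exact ⟨F i₀, hF i₀, by simp⟩
  | insert i s _ ih =>
    obtain ⟨G, hG, h⟩ := ih
    refine ⟨(A i).piecewise (F i) G, (hF i).piecewise (hA i) hG, fun j hj x hx => ?_⟩
    by_cases hxi : x ∈ A i
    · exact ⟨i, hxi, by simp [hxi]⟩
    · rcases Finset.mem_insert.1 hj with rfl | hj
      · exact absurd hx hxi
      · obtain ⟨k, hk, hk'⟩ := h j hj x hx
        exact ⟨k, hk, by simp [hxi, hk']⟩

/-- A basis of the column space can be picked among the columns. Surplus indices repeat column `0`,
which exists because `0 < N`. -/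
theorem exists_columns_span (hN : 0 < N) {S : Matrix (Fin N) (Fin N) ℂ}
    (hS : S.rank ≤ L) :
    ∃ J : Fin L → Fin N, ∀ j, (WithLp.toLp 2 fun i => S i j : EuclideanSpace ℂ (Fin N)) ∈
      Submodule.span ℂ (Set.range fun l => WithLp.toLp 2 fun i => S i (J l)) := by
  let v : Fin N → EuclideanSpace ℂ (Fin N) := fun j => WithLp.toLp 2 fun i => S i j
  have hr : Module.finrank ℂ (Submodule.span ℂ (Set.range v)) ≤ L := by
    refine le_trans (le_of_eq ?_) hS
    rw [Matrix.rank_eq_finrank_span_cols]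
    have : Set.range v = (WithLp.linearEquiv 2 ℂ (Fin N → ℂ)).symm '' Set.range S.col := by
      rw [← Set.range_comp]; rfl
    rw [this, ← LinearEquiv.coe_coe, Submodule.span_image]
    exact LinearEquiv.finrank_map_eq _ _
  obtain ⟨f, hf, hspan, -⟩ := Submodule.exists_fun_fin_finrank_span_eq ℂ (Set.range v)
  choose u hu using hf
  refine ⟨fun l => if h : l.1 < Module.finrank ℂ (Submodule.span ℂ (Set.range v)) then u ⟨l, h⟩
    else ⟨0, hN⟩, fun j => ?_⟩
  have h1 : v j ∈ Submodule.span ℂ (Set.range f) := by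
    rw [hspan]; exact Submodule.subset_span ⟨j, rfl⟩
  refine Submodule.span_mono ?_ h1
  rintro _ ⟨i, rfl⟩
  refine ⟨⟨i, i.2.trans_le hr⟩, ?_⟩
  simp only [i.2, dif_pos]
  exact hu i

/-- There are finitely many choices `J` of `L` columns, and each gives a measurable Gram–Schmidt
family. By the rank bound, the sets on which a choice spans all columns cover the whole space, so
the families can be glued. -/
theorem exists_measurable_compression (hN : 0 < N)
    {S : α → Matrix (Fin N) (Fin N) ℂ} (hSm : ∀ i j, Measurable fun x => S x i j)
    (hS : ∀ x, (S x).rank ≤ L)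
    {B : α → Matrix (Fin N) (Fin K) ℂ} (hB : ∀ i j, Measurable fun x => B x i j) :
    ∃ (V : α → Matrix (Fin L) (Fin K) ℂ) (B' : α → Matrix (Fin N) (Fin L) ℂ),
      (∀ i j, Measurable fun x => V x i j) ∧ (∀ i j, Measurable fun x => B' x i j) ∧
      ∀ x, IsCompression (S x) (B x) (V x) (B' x) := by
  let v : α → Fin N → EuclideanSpace ℂ (Fin N) := fun x j => WithLp.toLp 2 fun i => S x i j
  have hv : ∀ j, Measurable fun x => v x j := fun j =>
    (WithLp.measurable_toLp 2 _).comp (measurable_pi_lambda _ fun i => hSm i j)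
  let F : (Fin L → Fin N) → α → Fin L → EuclideanSpace ℂ (Fin N) :=
    fun J x => gramSchmidtNormed ℂ fun l => v x (J l)
  have hFl : ∀ J l, Measurable fun x => F J x l := fun J l =>
    measurable_gramSchmidtNormed (fun l => hv (J l)) l
  let A : (Fin L → Fin N) → Set α :=
    -- Membership in the span is expressed by the expansion identity, an equation between measurable
    -- functions.
    fun J => ⋂ j, {x | ∑ l, inner ℂ (F J x l) (v x j) • F J x l = v x j}
  have hA : ∀ J, MeasurableSet (A J) := fun J => MeasurableSet.iInter fun j =>
    measurableSet_eq_fun (Finset.measurable_sum _ fun l _ =>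
      Measurable.smul (Measurable.inner (𝕜 := ℂ) (hFl J l) (hv j)) (hFl J l)) (hv j)
  obtain ⟨g, hgm, hg⟩ := exists_measurable_glue A hA F (fun J => measurable_pi_lambda _ (hFl J))
    (fun _ => ⟨0, hN⟩) Finset.univ
  have hgl : ∀ l, Measurable fun x => g x l := fun l => (measurable_pi_apply l).comp hgm
  have hgood : ∀ x, IsPartialONB (g x) ∧ ∀ j, v x j ∈ Submodule.span ℂ (Set.range (g x)) := by
    intro x
    obtain ⟨J, hJ⟩ := exists_columns_span hN (hS x)
    have hxA : x ∈ A J := by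
      refine Set.mem_iInter.2 fun j => ?_
      refine (isPartialONB_gramSchmidtNormed _).sum_eq_of_mem ?_
      rw [span_gramSchmidtNormed_range, span_gramSchmidt]
      exact hJ j
    obtain ⟨J', hJ', e⟩ := hg J (Finset.mem_univ _) x hxA
    rw [e]
    refine ⟨isPartialONB_gramSchmidtNormed _, fun j => ?_⟩
    have := Set.mem_iInter.1 hJ' j
    simp only [Set.mem_ofPred_eq] at this
    rw [← this]
    exact Submodule.sum_mem _ fun l _ => Submodule.smul_mem _ _ (Submodule.subset_span ⟨l, rfl⟩)
  have hcoord : ∀ {n : ℕ} {u : α → EuclideanSpace ℂ (Fin n)}, Measurable u → ∀ i,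
      Measurable fun x => u x i := fun hu i =>
    (measurable_pi_apply i).comp ((WithLp.measurable_ofLp 2 _).comp hu)
  have hpull : ∀ l, Measurable fun x => pullVec (B x) (g x) l := fun l =>
    (WithLp.measurable_toLp 2 _).comp (measurable_pi_lambda _ fun k =>
      Finset.measurable_sum _ fun i _ => (hcoord (hgl l) i).mul
        (Complex.continuous_conj.measurable.comp (hB i k)))
  refine ⟨_, _, fun j k => ?_, fun i j => ?_, fun x =>
    isCompression_of_isPartialONB (B x) (hgood x).1 (hgood x).2⟩
  · exact Complex.continuous_conj.measurable.comp
      (hcoord (measurable_gramSchmidtNormed hpull j) k)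
  · simp only [Matrix.of_apply]
    exact Finset.measurable_sum _ fun l _ => Measurable.mul (hcoord (hgl l) i)
      (Measurable.inner (𝕜 := ℂ) (hpull l) (measurable_gramSchmidtNormed hpull j))

end

/-! ### Trigonometric polynomials with real coefficients -/

section

variable {T : ℝ}

/-- The frequency response of a finite digital filter with real taps. -/
def trig (T : ℝ) (c : ℤ →₀ ℝ) (θ : AddCircle T) : ℂ := c.sum fun n a => a * fourier n θ

/-- The sum of the squares of the taps. -/
def coefSq (c : ℤ →₀ ℝ) : ℝ := c.sum fun _ a => a ^ 2

theorem coefSq_nonneg (c : ℤ →₀ ℝ) : 0 ≤ coefSq c := Finset.sum_nonneg fun _ _ => sq_nonneg _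

theorem continuous_trig (c : ℤ →₀ ℝ) : Continuous (trig T c) := by
  unfold trig Finsupp.sum
  exact continuous_finsetSum _ fun n _ => continuous_const.mul (fourier n).continuous

theorem norm_trig_le [Fact (0 < T)] (c : ℤ →₀ ℝ) (θ : AddCircle T) :
    ‖trig T c θ‖ ≤ ∑ n ∈ c.support, |c n| := by
  refine (norm_sum_le _ _).trans (Finset.sum_le_sum fun n _ => ?_)
  rw [norm_mul, Complex.norm_real, Real.norm_eq_abs]
  exact mul_le_of_le_one_right (abs_nonneg _)
    (((fourier n).norm_coe_le_norm θ).trans (fourier_norm n).le)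

theorem fourier_apply_neg (n : ℤ) (θ : AddCircle T) :
    fourier n (-θ) = (starRingEnd ℂ) (fourier n θ) := by
  rw [← fourier_neg, fourier_apply, fourier_apply, smul_neg, neg_smul]

theorem trig_neg (c : ℤ →₀ ℝ) (θ : AddCircle T) :
    trig T c (-θ) = (starRingEnd ℂ) (trig T c θ) := by
  simp only [trig, Finsupp.sum, map_sum, map_mul, Complex.conj_ofReal, fourier_apply_neg]

theorem trig_coe (c : ℤ →₀ ℝ) (f : ℝ) : trig T c (f : AddCircle T)
    = c.sum fun n a => a * Complex.exp (2 * Real.pi * Complex.I * f * ((n * T⁻¹ : ℝ) : ℂ)) := by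
  unfold trig
  refine Finset.sum_congr rfl fun n _ => ?_
  beta_reduce
  rw [fourier_coe_apply]
  congr 2
  push_cast
  ring

theorem integral_norm_trig_sq [Fact (0 < T)] (c : ℤ →₀ ℝ) :
    ∫ θ, ‖trig T c θ‖ ^ 2 ∂AddCircle.haarAddCircle = coefSq c := by
  have h1 : ∀ θ : AddCircle T, ((‖trig T c θ‖ ^ 2 : ℝ) : ℂ)
      = ∑ n ∈ c.support, ∑ m ∈ c.support, (c n : ℂ) * c m * (fourier (-m) θ * fourier n θ) := by
    intro θ
    rw [← Complex.normSq_eq_norm_sq, ← Complex.mul_conj]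
    simp only [trig, Finsupp.sum, map_sum, map_mul, Complex.conj_ofReal, ← fourier_neg,
      Finset.sum_mul_sum]
    exact Finset.sum_congr rfl fun n _ => Finset.sum_congr rfl fun m _ => by ring
  have hint : ∀ n m : ℤ, Integrable (fun θ : AddCircle T =>
      (c n : ℂ) * c m * (fourier (-m) θ * fourier n θ)) AddCircle.haarAddCircle := fun n m =>
    (Continuous.integrable_of_hasCompactSupport (by fun_prop) (HasCompactSupport.of_compactSpace _))
  have h2 : ∀ n m : ℤ, ∫ θ : AddCircle T, fourier (-m) θ * fourier n θ ∂AddCircle.haarAddCircle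
      = if m = n then 1 else 0 := by
    intro n m
    have := congrFun (fourierCoeff_fourier (T := T) n) m
    simp only [fourierCoeff, smul_eq_mul] at this
    rw [this, Pi.single_apply]
  have h3 : ((∫ θ, ‖trig T c θ‖ ^ 2 ∂AddCircle.haarAddCircle : ℝ) : ℂ) = (coefSq c : ℝ) := by
    rw [← integral_complex_ofReal]
    simp_rw [h1]
    rw [integral_finsetSum _ fun n _ => integrable_finsetSum _ fun m _ => hint n m]
    simp_rw [integral_finsetSum _ fun m _ => hint _ m, integral_const_mul, h2]
    simp only [coefSq, Finsupp.sum, Complex.ofReal_sum]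
    refine Finset.sum_congr rfl fun n hn => ?_
    simp only [mul_ite, mul_one, mul_zero, Finset.sum_ite_eq', hn, if_true]
    push_cast; ring
  exact_mod_cast h3

theorem lintegral_norm_trig_sq [Fact (0 < T)] (c : ℤ →₀ ℝ) :
    ∫⁻ θ, ENNReal.ofReal (‖trig T c θ‖ ^ 2) ∂AddCircle.haarAddCircle
      = ENNReal.ofReal (coefSq c) := by
  have h : Integrable (fun θ => ‖trig T c θ‖ ^ 2) (AddCircle.haarAddCircle (T := T)) :=
    Continuous.integrable_of_hasCompactSupport ((continuous_trig c).norm.pow 2)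
      (HasCompactSupport.of_compactSpace _)
  rw [← integral_norm_trig_sq (T := T), ofReal_integral_eq_lintegral_ofReal h
    (Eventually.of_forall fun _ => by positivity)]

/-- Continuous functions are dense in `L²(μ)`, trigonometric polynomials are uniformly dense among
them, and the finite mass of `μ` turns uniform closeness into closeness in `L²(μ)`. -/
theorem exists_fourier_approx [Fact (0 < T)] (μ : Measure (AddCircle T)) [IsFiniteMeasure μ]
    {φ : AddCircle T → ℂ} (hφ : MemLp φ 2 μ) {δ : ℝ} (hδ : 0 < δ) :
    ∃ d : ℤ →₀ ℂ, eLpNorm (φ - fun θ => d.sum fun n a => a * fourier n θ) 2 μ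
      ≤ ENNReal.ofReal δ := by
  obtain ⟨g, hg, hgm⟩ := hφ.exists_boundedContinuous_eLpNorm_sub_le (by simp)
    (ε := ENNReal.ofReal (δ / 2)) (by simpa using hδ)
  set κ : ℝ := (μ Set.univ).toReal ^ (1 / 2 : ℝ) with hκ
  have hκ0 : 0 ≤ κ := by positivity
  have hmem : (g : C(AddCircle T, ℂ)) ∈
      (Submodule.span ℂ (Set.range (@fourier T))).topologicalClosure := by
    rw [span_fourier_closure_eq_top]; trivial
  obtain ⟨q, hq, hdist⟩ := Metric.mem_closure_iff.1 hmem (δ / (2 * (1 + κ))) (by positivity)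
  obtain ⟨d, hd⟩ := (Finsupp.mem_span_range_iff_exists_finsupp).1 hq
  have hqd : ∀ θ, q θ = d.sum fun n a => a * fourier n θ := by
    intro θ
    rw [← hd, Finsupp.sum, Finsupp.sum]
    simp
  have h2 : eLpNorm (fun θ => g θ - q θ) 2 μ ≤ ENNReal.ofReal (δ / 2) := by
    refine (eLpNorm_le_of_ae_bound (C := δ / (2 * (1 + κ)))
      (Eventually.of_forall fun θ => ?_)).trans ?_
    · rw [← dist_eq_norm]
      exact (ContinuousMap.dist_apply_le_dist (f := (g : C(AddCircle T, ℂ))) θ).trans hdist.le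
    · have e1 : μ Set.univ ^ (ENNReal.toReal 2)⁻¹ = ENNReal.ofReal κ := by
        rw [hκ, ← ENNReal.ofReal_rpow_of_nonneg ENNReal.toReal_nonneg (by norm_num),
          ENNReal.ofReal_toReal (measure_ne_top μ _)]
        norm_num
      rw [e1, ← ENNReal.ofReal_mul hκ0]
      refine ENNReal.ofReal_le_ofReal ?_
      have : κ / (1 + κ) ≤ 1 := by rw [div_le_one (by positivity)]; linarith
      calc κ * (δ / (2 * (1 + κ))) = κ / (1 + κ) * (δ / 2) := by field_simp
        _ ≤ 1 * (δ / 2) := by gcongr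
        _ = _ := one_mul _
  refine ⟨d, ?_⟩
  have e : (φ - fun θ => d.sum fun n a => a * fourier n θ) = (φ - ⇑g) + fun θ => g θ - q θ := by
    funext θ; simp [hqd]
  rw [e]
  refine (eLpNorm_add_le (hφ.sub hgm).1 ?_ (by norm_num)).trans ?_
  · exact ((g.continuous).sub q.continuous).aestronglyMeasurable
  · calc _ ≤ ENNReal.ofReal (δ / 2) + ENNReal.ofReal (δ / 2) := add_le_add hg h2
      _ = ENNReal.ofReal δ := by
        rw [← ENNReal.ofReal_add (by positivity) (by positivity), add_halves]

theorem lintegral_ofReal_norm_sq {α : Type*} [MeasurableSpace α] (μ : Measure α) (φ : α → ℂ) :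
    ∫⁻ a, ENNReal.ofReal (‖φ a‖ ^ 2) ∂μ = eLpNorm φ 2 μ ^ 2 := by
  rw [eLpNorm_eq_lintegral_rpow_enorm_toReal (by simp) (by simp), ← ENNReal.rpow_natCast,
    ← ENNReal.rpow_mul]
  simp only [ENNReal.toReal_ofNat, ENNReal.rpow_ofNat, Nat.cast_ofNat]
  norm_num

/-- Bounded conjugate-symmetric functions are limits in `L²(μ)` of responses of finite digital
filters with real taps. -/
theorem exists_trig_approx [Fact (0 < T)] (μ : Measure (AddCircle T)) [IsFiniteMeasure μ]
    {φ : AddCircle T → ℂ} (hφ : Measurable φ) {b : ℝ} (hb : ∀ θ, ‖φ θ‖ ≤ b)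
    (hsym : ∀ θ, φ (-θ) = (starRingEnd ℂ) (φ θ)) {ε : ℝ} (hε : 0 < ε) :
    ∃ c : ℤ →₀ ℝ, ∫⁻ θ, ENNReal.ofReal (‖φ θ - trig T c θ‖ ^ 2) ∂μ ≤ ENNReal.ofReal ε := by
  -- Symmetrizing the approximant involves its values at `-θ`, so the reflected measure has to be
  -- controlled too.
  set ν := μ + μ.map fun θ => -θ with hν
  have hneg : Measurable fun θ : AddCircle T => -θ := measurable_neg
  have : IsFiniteMeasure (μ.map fun θ => -θ) := Measure.isFiniteMeasure_map _ _
  have hφL : MemLp φ 2 ν :=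
    MemLp.of_bound hφ.aestronglyMeasurable b (Eventually.of_forall hb)
  obtain ⟨d, hd⟩ := exists_fourier_approx ν hφL (Real.sqrt_pos.2 hε)
  let q : AddCircle T → ℂ := fun θ => d.sum fun n a => a * fourier n θ
  have hqm : Measurable q := by
    refine Finset.measurable_sum _ fun n _ => ?_
    exact measurable_const.mul (fourier n).continuous.measurable
  -- Taking real parts of the coefficients amounts to averaging `q` with its conjugate reflection,
  -- which leaves `φ` unchanged by `hsym`.
  let c : ℤ →₀ ℝ := d.mapRange Complex.re Complex.zero_re
  have hc : ∀ θ, trig T c θ = (1 / 2) * (q θ + (starRingEnd ℂ) (q (-θ))) := by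
    intro θ
    have h1 : trig T c θ = d.sum fun n a => ((a.re : ℝ) : ℂ) * fourier n θ := by
      simp only [trig, c]
      rw [Finsupp.sum_mapRange_index (fun n => by simp)]
    rw [h1]
    simp only [q, Finsupp.sum, map_sum, map_mul, fourier_apply_neg, Complex.conj_conj,
      ← Finset.sum_add_distrib, Finset.mul_sum]
    refine Finset.sum_congr rfl fun n _ => ?_
    rw [Complex.re_eq_add_conj]; ring
  refine ⟨c, ?_⟩
  have hpt : ∀ θ, ENNReal.ofReal (‖φ θ - trig T c θ‖ ^ 2)
      ≤ ENNReal.ofReal (‖(φ - q) θ‖ ^ 2) + ENNReal.ofReal (‖(φ - q) (-θ)‖ ^ 2) := by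
    intro θ
    rw [← ENNReal.ofReal_add (by positivity) (by positivity)]
    refine ENNReal.ofReal_le_ofReal ?_
    have e : φ θ - trig T c θ
        = (1 / 2) * ((φ - q) θ + (starRingEnd ℂ) ((φ - q) (-θ))) := by
      simp only [hc, Pi.sub_apply, map_sub, hsym, Complex.conj_conj]; ring
    rw [e, norm_mul]
    have h1 := norm_add_le ((φ - q) θ) ((starRingEnd ℂ) ((φ - q) (-θ)))
    rw [RCLike.norm_conj] at h1
    set A := ‖(φ - q) θ‖
    set B := ‖(φ - q) (-θ)‖
    have h2 : ‖(1 / 2 : ℂ)‖ = 1 / 2 := by norm_num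
    rw [h2]
    have h3 := norm_nonneg ((φ - q) θ + (starRingEnd ℂ) ((φ - q) (-θ)))
    nlinarith [sq_nonneg (A - B), sq_nonneg A, sq_nonneg B]
  have hmeas : Measurable fun θ => ENNReal.ofReal (‖(φ - q) θ‖ ^ 2) :=
    ((hφ.sub hqm).norm.pow_const 2).ennreal_ofReal
  calc ∫⁻ θ, ENNReal.ofReal (‖φ θ - trig T c θ‖ ^ 2) ∂μ
      ≤ ∫⁻ θ, (ENNReal.ofReal (‖(φ - q) θ‖ ^ 2) + ENNReal.ofReal (‖(φ - q) (-θ)‖ ^ 2)) ∂μ :=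
        lintegral_mono hpt
    _ = ∫⁻ θ, ENNReal.ofReal (‖(φ - q) θ‖ ^ 2) ∂ν := by
        rw [lintegral_add_left hmeas, hν, lintegral_add_measure, lintegral_map hmeas hneg]
    _ = eLpNorm (φ - q) 2 ν ^ 2 := lintegral_ofReal_norm_sq _ _
    _ ≤ ENNReal.ofReal (√ε) ^ 2 := by gcongr
    _ = ENNReal.ofReal ε := by
        rw [← ENNReal.ofReal_pow (Real.sqrt_nonneg _), Real.sq_sqrt hε.le]

/-- A matrix of trigonometric polynomials. -/
def trigMat (T : ℝ) {m n : ℕ} (p : Fin m → Fin n → ℤ →₀ ℝ) (θ : AddCircle T) :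
    Matrix (Fin m) (Fin n) ℂ :=
  Matrix.of fun i j => trig T (p i j) θ

/-- The sum of the squares of all taps. -/
def coefSqMat {m n : ℕ} (p : Fin m → Fin n → ℤ →₀ ℝ) : ℝ := ∑ i, ∑ j, coefSq (p i j)

theorem coefSqMat_nonneg {m n : ℕ} (p : Fin m → Fin n → ℤ →₀ ℝ) : 0 ≤ coefSqMat p :=
  Finset.sum_nonneg fun _ _ => Finset.sum_nonneg fun _ _ => coefSq_nonneg _

theorem froSq_nonneg {m n : ℕ} (X : Matrix (Fin m) (Fin n) ℂ) : 0 ≤ froSq X :=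
  Finset.sum_nonneg fun _ _ => Finset.sum_nonneg fun _ _ => sq_nonneg _

theorem measurable_froSq {α : Type*} [MeasurableSpace α] {m n : ℕ}
    {X : α → Matrix (Fin m) (Fin n) ℂ} (hX : ∀ i j, Measurable fun a => X a i j) :
    Measurable fun a => froSq (X a) :=
  Finset.measurable_sum _ fun i _ => Finset.measurable_sum _ fun j _ => (hX i j).norm.pow_const 2

theorem measurable_trigMat {m n : ℕ} (p : Fin m → Fin n → ℤ →₀ ℝ) (i : Fin m) (j : Fin n) :
    Measurable fun θ => trigMat T p θ i j := (continuous_trig (p i j)).measurable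

theorem lintegral_ofReal_froSq {α : Type*} [MeasurableSpace α] (μ : Measure α) {m n : ℕ}
    {X : α → Matrix (Fin m) (Fin n) ℂ} (hX : ∀ i j, Measurable fun a => X a i j) :
    ∫⁻ a, ENNReal.ofReal (froSq (X a)) ∂μ
      = ∑ i, ∑ j, ∫⁻ a, ENNReal.ofReal (‖X a i j‖ ^ 2) ∂μ := by
  have hm : ∀ i j, Measurable fun a => ENNReal.ofReal (‖X a i j‖ ^ 2) := fun i j =>
    ((hX i j).norm.pow_const 2).ennreal_ofReal
  have h : ∀ a, ENNReal.ofReal (froSq (X a)) = ∑ i, ∑ j, ENNReal.ofReal (‖X a i j‖ ^ 2) := by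
    intro a
    rw [froSq, ENNReal.ofReal_sum_of_nonneg fun i _ => Finset.sum_nonneg fun j _ => sq_nonneg _]
    exact Finset.sum_congr rfl fun i _ => ENNReal.ofReal_sum_of_nonneg fun j _ => sq_nonneg _
  simp_rw [h]
  rw [lintegral_finsetSum _ fun i _ => Finset.measurable_sum _ fun j _ => hm i j]
  exact Finset.sum_congr rfl fun i _ => lintegral_finsetSum _ fun j _ => hm i j

theorem lintegral_froSq_trigMat [Fact (0 < T)] {m n : ℕ} (p : Fin m → Fin n → ℤ →₀ ℝ) :
    ∫⁻ θ, ENNReal.ofReal (froSq (trigMat T p θ)) ∂AddCircle.haarAddCircle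
      = ENNReal.ofReal (coefSqMat p) := by
  rw [lintegral_ofReal_froSq _ (measurable_trigMat p), coefSqMat,
    ENNReal.ofReal_sum_of_nonneg fun i _ => Finset.sum_nonneg fun j _ => coefSq_nonneg _]
  refine Finset.sum_congr rfl fun i _ => ?_
  rw [ENNReal.ofReal_sum_of_nonneg fun j _ => coefSq_nonneg _]
  exact Finset.sum_congr rfl fun j _ => lintegral_norm_trig_sq _

theorem exists_trigMat_approx [Fact (0 < T)] (μ : Measure (AddCircle T)) [IsFiniteMeasure μ]
    {m n : ℕ} {X : AddCircle T → Matrix (Fin m) (Fin n) ℂ}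
    (hX : ∀ i j, Measurable fun a => X a i j) {b : ℝ} (hb : ∀ i j θ, ‖X θ i j‖ ≤ b)
    (hsym : ∀ i j θ, X (-θ) i j = (starRingEnd ℂ) (X θ i j)) {ε : ℝ} (hε : 0 < ε) :
    ∃ p : Fin m → Fin n → ℤ →₀ ℝ,
      ∫⁻ θ, ENNReal.ofReal (froSq (X θ - trigMat T p θ)) ∂μ ≤ ENNReal.ofReal ε := by
  have hδ : 0 < ε / (m * n + 1) := by positivity
  choose p hp using fun i j => exists_trig_approx μ (hX i j) (hb i j) (hsym i j) hδ
  refine ⟨p, ?_⟩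
  rw [lintegral_ofReal_froSq (X := fun θ => X θ - trigMat T p θ) μ
    fun i j => (hX i j).sub (measurable_trigMat p i j)]
  calc _ ≤ ∑ _i : Fin m, ∑ _j : Fin n, ENNReal.ofReal (ε / (m * n + 1)) :=
        Finset.sum_le_sum fun i _ => Finset.sum_le_sum fun j _ => hp i j
    _ = ENNReal.ofReal (m * n * (ε / (m * n + 1))) := by
        simp only [Finset.sum_const, Finset.card_univ, Fintype.card_fin, nsmul_eq_mul]
        rw [← mul_assoc, ENNReal.ofReal_mul (by positivity), ENNReal.ofReal_mul (by positivity)]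
        simp
    _ ≤ ENNReal.ofReal ε := by
        refine ENNReal.ofReal_le_ofReal ?_
        rw [mul_div_assoc', div_le_iff₀ (by positivity)]
        nlinarith

end

/-! ### The Frobenius norm -/

section

variable {k m n : ℕ}

theorem froSq_eq_sum_col (X : Matrix (Fin m) (Fin n) ℂ) : froSq X = ∑ j, vecSq fun i => X i j := by
  rw [froSq, Finset.sum_comm]; rfl

/-- Young's inequality. A small `t` leaves the main term `X` almost unchanged and charges the
perturbation `Y` by `1 + t⁻¹`. -/
theorem froSq_add_le (X Y : Matrix (Fin m) (Fin n) ℂ) {t : ℝ} (ht : 0 < t) :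
    froSq (X + Y) ≤ (1 + t) * froSq X + (1 + t⁻¹) * froSq Y := by
  simp only [froSq, Finset.mul_sum, ← Finset.sum_add_distrib]
  refine Finset.sum_le_sum fun i _ => Finset.sum_le_sum fun j _ => ?_
  have h1 : ‖(X + Y) i j‖ ≤ ‖X i j‖ + ‖Y i j‖ := norm_add_le _ _
  have h0 := norm_nonneg ((X + Y) i j)
  have h2 : 2 * ‖X i j‖ * ‖Y i j‖ ≤ t * ‖X i j‖ ^ 2 + t⁻¹ * ‖Y i j‖ ^ 2 := by
    have h3 : 0 ≤ t⁻¹ * (t * ‖X i j‖ - ‖Y i j‖) ^ 2 := by positivity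
    have h4 : t⁻¹ * (t * ‖X i j‖ - ‖Y i j‖) ^ 2
        = t * ‖X i j‖ ^ 2 + t⁻¹ * ‖Y i j‖ ^ 2 - 2 * ‖X i j‖ * ‖Y i j‖ := by
      field_simp; ring
    linarith
  nlinarith

theorem froSq_mul_le (X : Matrix (Fin k) (Fin m) ℂ) (Y : Matrix (Fin m) (Fin n) ℂ) :
    froSq (X * Y) ≤ froSq X * froSq Y := by
  have h : ∀ i j, ‖(X * Y) i j‖ ^ 2 ≤ (∑ l, ‖X i l‖ ^ 2) * ∑ l, ‖Y l j‖ ^ 2 := by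
    intro i j
    rw [Matrix.mul_apply]
    calc ‖∑ l, X i l * Y l j‖ ^ 2 ≤ (∑ l, ‖X i l‖ * ‖Y l j‖) ^ 2 := by
          gcongr
          exact (norm_sum_le _ _).trans (le_of_eq (by simp))
      _ ≤ _ := Finset.sum_mul_sq_le_sq_mul_sq _ _ _
  calc froSq (X * Y) ≤ ∑ i, ∑ j, (∑ l, ‖X i l‖ ^ 2) * ∑ l, ‖Y l j‖ ^ 2 :=
        Finset.sum_le_sum fun i _ => Finset.sum_le_sum fun j _ => h i j
    _ = froSq X * froSq Y := by
        simp only [froSq]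
        rw [Finset.sum_comm (s := Finset.univ (α := Fin m)) (t := Finset.univ (α := Fin n)),
          Finset.sum_mul_sum]

/-- Expand `‖X - Y‖²`, drop `‖Y‖²`, and bound the cross term by Cauchy–Schwarz. -/
theorem froSq_le_sub (X Y : Matrix (Fin m) (Fin n) ℂ) :
    froSq X ≤ froSq (X - Y) + 2 * (√(froSq X) * √(froSq Y)) := by
  have h1 : ∑ i, ∑ j, ‖X i j‖ * ‖Y i j‖ ≤ √(froSq X) * √(froSq Y) := by
    rw [← Real.sqrt_mul (froSq_nonneg X)]
    refine Real.le_sqrt_of_sq_le ?_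
    have := Finset.sum_mul_sq_le_sq_mul_sq (Finset.univ : Finset (Fin m × Fin n))
      (fun p => ‖X p.1 p.2‖) (fun p => ‖Y p.1 p.2‖)
    simpa only [Fintype.sum_prod_type, froSq] using this
  have h2 : froSq X ≤ froSq (X - Y) + 2 * ∑ i, ∑ j, ‖X i j‖ * ‖Y i j‖ := by
    simp only [froSq, Finset.mul_sum, ← Finset.sum_add_distrib]
    refine Finset.sum_le_sum fun i _ => Finset.sum_le_sum fun j _ => ?_
    have h3 : |‖X i j‖ - ‖Y i j‖| ≤ ‖(X - Y) i j‖ := abs_norm_sub_norm_le _ _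
    have h4 : (‖X i j‖ - ‖Y i j‖) ^ 2 ≤ ‖(X - Y) i j‖ ^ 2 := by
      rw [← sq_abs]; gcongr
    nlinarith [sq_nonneg ‖Y i j‖]
  linarith

theorem norm_sq_le_froSq (X : Matrix (Fin m) (Fin n) ℂ) (i : Fin m) (j : Fin n) :
    ‖X i j‖ ^ 2 ≤ froSq X :=
  (Finset.single_le_sum (f := fun j => ‖X i j‖ ^ 2) (fun _ _ => sq_nonneg _)
    (Finset.mem_univ j)).trans
    (Finset.single_le_sum (f := fun i => ∑ j, ‖X i j‖ ^ 2)
      (fun _ _ => Finset.sum_nonneg fun _ _ => sq_nonneg _) (Finset.mem_univ i))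

theorem lintegral_ofReal_le {α : Type*} [MeasurableSpace α] {μ : Measure α} {F G H : α → ℝ}
    (hG : Measurable G) (hH : Measurable H) (hG0 : ∀ x, 0 ≤ G x) (hH0 : ∀ x, 0 ≤ H x)
    {a b : ℝ} (ha : 0 ≤ a) (hb : 0 ≤ b) (h : ∀ x, F x ≤ a * G x + b * H x) {g r : ℝ} (hg : 0 ≤ g)
    (hr : 0 ≤ r)
    (hGg : ∫⁻ x, ENNReal.ofReal (G x) ∂μ ≤ ENNReal.ofReal g)
    (hHr : ∫⁻ x, ENNReal.ofReal (H x) ∂μ ≤ ENNReal.ofReal r) :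
    ∫⁻ x, ENNReal.ofReal (F x) ∂μ ≤ ENNReal.ofReal (a * g + b * r) := by
  calc ∫⁻ x, ENNReal.ofReal (F x) ∂μ
      ≤ ∫⁻ x, (ENNReal.ofReal a * ENNReal.ofReal (G x)
          + ENNReal.ofReal b * ENNReal.ofReal (H x)) ∂μ := by
        refine lintegral_mono fun x => ?_
        rw [← ENNReal.ofReal_mul ha, ← ENNReal.ofReal_mul hb,
          ← ENNReal.ofReal_add (mul_nonneg ha (hG0 x)) (mul_nonneg hb (hH0 x))]
        exact ENNReal.ofReal_le_ofReal (h x)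
    _ = ENNReal.ofReal a * ∫⁻ x, ENNReal.ofReal (G x) ∂μ
          + ENNReal.ofReal b * ∫⁻ x, ENNReal.ofReal (H x) ∂μ := by
        rw [lintegral_add_left (hG.ennreal_ofReal.const_mul _),
          lintegral_const_mul _ hG.ennreal_ofReal, lintegral_const_mul _ hH.ennreal_ofReal]
    _ ≤ ENNReal.ofReal a * ENNReal.ofReal g + ENNReal.ofReal b * ENNReal.ofReal r := by gcongr
    _ = _ := by
        rw [← ENNReal.ofReal_mul ha, ← ENNReal.ofReal_mul hb,
          ← ENNReal.ofReal_add (mul_nonneg ha hg) (mul_nonneg hb hr)]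

theorem measurable_mul_apply {α : Type*} [MeasurableSpace α]
    {X : α → Matrix (Fin k) (Fin m) ℂ} {Y : α → Matrix (Fin m) (Fin n) ℂ}
    (hX : ∀ i j, Measurable fun a => X a i j) (hY : ∀ i j, Measurable fun a => Y a i j)
    (i : Fin k) (j : Fin n) : Measurable fun a => (X a * Y a) i j := by
  simp only [Matrix.mul_apply]
  exact Finset.measurable_sum _ fun l _ => (hX i l).mul (hY l j)

end

/-! ### Compression to fewer channels -/

section

variable {T : ℝ} {M N K L : ℕ}

theorem froSq_trigMat_le [Fact (0 < T)] (p : Fin N → Fin K → ℤ →₀ ℝ) :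
    ∃ b : ℝ, ∀ θ : AddCircle T, froSq (trigMat T p θ) ≤ b :=
  ⟨∑ i, ∑ j, (∑ n ∈ (p i j).support, |p i j n|) ^ 2, fun θ =>
    Finset.sum_le_sum fun i _ => Finset.sum_le_sum fun j _ => by
      gcongr; exact norm_trig_le _ _⟩

/-- Extension of a function on a half of the circle to a conjugate-symmetric function. -/
def symmExt (U : Set (AddCircle T)) {m n : ℕ} (X : AddCircle T → Matrix (Fin m) (Fin n) ℂ)
    (θ : AddCircle T) : Matrix (Fin m) (Fin n) ℂ :=
  open Classical in
  if θ ∈ U then X θ else if -θ ∈ U then (X (-θ)).map (starRingEnd ℂ) else 0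

theorem symmExt_neg {U : Set (AddCircle T)} (hU : ∀ θ ∈ U, -θ ∉ U) {m n : ℕ}
    (X : AddCircle T → Matrix (Fin m) (Fin n) ℂ) (θ : AddCircle T) (i : Fin m) (j : Fin n) :
    symmExt U X (-θ) i j = (starRingEnd ℂ) (symmExt U X θ i j) := by
  unfold symmExt
  by_cases h1 : θ ∈ U
  · simp [h1, hU θ h1]
  · by_cases h2 : -θ ∈ U <;> simp [h1, h2]

theorem measurable_symmExt {U : Set (AddCircle T)} (hU : MeasurableSet U) {m n : ℕ}
    {X : AddCircle T → Matrix (Fin m) (Fin n) ℂ} (hX : ∀ i j, Measurable fun θ => X θ i j)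
    (i : Fin m) (j : Fin n) : Measurable fun θ => symmExt U X θ i j := by
  classical
  have h : (fun θ => symmExt U X θ i j) = fun θ => if θ ∈ U then X θ i j else
      if -θ ∈ U then (starRingEnd ℂ) (X (-θ) i j) else 0 := by
    funext θ; unfold symmExt; split_ifs <;> simp
  rw [h]
  exact Measurable.ite hU (hX i j) (Measurable.ite (measurable_neg hU)
    (Complex.continuous_conj.measurable.comp ((hX i j).comp measurable_neg)) measurable_const)

/-- The compression is made on `U` and carried to `-U` by conjugation, so that `V` and `B'` have the
symmetry of real filters. On the rest of the circle both are zero, which is harmless because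
`hrange` forces `C` to vanish there. -/
theorem exists_symm_compression (hN : 0 < N)
    {C : ℝ → Matrix (Fin M) (Fin M) ℂ} {Γ : ℝ → Matrix (Fin N) (Fin M) ℂ}
    {S : AddCircle T → Matrix (Fin N) (Fin N) ℂ} (hSm : ∀ i j, Measurable fun θ => S θ i j)
    (hSr : ∀ θ, (S θ).rank ≤ L) {U : Set (AddCircle T)} (hU : MeasurableSet U)
    (hUneg : ∀ θ ∈ U, -θ ∉ U)
    (hrange : ∀ f : ℝ, C f = 0 ∨
      ((f : AddCircle T) ∈ U ∧ ∀ a, ∃ c, (Γ f * CFC.sqrt (C f)) *ᵥ a = S f *ᵥ c) ∨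
      (-(f : AddCircle T) ∈ U ∧
        ∀ a, ∃ c, (Γ f * CFC.sqrt (C f)) *ᵥ a = ((S (-f)).map (starRingEnd ℂ)) *ᵥ c))
    (b : Fin N → Fin K → ℤ →₀ ℝ) :
    ∃ (V : AddCircle T → Matrix (Fin L) (Fin K) ℂ) (B' : AddCircle T → Matrix (Fin N) (Fin L) ℂ),
      (∀ i j, Measurable fun θ => V θ i j) ∧ (∀ i j, Measurable fun θ => B' θ i j) ∧
      (∀ i j θ, V (-θ) i j = (starRingEnd ℂ) (V θ i j)) ∧
      (∀ i j θ, B' (-θ) i j = (starRingEnd ℂ) (B' θ i j)) ∧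
      (∀ θ a, vecSq (V θ *ᵥ a) ≤ vecSq a) ∧
      (∀ θ, froSq (B' θ) ≤ froSq (trigMat T b θ)) ∧
      ∀ (f : ℝ) (A : Matrix (Fin K) (Fin M) ℂ),
        froSq ((Γ f - B' f * (V f * A)) * CFC.sqrt (C f))
          ≤ froSq ((Γ f - trigMat T b f * A) * CFC.sqrt (C f)) := by
  obtain ⟨V, B', hV, hB', hVB⟩ := exists_measurable_compression hN hSm hSr
    (B := trigMat T b) (measurable_trigMat b)
  have htneg : ∀ θ : AddCircle T, (trigMat T b (-θ)).map (starRingEnd ℂ) = trigMat T b θ := by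
    intro θ; ext i j; simp [trigMat, trig_neg]
  have hconj : ∀ θ, IsCompression ((S (-θ)).map (starRingEnd ℂ)) (trigMat T b θ)
      ((V (-θ)).map (starRingEnd ℂ)) ((B' (-θ)).map (starRingEnd ℂ)) := by
    intro θ
    have := (hVB (-θ)).conj
    rwa [htneg] at this
  refine ⟨symmExt U V, symmExt U B', measurable_symmExt hU hV, measurable_symmExt hU hB',
    fun i j θ => symmExt_neg hUneg V θ i j, fun i j θ => symmExt_neg hUneg B' θ i j,
    fun θ a => ?_, fun θ => ?_, fun f A => ?_⟩
  · unfold symmExt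
    split_ifs
    · exact (hVB θ).contraction a
    · exact (hconj θ).contraction a
    · have h0 : (0 : ℝ) ≤ vecSq a := Finset.sum_nonneg fun i _ => sq_nonneg ‖a i‖
      simpa [vecSq] using h0
  · unfold symmExt
    split_ifs
    · exact (hVB θ).froSq_le
    · exact (hconj θ).froSq_le
    · simpa [froSq] using froSq_nonneg (trigMat T b θ)
  -- The comparison is made column by column: every column of `Γ C^{1/2}` lies in the range of `S`,
  -- as `dist_le` requires.
  · have key : ∀ {S : Matrix (Fin N) (Fin N) ℂ} {B : Matrix (Fin N) (Fin K) ℂ}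
        {V : Matrix (Fin L) (Fin K) ℂ} {B' : Matrix (Fin N) (Fin L) ℂ}, IsCompression S B V B' →
        (∀ a, ∃ c, (Γ f * CFC.sqrt (C f)) *ᵥ a = S *ᵥ c) →
        froSq ((Γ f - B' * (V * A)) * CFC.sqrt (C f))
          ≤ froSq ((Γ f - B * A) * CFC.sqrt (C f)) := by
      intro S B V B' h hc
      rw [froSq_eq_sum_col, froSq_eq_sum_col]
      refine Finset.sum_le_sum fun m _ => ?_
      obtain ⟨c, hc⟩ := hc (Pi.single m 1)
      have h1 := h.dist_le c ((A * CFC.sqrt (C f)) *ᵥ Pi.single m 1)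
      rw [← hc] at h1
      have hcol : ∀ {n : ℕ} (X : Matrix (Fin n) (Fin M) ℂ),
          (fun i => X i m) = X *ᵥ Pi.single m 1 := fun X => by
        rw [Matrix.mulVec_single_one]; rfl
      rw [hcol, hcol]
      have e1 : ((Γ f - B' * (V * A)) * CFC.sqrt (C f)) *ᵥ Pi.single m 1
          = (Γ f * CFC.sqrt (C f)) *ᵥ Pi.single m 1
            - B' *ᵥ V *ᵥ (A * CFC.sqrt (C f)) *ᵥ Pi.single m 1 := by
        simp only [Matrix.mulVec_mulVec, ← Matrix.sub_mulVec, Matrix.sub_mul, Matrix.mul_assoc]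
      have e2 : ((Γ f - B * A) * CFC.sqrt (C f)) *ᵥ Pi.single m 1
          = (Γ f * CFC.sqrt (C f)) *ᵥ Pi.single m 1
            - B *ᵥ (A * CFC.sqrt (C f)) *ᵥ Pi.single m 1 := by
        rw [Matrix.mulVec_mulVec, ← Matrix.sub_mulVec, Matrix.sub_mul, Matrix.mul_assoc]
      rw [e1, e2]
      exact h1
    rcases hrange f with h | ⟨h, hc⟩ | ⟨h, hc⟩
    · have : CFC.sqrt (C f) = 0 := by rw [h, CFC.sqrt_zero]
      simp [this]
    · simp only [symmExt, h, if_true]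
      exact key (hVB f) hc
    · have h' : (f : AddCircle T) ∉ U := fun hf => hUneg _ hf h
      simp only [symmExt, h, h', if_true, if_false]
      exact key (hconj f) hc

/-- The factors `V` and `B'` are merely measurable. Replacing them by real trigonometric polynomials
costs `ε`, and then the compressed channels are finite combinations of samples of the old ones, and
the digital filter is finite. -/
theorem exists_compression [Fact (0 < T)] (hN : 0 < N)
    {C : ℝ → Matrix (Fin M) (Fin M) ℂ} (hC : ∀ i j, Measurable fun f => C f i j)
    (hCp : ∀ f, (C f).PosSemidef)
    {Γ : ℝ → Matrix (Fin N) (Fin M) ℂ} (hΓ : ∀ i j, Measurable fun f => Γ f i j)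
    {S : AddCircle T → Matrix (Fin N) (Fin N) ℂ} (hSm : ∀ i j, Measurable fun θ => S θ i j)
    (hSr : ∀ θ, (S θ).rank ≤ L) {U : Set (AddCircle T)} (hU : MeasurableSet U)
    (hUneg : ∀ θ ∈ U, -θ ∉ U)
    (hrange : ∀ f : ℝ, C f = 0 ∨
      ((f : AddCircle T) ∈ U ∧ ∀ a, ∃ c, (Γ f * CFC.sqrt (C f)) *ᵥ a = S f *ᵥ c) ∨
      (-(f : AddCircle T) ∈ U ∧
        ∀ a, ∃ c, (Γ f * CFC.sqrt (C f)) *ᵥ a = ((S (-f)).map (starRingEnd ℂ)) *ᵥ c))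
    {A : ℝ → Matrix (Fin K) (Fin M) ℂ} (hA : ∀ i j, Measurable fun f => A f i j)
    (b : Fin N → Fin K → ℤ →₀ ℝ) {d e : ℝ} (hd0 : 0 ≤ d) (he0 : 0 ≤ e)
    (hd : ∫⁻ f : ℝ, ENNReal.ofReal (froSq ((Γ f - trigMat T b f * A f) * CFC.sqrt (C f)))
      ≤ ENNReal.ofReal d)
    (he : ∫⁻ f : ℝ, ENNReal.ofReal (froSq (A f * CFC.sqrt (C f))) ≤ ENNReal.ofReal e)
    {ε : ℝ} (hε : 0 < ε) :
    ∃ (p : Fin L → Fin K → ℤ →₀ ℝ) (β : Fin N → Fin L → ℤ →₀ ℝ),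
      ∫⁻ f : ℝ, ENNReal.ofReal (froSq ((Γ f - trigMat T β f * (trigMat T p f * A f)) *
        CFC.sqrt (C f))) ≤ ENNReal.ofReal (d + ε) ∧
      ∫⁻ f : ℝ, ENNReal.ofReal (froSq (trigMat T p f * A f * CFC.sqrt (C f)))
        ≤ ENNReal.ofReal (e + ε) ∧
      coefSqMat β ≤ coefSqMat b + ε := by
  obtain ⟨V, B', hV, hB', hVs, hBs, hVc, hBf, hdist⟩ :=
    exists_symm_compression (L := L) hN hSm hSr hU hUneg hrange b
  obtain ⟨M₀, hM₀⟩ := froSq_trigMat_le (T := T) b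
  have hR := measurable_sqrt_apply hC hCp
  have hcoe : Measurable ((↑) : ℝ → AddCircle T) := AddCircle.measurable_mk'
  set ef : ℝ → ℝ := fun f => froSq (A f * CFC.sqrt (C f)) with hef
  have hefm : Measurable ef := measurable_froSq (measurable_mul_apply hA hR)
  have hef0 : ∀ f, 0 ≤ ef f := fun f => froSq_nonneg _
  -- The power density of the channels, folded onto the circle: integrals over the line of a
  -- periodic function times `ef` become integrals against this finite measure.
  set μ : Measure (AddCircle T) :=
    (volume.withDensity fun f => ENNReal.ofReal (ef f)).map (↑) with hμ
  have hμfin : IsFiniteMeasure μ := by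
    have : IsFiniteMeasure (volume.withDensity fun f => ENNReal.ofReal (ef f)) :=
      isFiniteMeasure_withDensity (ne_top_of_le_ne_top ENNReal.ofReal_ne_top he)
    exact Measure.isFiniteMeasure_map _ _
  have hμint : ∀ g : AddCircle T → ℝ, Measurable g → (∀ θ, 0 ≤ g θ) →
      ∫⁻ f : ℝ, ENNReal.ofReal (g f * ef f) = ∫⁻ θ, ENNReal.ofReal (g θ) ∂μ := by
    intro g hg hg0
    rw [hμ, lintegral_map hg.ennreal_ofReal hcoe,
      lintegral_withDensity_eq_lintegral_mul volume hefm.ennreal_ofReal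
        (g := fun f : ℝ => ENNReal.ofReal (g f)) (hg.comp hcoe).ennreal_ofReal]
    refine lintegral_congr fun f => ?_
    rw [Pi.mul_apply, mul_comm, ENNReal.ofReal_mul (hef0 f)]
  set G := coefSqMat b with hG
  have hG0 : 0 ≤ G := coefSqMat_nonneg b
  -- the parameters of the approximation
  set t : ℝ := ε / (2 * (1 + d + e + G)) with ht
  have ht0 : 0 < t := by positivity
  have htε : t * (d + e + G) ≤ ε / 2 := by
    have h1 : t * (1 + d + e + G) = ε / 2 := by rw [ht]; field_simp
    nlinarith
  set ε₁ : ℝ := ε / (8 * (1 + t⁻¹)) with hε₁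
  have hti : 0 < t⁻¹ := inv_pos.2 ht0
  have hε₁0 : 0 < ε₁ := by positivity
  have hε₁' : (1 + t⁻¹) * (2 * ε₁) = ε / 4 := by rw [hε₁]; field_simp; ring
  -- Closeness for `μ` controls the estimation error; closeness for the Haar measure controls the
  -- taps, by Parseval.
  obtain ⟨β, hβ⟩ := exists_trigMat_approx (μ + AddCircle.haarAddCircle) hB' (b := √M₀)
    (fun i j θ => Real.le_sqrt_of_sq_le
      ((norm_sq_le_froSq _ i j).trans ((hBf θ).trans (hM₀ θ)))) hBs hε₁0
  rw [lintegral_add_measure] at hβ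
  have hβμ := le_self_add.trans hβ
  have hβh := le_add_self.trans hβ
  obtain ⟨M₁, hM₁⟩ := froSq_trigMat_le (T := T) β
  have hM₁0 : 0 ≤ M₁ := (froSq_nonneg _).trans (hM₁ 0)
  -- The error of `p` is multiplied by `β` in the estimate, so `β` is fixed first and its bound `M₁`
  -- enters here.
  set ε₂ : ℝ := ε / (8 * (1 + t⁻¹) * (1 + M₁)) with hε₂
  have hε₂0 : 0 < ε₂ := by positivity
  have hε₂' : (1 + t⁻¹) * (2 * ((1 + M₁) * ε₂)) = ε / 4 := by rw [hε₂]; field_simp; ring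
  obtain ⟨p, hp⟩ := exists_trigMat_approx μ hV (b := 1) (fun i j θ => by
    have h1 := hVc θ (Pi.single j 1)
    have h2 : vecSq (Pi.single j 1 : Fin K → ℂ) = 1 := by
      rw [vecSq, Finset.sum_eq_single j] <;> simp +contextual
    have h3 : ‖V θ i j‖ ^ 2 ≤ 1 := by
      rw [← h2]
      refine le_trans ?_ h1
      rw [Matrix.mulVec_single_one]
      exact Finset.single_le_sum (f := fun i => ‖V θ i j‖ ^ 2) (fun _ _ => sq_nonneg _)
        (Finset.mem_univ i)
    nlinarith [norm_nonneg (V θ i j)]) hVs hε₂0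
  have hVA : ∀ f : ℝ, froSq (V f * A f * CFC.sqrt (C f)) ≤ ef f := by
    intro f
    simp only [hef]
    rw [froSq_eq_sum_col, froSq_eq_sum_col, Matrix.mul_assoc]
    exact Finset.sum_le_sum fun m _ => hVc f fun i => (A f * CFC.sqrt (C f)) i m
  have hm1 : Measurable fun θ => froSq (B' θ - trigMat T β θ) :=
    measurable_froSq (X := fun θ => B' θ - trigMat T β θ)
      fun i j => (hB' i j).sub (measurable_trigMat β i j)
  have hm2 : Measurable fun θ => froSq (V θ - trigMat T p θ) :=
    measurable_froSq (X := fun θ => V θ - trigMat T p θ)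
      fun i j => (hV i j).sub (measurable_trigMat p i j)
  have hi1 := (hμint _ hm1 fun θ => froSq_nonneg _).trans_le hβμ
  have hi2 := (hμint _ hm2 fun θ => froSq_nonneg _).trans_le hp
  refine ⟨p, β, ?_, ?_, ?_⟩
  · have hH : ∫⁻ f : ℝ, ENNReal.ofReal (froSq (B' f - trigMat T β f) * ef f
        + M₁ * (froSq (V f - trigMat T p f) * ef f)) ≤ ENNReal.ofReal (1 * ε₁ + M₁ * ε₂) :=
      lintegral_ofReal_le ((hm1.comp hcoe).mul hefm) ((hm2.comp hcoe).mul hefm)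
        (fun f => mul_nonneg (froSq_nonneg _) (hef0 f))
        (fun f => mul_nonneg (froSq_nonneg _) (hef0 f)) zero_le_one hM₁0
        (fun f => by simp) hε₁0.le hε₂0.le hi1 hi2
    have hXm : ∀ i j, Measurable fun f : ℝ =>
        ((Γ f - trigMat T b f * A f) * CFC.sqrt (C f)) i j := by
      refine measurable_mul_apply (X := fun f : ℝ => Γ f - trigMat T b f * A f)
        (fun i j => (hΓ i j).sub ?_) hR
      exact measurable_mul_apply (X := fun f : ℝ => trigMat T b f)
        (fun i j => (measurable_trigMat b i j).comp hcoe) hA i j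
    refine (lintegral_ofReal_le (a := 1 + t) (b := (1 + t⁻¹) * 2) (measurable_froSq hXm)
      (((hm1.comp hcoe).mul hefm).add (((hm2.comp hcoe).mul hefm).const_mul M₁))
      (fun f => froSq_nonneg _) (fun f => add_nonneg (mul_nonneg (froSq_nonneg _) (hef0 f))
        (mul_nonneg hM₁0 (mul_nonneg (froSq_nonneg _) (hef0 f)))) (by positivity) (by positivity)
      (fun f => ?_) hd0 (by positivity) hd hH).trans (ENNReal.ofReal_le_ofReal ?_)
    · have e1 : (Γ f - trigMat T β f * (trigMat T p f * A f)) * CFC.sqrt (C f)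
          = (Γ f - B' f * (V f * A f)) * CFC.sqrt (C f)
            + ((B' f - trigMat T β f) * (V f * A f * CFC.sqrt (C f))
              + trigMat T β f * ((V f - trigMat T p f) * (A f * CFC.sqrt (C f)))) := by
        simp only [Matrix.sub_mul, Matrix.mul_sub, Matrix.mul_assoc]; abel
      have e2 := froSq_add_le ((Γ f - B' f * (V f * A f)) * CFC.sqrt (C f))
        ((B' f - trigMat T β f) * (V f * A f * CFC.sqrt (C f))
              + trigMat T β f * ((V f - trigMat T p f) * (A f * CFC.sqrt (C f)))) ht0
      have e3 := froSq_add_le ((B' f - trigMat T β f) * (V f * A f * CFC.sqrt (C f)))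
        (trigMat T β f * ((V f - trigMat T p f) * (A f * CFC.sqrt (C f)))) one_pos
      have e4 : froSq ((B' f - trigMat T β f) * (V f * A f * CFC.sqrt (C f)))
          ≤ froSq (B' f - trigMat T β f) * ef f :=
        (froSq_mul_le _ _).trans (mul_le_mul_of_nonneg_left (hVA f) (froSq_nonneg _))
      have e5 : froSq (trigMat T β f * ((V f - trigMat T p f) * (A f * CFC.sqrt (C f))))
          ≤ M₁ * (froSq (V f - trigMat T p f) * ef f) :=
        (froSq_mul_le _ _).trans (mul_le_mul (hM₁ _) (froSq_mul_le _ _) (froSq_nonneg _) hM₁0)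
      rw [e1]
      refine e2.trans ?_
      have e6 := mul_le_mul_of_nonneg_left (hdist f (A f)) (by positivity : 0 ≤ 1 + t)
      have e7 : (1 + t⁻¹) * froSq ((B' f - trigMat T β f) * (V f * A f * CFC.sqrt (C f))
              + trigMat T β f * ((V f - trigMat T p f) * (A f * CFC.sqrt (C f))))
          ≤ (1 + t⁻¹) * (2 * (froSq (B' f - trigMat T β f) * ef f
            + M₁ * (froSq (V f - trigMat T p f) * ef f))) := by
        refine mul_le_mul_of_nonneg_left ?_ (by positivity)
        norm_num at e3
        linarith
      simp only [Pi.add_apply, Pi.mul_apply, Function.comp_apply]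
      linarith
    · have h3 : (1 + t⁻¹) * (2 * (M₁ * ε₂)) ≤ (1 + t⁻¹) * (2 * ((1 + M₁) * ε₂)) := by
        gcongr; linarith
      nlinarith [mul_nonneg ht0.le he0, mul_nonneg ht0.le hG0]
  · refine (lintegral_ofReal_le (a := 1 + t) (b := 1 + t⁻¹) hefm ((hm2.comp hcoe).mul hefm) hef0
      (fun f => mul_nonneg (froSq_nonneg _) (hef0 f)) (by positivity) (by positivity)
      (fun f => ?_) he0 hε₂0.le he hi2).trans (ENNReal.ofReal_le_ofReal ?_)
    · have e1 : trigMat T p f * A f * CFC.sqrt (C f)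
          = V f * A f * CFC.sqrt (C f) + (trigMat T p f - V f) * (A f * CFC.sqrt (C f)) := by
        simp only [Matrix.sub_mul, Matrix.mul_assoc]; abel
      have e2 := froSq_add_le (V f * A f * CFC.sqrt (C f))
        ((trigMat T p f - V f) * (A f * CFC.sqrt (C f))) ht0
      have e3 : froSq ((trigMat T p f - V f) * (A f * CFC.sqrt (C f)))
          ≤ froSq (V f - trigMat T p f) * ef f := by
        refine (froSq_mul_le _ _).trans (le_of_eq ?_)
        congr 1
        simp only [froSq, Matrix.sub_apply, norm_sub_rev]
      rw [e1]
      refine e2.trans (add_le_add ?_ ?_)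
      · exact mul_le_mul_of_nonneg_left (hVA f) (by positivity)
      · exact mul_le_mul_of_nonneg_left e3 (by positivity)
    · have h3 : (1 + t⁻¹) * (2 * ε₂) ≤ (1 + t⁻¹) * (2 * ((1 + M₁) * ε₂)) := by
        gcongr; nlinarith
      have h4 : 0 ≤ (1 + t⁻¹) * ε₂ := by positivity
      nlinarith [mul_nonneg ht0.le hd0, mul_nonneg ht0.le hG0]
  · have hb := lintegral_froSq_trigMat (T := T) b
    have hβ2 := lintegral_ofReal_le (μ := AddCircle.haarAddCircle (T := T))
      (F := fun θ => froSq (trigMat T β θ)) (a := 1 + t) (b := 1 + t⁻¹)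
      (measurable_froSq (measurable_trigMat b)) hm1 (fun θ => froSq_nonneg _)
      (fun θ => froSq_nonneg _) (by positivity) (by positivity) (fun θ => by
        have e1 : trigMat T β θ = B' θ + (trigMat T β θ - B' θ) := by abel
        have e2 := froSq_add_le (B' θ) (trigMat T β θ - B' θ) ht0
        rw [← e1] at e2
        have e3 : froSq (trigMat T β θ - B' θ) = froSq (B' θ - trigMat T β θ) := by
          simp only [froSq, Matrix.sub_apply, norm_sub_rev]
        rw [e3] at e2
        exact e2.trans (by gcongr; exact hBf θ)) hG0 hε₁0.le hb.le hβh
    rw [lintegral_froSq_trigMat, ENNReal.ofReal_le_ofReal_iff (by positivity)] at hβ2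
    nlinarith [mul_nonneg ht0.le hd0, mul_nonneg ht0.le he0, mul_pos (add_pos one_pos hti) hε₁0]

end

/-! ### A small estimation error needs a strong signal or a strong digital filter -/

section

variable {T : ℝ} {M N : ℕ}

/-- The band is covered by finitely many periods, each contributing `T` times the Haar integral. -/
theorem exists_lintegral_band_le [Fact (0 < T)] (W : ℝ) :
    ∃ c : ℝ, 0 < c ∧ ∀ F : AddCircle T → ℝ≥0∞,
      ∫⁻ f in Set.Icc (-W) W, F (f : ℝ) ≤ ENNReal.ofReal c * ∫⁻ θ, F θ ∂AddCircle.haarAddCircle := by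
  have hT : (0 : ℝ) < T := Fact.out
  obtain ⟨n, hn⟩ := exists_nat_gt (W / T)
  rw [div_lt_iff₀ hT] at hn
  set s : Finset ℤ := Finset.Icc (-(n : ℤ) - 1) n with hs
  refine ⟨(s.card + 1) * T, by positivity, fun F => ?_⟩
  have hcov : Set.Icc (-W) W ⊆ ⋃ i : s, Set.Ioc ((i : ℤ) * T) ((i : ℤ) * T + T) := by
    intro f hf
    set i : ℤ := ⌈f / T⌉ - 1 with hi
    have h1 : f ≤ ⌈f / T⌉ * T := by rw [← div_le_iff₀ hT]; exact Int.le_ceil _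
    have h2 : (⌈f / T⌉ - 1) * T < f := by
      rw [← lt_div_iff₀ hT]; linarith [Int.ceil_lt_add_one (f / T)]
    have hn' : |f / T| ≤ n := by
      rw [abs_div, abs_of_pos hT, div_le_iff₀ hT]
      exact (abs_le.2 hf).trans hn.le
    have h3 := abs_le.1 hn'
    have h4 : ⌈f / T⌉ ≤ n := Int.ceil_le.2 (by exact_mod_cast h3.2)
    have h5 : -(n : ℤ) ≤ ⌈f / T⌉ := by
      have : (-(n : ℝ)) ≤ ⌈f / T⌉ := h3.1.trans (Int.le_ceil _)
      exact_mod_cast this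
    refine Set.mem_iUnion.2 ⟨⟨i, Finset.mem_Icc.2 ⟨by omega, by omega⟩⟩, ?_, ?_⟩
    · simpa [hi] using h2
    · simp only [hi]; push_cast; linarith
  calc ∫⁻ f in Set.Icc (-W) W, F (f : ℝ)
      ≤ ∫⁻ f in ⋃ i : s, Set.Ioc ((i : ℤ) * T) ((i : ℤ) * T + T), F (f : ℝ) :=
        lintegral_mono_set hcov
    _ ≤ ∑' i : s, ∫⁻ f in Set.Ioc ((i : ℤ) * T) ((i : ℤ) * T + T), F (f : ℝ) :=
        lintegral_iUnion_le _ _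
    _ = ∑' _ : s, ENNReal.ofReal T * ∫⁻ θ, F θ ∂AddCircle.haarAddCircle := by
        refine tsum_congr fun i => ?_
        rw [AddCircle.lintegral_preimage, AddCircle.volume_eq_smul_haarAddCircle,
          lintegral_smul_measure, smul_eq_mul]
    _ = ENNReal.ofReal (s.card * T) * ∫⁻ θ, F θ ∂AddCircle.haarAddCircle := by
        rw [tsum_fintype, Finset.sum_const, nsmul_eq_mul, ENNReal.ofReal_mul (Nat.cast_nonneg _),
          mul_assoc]
        simp
    _ ≤ _ := by gcongr; simp

theorem exists_tail_le {a : ℝ → ℝ} (ha : Measurable a)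
    (hfin : ∫⁻ f, ENNReal.ofReal (a f) ≠ ⊤) {δ : ℝ} (hδ : 0 < δ) :
    ∃ τ : ℝ, 0 < τ ∧
      ∫⁻ f, ENNReal.ofReal (if τ ^ 2 < a f then a f else 0) ≤ ENNReal.ofReal δ := by
  have h : Tendsto (fun n : ℕ => ∫⁻ f, ENNReal.ofReal (if ((n : ℝ) + 1) ^ 2 < a f then a f else 0))
      atTop (𝓝 (∫⁻ _ : ℝ, 0)) := by
    refine tendsto_lintegral_of_dominated_convergence (fun f => ENNReal.ofReal (a f))
      (fun n => (Measurable.ite (measurableSet_lt measurable_const ha) ha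
        measurable_const).ennreal_ofReal) (fun n => .of_forall fun f => ?_) hfin
      (.of_forall fun f => ?_)
    · dsimp only
      split_ifs
      · exact le_rfl
      · simp
    · refine tendsto_const_nhds.congr' ?_
      obtain ⟨m, hm⟩ := exists_nat_ge (a f)
      filter_upwards [eventually_ge_atTop m] with n hn
      have h1 : (m : ℝ) ≤ n := by exact_mod_cast hn
      rw [if_neg (not_lt.2 (by nlinarith [(Nat.cast_nonneg n : (0 : ℝ) ≤ n)])), ENNReal.ofReal_zero]
  rw [lintegral_zero] at h
  obtain ⟨n, hn⟩ := (h.eventually (ge_mem_nhds (ENNReal.ofReal_pos.2 hδ))).exists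
  exact ⟨n + 1, by positivity, hn⟩

/-- Lowering the error by `δ` below that of the zero estimate needs a cross term between `Γ C^{1/2}`
and `B A C^{1/2}` of that order. Once the part with `‖Γ C^{1/2}‖ > τ` is discarded, Cauchy–Schwarz
bounds this term by the square root of `e ∫ ‖B‖²` up to a constant, and the integral over the band
is at most a constant times the sum of squared taps. The bound `ρ` is uniform in `K` and in the
system. -/
theorem exists_le_power_mul_coefSqMat [Fact (0 < T)]
    {C : ℝ → Matrix (Fin M) (Fin M) ℂ} (hC : ∀ i j, Measurable fun f => C f i j)
    (hCp : ∀ f, (C f).PosSemidef) {W : ℝ} (hW : ∀ f, W < |f| → C f = 0)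
    {Γ : ℝ → Matrix (Fin N) (Fin M) ℂ} (hΓ : ∀ i j, Measurable fun f => Γ f i j)
    {Φ : ℝ}
    (hΦ : ∫⁻ f, ENNReal.ofReal (froSq (Γ f * CFC.sqrt (C f))) = ENNReal.ofReal Φ)
    {δ : ℝ} (hδ : 0 < δ) :
    ∃ ρ : ℝ, 0 < ρ ∧ ∀ (K : ℕ) (A : ℝ → Matrix (Fin K) (Fin M) ℂ),
      (∀ i j, Measurable fun f => A f i j) → ∀ (b : Fin N → Fin K → ℤ →₀ ℝ) (d e : ℝ),
      0 ≤ d → 0 ≤ e →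
      ∫⁻ f : ℝ, ENNReal.ofReal (froSq ((Γ f - trigMat T b f * A f) * CFC.sqrt (C f)))
        ≤ ENNReal.ofReal d →
      ∫⁻ f : ℝ, ENNReal.ofReal (froSq (A f * CFC.sqrt (C f))) ≤ ENNReal.ofReal e →
      d ≤ Φ - δ → ρ ≤ e * coefSqMat b := by
  have hR := measurable_sqrt_apply hC hCp
  set a : ℝ → ℝ := fun f => froSq (Γ f * CFC.sqrt (C f)) with ha
  have ham : Measurable a := measurable_froSq (measurable_mul_apply hΓ hR)
  have ha0 : ∀ f, 0 ≤ a f := fun f => froSq_nonneg _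
  obtain ⟨τ, hτ, htail⟩ := exists_tail_le ham (by rw [hΦ]; exact ENNReal.ofReal_ne_top)
    (half_pos hδ)
  obtain ⟨c, hc, hband⟩ := exists_lintegral_band_le (T := T) W
  set κ : ℝ := δ / (2 * τ) with hκ
  have hκ0 : 0 < κ := by positivity
  refine ⟨κ ^ 2 / (4 * c), by positivity, fun K A hA b d e hd0 he0 hd he hdΦ => ?_⟩
  have hcoe : Measurable ((↑) : ℝ → AddCircle T) := AddCircle.measurable_mk'
  set g : ℝ → ℝ := fun f => froSq (trigMat T b (f : AddCircle T)) with hg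
  set E : ℝ → ℝ := fun f => froSq (A f * CFC.sqrt (C f)) with hE
  set D : ℝ → ℝ := fun f => froSq ((Γ f - trigMat T b (f : AddCircle T) * A f) * CFC.sqrt (C f))
    with hD
  have hgm : Measurable g := measurable_froSq fun i j => (measurable_trigMat b i j).comp hcoe
  have hEm : Measurable E := measurable_froSq (measurable_mul_apply hA hR)
  have hDm : Measurable D := by
    refine measurable_froSq (measurable_mul_apply
      (X := fun f : ℝ => Γ f - trigMat T b f * A f) (fun i j => (hΓ i j).sub ?_) hR)
    exact measurable_mul_apply (X := fun f : ℝ => trigMat T b f)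
      (fun i j => (measurable_trigMat b i j).comp hcoe) hA i j
  -- The weight `s` in the arithmetic–geometric mean inequality stands in for Cauchy–Schwarz under
  -- the integral; it is chosen after integration.
  have hpt : ∀ f, ∀ s : ℝ, 0 < s → a f ≤ D f + (if τ ^ 2 < a f then a f else 0)
      + ((τ * s) * (Set.Icc (-W) W).indicator g f + (τ / s) * E f) := by
    intro f s hs
    have hD0 : 0 ≤ D f := froSq_nonneg _
    have hE0 : 0 ≤ E f := froSq_nonneg _
    have hg0 : 0 ≤ (Set.Icc (-W) W).indicator g f :=
      Set.indicator_nonneg (fun f _ => froSq_nonneg _) f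
    have h0 : 0 ≤ (τ * s) * (Set.Icc (-W) W).indicator g f + (τ / s) * E f := by positivity
    split_ifs with h
    · linarith
    · by_cases hf : W < |f|
      · have : a f = 0 := by simp [ha, hW f hf, froSq]
        linarith
      · have hfW : f ∈ Set.Icc (-W) W := abs_le.1 (not_lt.1 hf)
        rw [Set.indicator_of_mem hfW]
        have h1 := froSq_le_sub (Γ f * CFC.sqrt (C f))
          (trigMat T b (f : AddCircle T) * (A f * CFC.sqrt (C f)))
        rw [← Matrix.mul_assoc (trigMat T b _), ← Matrix.sub_mul, Matrix.mul_assoc (trigMat T b _)]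
          at h1
        change a f ≤ D f + 2 * (√(a f) * _) at h1
        have h2 : √(a f) ≤ τ := Real.sqrt_le_iff.2 ⟨hτ.le, not_lt.1 h⟩
        have h3 : √(froSq (trigMat T b (f : AddCircle T) * (A f * CFC.sqrt (C f))))
            ≤ √(g f) * √(E f) := by
          rw [← Real.sqrt_mul (froSq_nonneg _)]
          exact Real.sqrt_le_sqrt (froSq_mul_le _ _)
        have h4 : 2 * (√(g f) * √(E f)) ≤ s * g f + s⁻¹ * E f := by
          have h5 : 0 ≤ s⁻¹ * (s * √(g f) - √(E f)) ^ 2 := by positivity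
          have h6 : s⁻¹ * (s * √(g f) - √(E f)) ^ 2
              = s * √(g f) ^ 2 + s⁻¹ * √(E f) ^ 2 - 2 * (√(g f) * √(E f)) := by
            field_simp; ring
          rw [Real.sq_sqrt (froSq_nonneg _), Real.sq_sqrt hE0] at h6
          linarith
        have h7 : √(a f) * √(froSq (trigMat T b (f : AddCircle T) * (A f * CFC.sqrt (C f))))
            ≤ τ * (√(g f) * √(E f)) := mul_le_mul h2 h3 (Real.sqrt_nonneg _) hτ.le
        have h8 := mul_le_mul_of_nonneg_left h4 hτ.le
        have h9 : τ * (s * g f + s⁻¹ * E f) = τ * s * g f + τ / s * E f := by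
          rw [div_eq_mul_inv]; ring
        linarith
  have hG0 := coefSqMat_nonneg b
  have hgint : ∫⁻ f, ENNReal.ofReal ((Set.Icc (-W) W).indicator g f)
      ≤ ENNReal.ofReal (c * coefSqMat b) := by
    have h1 : ∀ f, ENNReal.ofReal ((Set.Icc (-W) W).indicator g f)
        = (Set.Icc (-W) W).indicator (fun f => ENNReal.ofReal (g f)) f := fun f => by
      by_cases h : f ∈ Set.Icc (-W) W <;> simp [h]
    simp_rw [h1]
    rw [lintegral_indicator measurableSet_Icc]
    refine (hband fun θ => ENNReal.ofReal (froSq (trigMat T b θ))).trans (le_of_eq ?_)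
    rw [lintegral_froSq_trigMat, ENNReal.ofReal_mul hc.le]
  have htl0 : ∀ f, 0 ≤ if τ ^ 2 < a f then a f else 0 := fun f => by
    split_ifs
    exacts [ha0 f, le_rfl]
  have hint : ∀ s : ℝ, 0 < s → κ ≤ s * (c * coefSqMat b) + e / s := by
    intro s hs
    have h1 := lintegral_ofReal_le (μ := volume) (a := τ * s) (b := τ / s)
      (F := fun f => (τ * s) * (Set.Icc (-W) W).indicator g f + (τ / s) * E f)
      (hgm.indicator measurableSet_Icc) hEm
      (fun f => Set.indicator_nonneg (fun f _ => froSq_nonneg _) f) (fun f => froSq_nonneg _)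
      (by positivity) (by positivity) (fun f => le_rfl) (by positivity) he0 hgint he
    have h2 := lintegral_ofReal_le (μ := volume) (a := 1) (b := 1)
      (F := fun f => D f + if τ ^ 2 < a f then a f else 0) hDm
      (Measurable.ite (measurableSet_lt measurable_const ham) ham measurable_const)
      (fun f => froSq_nonneg _) htl0 zero_le_one zero_le_one
      (fun f => by simp) hd0 (half_pos hδ).le hd htail
    have h3 := lintegral_ofReal_le (μ := volume) (a := 1) (b := 1) (F := a)
      (hDm.add (Measurable.ite (measurableSet_lt measurable_const ham) ham measurable_const))
      (((hgm.indicator measurableSet_Icc).const_mul (τ * s)).add (hEm.const_mul (τ / s)))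
      (fun f => add_nonneg (froSq_nonneg _) (htl0 f))
      (fun f => add_nonneg (mul_nonneg (by positivity)
        (Set.indicator_nonneg (fun f _ => froSq_nonneg _) f))
        (mul_nonneg (by positivity) (froSq_nonneg _))) zero_le_one zero_le_one
      (fun f => by simpa using hpt f s hs) (by linarith) (by positivity) h2 h1
    rw [hΦ, ENNReal.ofReal_le_ofReal_iff (by positivity)] at h3
    have h4 : δ / 2 ≤ τ * (s * (c * coefSqMat b) + e / s) := by
      have : τ * (s * (c * coefSqMat b) + e / s) = τ * s * (c * coefSqMat b) + τ / s * e := by ring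
      linarith
    rw [hκ, div_le_iff₀ (by positivity)]
    nlinarith
  set X := c * coefSqMat b with hX
  have hX0 : 0 ≤ X := by positivity
  have he1 : 0 < e := by
    by_contra h
    have he2 : e = 0 := le_antisymm (not_lt.1 h) he0
    have := hint (κ / (2 * (X + 1))) (by positivity)
    rw [he2, zero_div, add_zero, div_mul_eq_mul_div, le_div_iff₀ (by positivity)] at this
    nlinarith
  -- This `s` makes `e / s = κ / 2`, so half of `κ` is absorbed and `κ² ≤ 4 c e g` remains.
  have h1 := hint (2 * e / κ) (by positivity)
  have h2 : e / (2 * e / κ) = κ / 2 := by field_simp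
  rw [h2] at h1
  have h3 : κ / 2 ≤ 2 * e / κ * X := by linarith
  rw [div_mul_eq_mul_div, le_div_iff₀ hκ0] at h3
  rw [div_le_iff₀ (by positivity)]
  have : e * coefSqMat b * (4 * c) = 4 * e * X := by rw [hX]; ring
  nlinarith

end

/-! ### A regular version of the power spectral density -/

section

variable {Ω : Type*} [MeasurableSpace Ω] {P : Measure Ω} {M N : ℕ} {x : Fin M → ℝ → Ω → ℝ}
  {C : ℝ → Matrix (Fin M) (Fin M) ℂ} {Γ : ℝ → Matrix (Fin N) (Fin M) ℂ} {s : Fin N → Ω → ℝ}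

theorem isSpec_task (hx : IsWSS P x C) (hs : IsLinearTask P x C Γ s) (i : Fin N) :
    IsSpec P x C (fun f => Γ f i) (P[s i | signalSigma x]) := by
  simpa using (isFilterOutput_iff_isSpec hx.posSemidef).1 (hs.mmse i)

/-- The exceptional null set is united with its mirror image, so zeroing respects the symmetry. For
`Γ` the symmetry holds only after multiplication by `C^{1/2}`, since nothing else of `Γ` is
determined. -/
theorem exists_symm_psd (hx : IsWSS P x C) (hs : IsLinearTask P x C Γ s)
    (hm : ∀ i j, Measurable fun f => C f i j) {B : Set ℝ} (hB : volume B = 0) :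
    ∃ Z : Set ℝ, B ⊆ Z ∧ MeasurableSet Z ∧ volume Z = 0 ∧
      (∀ f i j, zeroOn Z C (-f) i j = (starRingEnd ℂ) (zeroOn Z C f i j)) ∧
      (∀ f, (Γ (-f)).map (starRingEnd ℂ) * CFC.sqrt (zeroOn Z C f)
        = Γ f * CFC.sqrt (zeroOn Z C f)) := by
  have h1 : ∀ᵐ f : ℝ, ∀ i j, C (-f) i j = (starRingEnd ℂ) (C f i j) :=
    ae_all_iff.2 fun i => ae_all_iff.2 fun j => hx.ae_conj_symm i j
  have h2' : ∀ i, ∀ᵐ f : ℝ, specVec C (fun f m => (starRingEnd ℂ) (Γ (-f) i m)) f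
      = specVec C (fun f => Γ f i) f := fun i =>
    IsSpec.ae_conj_symm (v := fun f => Γ f i) hx hm h1 (fun m => hs.measurable_filter i m)
      (isSpec_task hx hs i)
  have h2 := ae_all_iff.2 h2'
  have h3 : ∀ᵐ f : ℝ, f ∉ B := by simpa [ae_iff] using hB
  obtain ⟨Z₁, hZ₁, hZ₁m, hZ₁0⟩ :=
    exists_measurable_superset_of_null (ae_iff.1 (h1.and (h2.and h3)))
  have hgood : ∀ f, f ∉ Z₁ → (∀ i j, C (-f) i j = (starRingEnd ℂ) (C f i j)) ∧
      (∀ i, specVec C (fun f m => (starRingEnd ℂ) (Γ (-f) i m)) f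
        = specVec C (fun f => Γ f i) f) ∧ f ∉ B := fun f hf => by
    by_contra h
    exact hf (hZ₁ h)
  have hneg : ∀ f, -f ∈ Z₁ ∪ (Neg.neg ⁻¹' Z₁) ↔ f ∈ Z₁ ∪ (Neg.neg ⁻¹' Z₁) := fun f => by
    simp [or_comm]
  refine ⟨Z₁ ∪ (Neg.neg ⁻¹' Z₁), fun f hf => ?_, hZ₁m.union (measurable_neg hZ₁m),
    measure_union_null hZ₁0 ?_, fun f i j => ?_, fun f => ?_⟩
  · by_contra h
    exact (hgood f fun h' => h (Or.inl h')).2.2 hf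
  · exact (Measure.measurePreserving_neg (volume : Measure ℝ)).quasiMeasurePreserving.preimage_null
      hZ₁0
  · by_cases h : f ∈ Z₁ ∪ (Neg.neg ⁻¹' Z₁)
    · rw [zeroOn_of_mem h, zeroOn_of_mem ((hneg f).2 h)]
      simp
    · rw [zeroOn_of_notMem h, zeroOn_of_notMem fun h' => h ((hneg f).1 h')]
      exact (hgood f fun h' => h (Or.inl h')).1 i j
  · by_cases h : f ∈ Z₁ ∪ (Neg.neg ⁻¹' Z₁)
    · rw [zeroOn_of_mem h]
      simp
    · rw [zeroOn_of_notMem h]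
      ext i m
      have := congrArg (fun v : EuclideanSpace ℂ (Fin M) => v m)
        ((hgood f fun h' => h (Or.inl h')).2.1 i)
      rw [Matrix.mul_apply_eq_vecMul, Matrix.mul_apply_eq_vecMul]
      exact this

/-- The multiples of `fs / 2` are the frequencies that equal their own negative modulo `fs`; they
belong to neither half of the circle. Being countable, they can be removed. -/
theorem exists_regular_psd (hx : IsWSS P x C) (hs : IsLinearTask P x C Γ s) (fs : ℝ) :
    ∃ C' : ℝ → Matrix (Fin M) (Fin M) ℂ, (∀ f, C' f = 0 ∨ C' f = C f) ∧ C =ᵐ[volume] C' ∧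
      (∀ i j, Measurable fun f => C' f i j) ∧
      (∀ f i j, C' (-f) i j = (starRingEnd ℂ) (C' f i j)) ∧
      (∀ f, (Γ (-f)).map (starRingEnd ℂ) * CFC.sqrt (C' f) = Γ f * CFC.sqrt (C' f)) ∧
      ∀ n : ℤ, C' (n * (fs / 2)) = 0 := by
  obtain ⟨Z₀, -, hZ₀, hm⟩ := exists_measurable_zeroOn fun i j => (hx.integrable i j).1
  have hCC : C =ᵐ[volume] zeroOn Z₀ C := (zeroOn_ae_eq hZ₀).symm
  obtain ⟨Z, hZB, hZm, hZ0, hsymC, hsymΓ⟩ := exists_symm_psd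
    (hx.congr hCC (zeroOn_posSemidef hx.posSemidef)) (hs.congr hCC) hm
    ((Set.countable_range fun n : ℤ => (n * (fs / 2) : ℝ)).measure_zero volume)
  refine ⟨zeroOn Z (zeroOn Z₀ C), fun f => ?_, hCC.trans (zeroOn_ae_eq hZ0).symm, fun i j => ?_,
    hsymC, hsymΓ, fun n => zeroOn_of_mem (hZB ⟨n, rfl⟩)⟩
  · by_cases h : f ∈ Z
    · exact Or.inl (zeroOn_of_mem h)
    · rw [zeroOn_of_notMem h]
      by_cases h' : f ∈ Z₀
      · exact Or.inl (zeroOn_of_mem h')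
      · exact Or.inr (zeroOn_of_notMem h')
  · rw [zeroOn_eq_indicator]
    exact (hm i j).indicator hZm.compl

end

/-! ### The aliased power spectral density -/

section

/-- The range of `X Xᴴ` lies in that of `X`, and the ranks agree. This replaces the wide aliased
response by a square matrix with the same range. -/
theorem exists_mulVec_mul_conjTranspose {ι κ : Type*} [Fintype ι] [Fintype κ]
    (X : Matrix ι κ ℂ) (a : κ → ℂ) : ∃ c, X *ᵥ a = (X * Xᴴ) *ᵥ c := by
  have hle : LinearMap.range (X * Xᴴ).mulVecLin ≤ LinearMap.range X.mulVecLin := by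
    rintro _ ⟨c, rfl⟩
    exact ⟨Xᴴ *ᵥ c, by simp [Matrix.mulVec_mulVec]⟩
  have heq := Submodule.eq_of_le_of_finrank_eq hle (Matrix.rank_self_mul_conjTranspose X)
  obtain ⟨c, hc⟩ : X *ᵥ a ∈ LinearMap.range (X * Xᴴ).mulVecLin := by
    rw [heq]; exact ⟨a, rfl⟩
  exact ⟨c, hc.symm⟩

theorem map_conj_mulVec {m n : ℕ} (X : Matrix (Fin m) (Fin n) ℂ) (a : Fin n → ℂ) :
    X.map (starRingEnd ℂ) *ᵥ a = fun i => (starRingEnd ℂ) ((X *ᵥ fun j => (starRingEnd ℂ) (a j)) i) := by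
  funext i
  simp [Matrix.mulVec, dotProduct, map_sum]

variable {M N : ℕ} {C C' : ℝ → Matrix (Fin M) (Fin M) ℂ} {Γ : ℝ → Matrix (Fin N) (Fin M) ℂ}
  {fs : ℝ} {Υ : ℕ}

theorem aliasedResponse_mulVec_block (C : ℝ → Matrix (Fin M) (Fin M) ℂ)
    (Γ : ℝ → Matrix (Fin N) (Fin M) ℂ) (fs : ℝ) (f : ℝ) (l : Fin (2 * Υ + 1)) (a : Fin M → ℂ) :
    aliasedResponse C Γ fs Υ f *ᵥ (fun p => if p.1 = l then a p.2 else 0)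
      = (Γ (f - ((l : ℝ) - Υ) * fs) * CFC.sqrt (C (f - ((l : ℝ) - Υ) * fs))) *ᵥ a := by
  funext i
  simp only [Matrix.mulVec, dotProduct, aliasedResponse, Matrix.of_apply]
  rw [Fintype.sum_prod_type, Finset.sum_eq_single l]
  · simp
  · intro b _ hb; simp [hb]
  · simp

/-- Zeroing `C` at some frequencies multiplies the aliased response by a diagonal matrix of zeros
and ones, which cannot raise the rank. -/
theorem rank_aliasedResponse_le (h : ∀ f, C' f = 0 ∨ C' f = C f) {f : ℝ}
    (hf : f ∈ Set.Icc (-(fs / 2)) (fs / 2)) :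
    (aliasedResponse C' Γ fs Υ f).rank ≤ maxRank C Γ fs Υ := by
  classical
  have h1 : aliasedResponse C' Γ fs Υ f = aliasedResponse C Γ fs Υ f *
      Matrix.diagonal fun p : Fin (2 * Υ + 1) × Fin M =>
        if C' (f - ((p.1 : ℝ) - Υ) * fs) = 0 then (0 : ℂ) else 1 := by
    ext i p
    rw [Matrix.mul_diagonal]
    simp only [aliasedResponse, Matrix.of_apply]
    rcases h (f - ((p.1 : ℝ) - Υ) * fs) with h | h
    · simp [h]
    · rw [h]
      split_ifs with h0
      · simp [h0]
      · simp
  have h2 : (aliasedResponse C' Γ fs Υ f).rank ≤ (aliasedResponse C Γ fs Υ f).rank := by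
    rw [h1]
    exact Matrix.rank_mul_le_left _ _
  have hbdd : BddAbove ((fun f => (aliasedResponse C Γ fs Υ f).rank) ''
      Set.Icc (-(fs / 2)) (fs / 2)) := by
    refine ⟨N, ?_⟩
    rintro _ ⟨f, -, rfl⟩
    simpa using (aliasedResponse C Γ fs Υ f).rank_le_card_height
  exact h2.trans (le_csSup hbdd (Set.mem_image_of_mem _ hf))

theorem measurable_aliasedResponse (hC : ∀ i j, Measurable fun f => C f i j)
    (hp : ∀ f, (C f).PosSemidef) (hΓ : ∀ i j, Measurable fun f => Γ f i j) (i : Fin N)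
    (p : Fin (2 * Υ + 1) × Fin M) : Measurable fun f => aliasedResponse C Γ fs Υ f i p :=
  (measurable_mul_apply hΓ (measurable_sqrt_apply hC hp) i p.2).comp
    (measurable_id.sub_const _)

/-- `S = X Xᴴ` with `X` the aliased response at the representative in `(-fs/2, fs/2]`, and `U`
corresponds to `(0, fs/2)`. A frequency of `U` in the band differs from its representative by at
most `Υ` periods, so its `Γ C^{1/2}` is a block of `X`. The other half follows by conjugate
symmetry. -/
theorem exists_aliased_psd [Fact (0 < fs)] (hC : ∀ i j, Measurable fun f => C' f i j)
    (hp : ∀ f, (C' f).PosSemidef) (hΓ : ∀ i j, Measurable fun f => Γ f i j)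
    (hCC : ∀ f, C' f = 0 ∨ C' f = C f)
    (hsymC : ∀ f i j, C' (-f) i j = (starRingEnd ℂ) (C' f i j))
    (hsymΓ : ∀ f, (Γ (-f)).map (starRingEnd ℂ) * CFC.sqrt (C' f) = Γ f * CFC.sqrt (C' f))
    (hhalf : ∀ n : ℤ, C' (n * (fs / 2)) = 0)
    (hband : ∀ f : ℝ, ((Υ : ℝ) + 1 / 2) * fs < |f| → C' f = 0) :
    ∃ (S : AddCircle fs → Matrix (Fin N) (Fin N) ℂ) (U : Set (AddCircle fs)),
      (∀ i j, Measurable fun θ => S θ i j) ∧ (∀ θ, (S θ).rank ≤ maxRank C Γ fs Υ) ∧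
      MeasurableSet U ∧ (∀ θ ∈ U, -θ ∉ U) ∧
      ∀ f : ℝ, C' f = 0 ∨
        ((f : AddCircle fs) ∈ U ∧ ∀ a, ∃ c, (Γ f * CFC.sqrt (C' f)) *ᵥ a = S f *ᵥ c) ∨
        (-(f : AddCircle fs) ∈ U ∧
          ∀ a, ∃ c, (Γ f * CFC.sqrt (C' f)) *ᵥ a = ((S (-f)).map (starRingEnd ℂ)) *ᵥ c) := by
  have hfs : 0 < fs := Fact.out
  set r : AddCircle fs → ℝ := fun θ => AddCircle.measurableEquivIoc fs (-(fs / 2)) θ with hr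
  have hrm : Measurable r :=
    measurable_subtype_coe.comp (AddCircle.measurableEquivIoc fs (-(fs / 2))).measurable
  have hrmem : ∀ θ, -(fs / 2) < r θ ∧ r θ ≤ fs / 2 := fun θ => by
    have := (AddCircle.measurableEquivIoc fs (-(fs / 2)) θ).2
    exact ⟨this.1, this.2.trans (by linarith)⟩
  have hrcoe : ∀ θ, (r θ : AddCircle fs) = θ := fun θ => AddCircle.coe_equivIoc
  have hruniq : ∀ (θ : AddCircle fs) (y : ℝ), -(fs / 2) < y → y ≤ fs / 2 →
      (y : AddCircle fs) = θ → r θ = y := by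
    intro θ y h1 h2 h3
    rw [← h3]
    exact AddCircle.equivIoc_coe_of_mem ⟨h1, by linarith⟩
  have hrneg : ∀ θ, r θ < fs / 2 → r (-θ) = -r θ := fun θ h =>
    hruniq _ _ (by linarith) (by linarith [(hrmem θ).1]) (by rw [AddCircle.coe_neg, hrcoe])
  set X := fun θ => aliasedResponse C' Γ fs Υ (r θ) with hX
  set S : AddCircle fs → Matrix (Fin N) (Fin N) ℂ := fun θ => X θ * (X θ)ᴴ with hS
  have hXm : ∀ i p, Measurable fun θ => X θ i p := fun i p =>
    (measurable_aliasedResponse hC hp hΓ i p).comp hrm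
  set U : Set (AddCircle fs) := {θ | 0 < r θ ∧ r θ < fs / 2} with hU
  have hmain : ∀ f : ℝ, C' f ≠ 0 → 0 < r f → r f < fs / 2 → ∀ a,
      ∃ c, (Γ f * CFC.sqrt (C' f)) *ᵥ a = S f *ᵥ c := by
    intro f hf h0 h1 a
    have hfband : |f| ≤ ((Υ : ℝ) + 1 / 2) * fs := not_lt.1 fun h => hf (hband f h)
    obtain ⟨n, hn⟩ : ∃ n : ℤ, n • fs = r f - f := by
      have := hrcoe (f : AddCircle fs)
      rwa [← sub_eq_zero, ← AddCircle.coe_sub, AddCircle.coe_eq_zero_iff] at this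
    rw [zsmul_eq_mul] at hn
    have hb := abs_le.1 hfband
    have hn1 : (n : ℝ) < Υ + 1 := by
      by_contra h
      nlinarith [not_lt.1 h]
    have hn2 : -((Υ : ℝ) + 1) < n := by
      by_contra h
      nlinarith [not_lt.1 h]
    have hn3 : n ≤ Υ := by
      have : n < (Υ : ℤ) + 1 := by exact_mod_cast hn1
      omega
    have hn4 : -(Υ : ℤ) ≤ n := by
      have : -((Υ : ℤ) + 1) < n := by exact_mod_cast hn2
      omega
    set l : Fin (2 * Υ + 1) := ⟨(n + Υ).toNat, by omega⟩ with hl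
    have hl' : ((l : ℕ) : ℝ) = n + Υ := by
      have : ((n + Υ).toNat : ℤ) = n + Υ := Int.toNat_of_nonneg (by omega)
      simp only [hl]
      exact_mod_cast this
    have hfl : r f - ((l : ℝ) - Υ) * fs = f := by rw [hl']; linarith
    have hblock := aliasedResponse_mulVec_block (Υ := Υ) C' Γ fs (r f) l a
    rw [hfl] at hblock
    rw [← hblock]
    exact exists_mulVec_mul_conjTranspose (X f) _
  refine ⟨S, U, fun i j => ?_, fun θ => ?_, ?_, fun θ hθ hθ' => ?_, fun f => ?_⟩
  · simp only [hS, Matrix.mul_apply, Matrix.conjTranspose_apply]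
    exact Finset.measurable_sum _ fun p _ => (hXm i p).mul
      (Complex.continuous_conj.measurable.comp (hXm j p))
  · rw [hS, Matrix.rank_self_mul_conjTranspose]
    exact rank_aliasedResponse_le hCC ⟨(hrmem θ).1.le, (hrmem θ).2⟩
  · exact (measurableSet_lt measurable_const hrm).inter (measurableSet_lt hrm measurable_const)
  · have := hrneg θ hθ.2
    have h1 := hθ'.1
    rw [this] at h1
    linarith [hθ.1]
  · by_cases hf : C' f = 0
    · exact Or.inl hf
    refine Or.inr ?_
    obtain ⟨n, hn⟩ : ∃ n : ℤ, n • fs = r f - f := by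
      have := hrcoe (f : AddCircle fs)
      rwa [← sub_eq_zero, ← AddCircle.coe_sub, AddCircle.coe_eq_zero_iff] at this
    rw [zsmul_eq_mul] at hn
    have hr1 : r f ≠ fs / 2 := by
      intro h
      refine hf ?_
      have := hhalf (1 - 2 * n)
      rwa [show (((1 - 2 * n : ℤ) : ℝ) * (fs / 2)) = f by push_cast; linarith] at this
    have hr0 : r f ≠ 0 := by
      intro h
      refine hf ?_
      have := hhalf (-2 * n)
      rwa [show (((-2 * n : ℤ) : ℝ) * (fs / 2)) = f by push_cast; linarith] at this
    have hlt : r f < fs / 2 := lt_of_le_of_ne (hrmem _).2 hr1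
    rcases lt_or_gt_of_ne hr0 with h | h
    · right
      have hrn := hrneg f hlt
      have hmemU : -(f : AddCircle fs) ∈ U := by
        simp only [hU, Set.mem_ofPred_eq, hrn]
        exact ⟨by linarith, by linarith [(hrmem (f : AddCircle fs)).1]⟩
      refine ⟨hmemU, fun a => ?_⟩
      have hsq : ∀ f, CFC.sqrt (C' f) * (CFC.sqrt (C' f))ᴴ = C' f := fun f => by
        have h2 : (CFC.sqrt (C' f))ᴴ = CFC.sqrt (C' f) := (CFC.sqrt_nonneg _).isSelfAdjoint
        rw [h2]
        exact CFC.sqrt_mul_sqrt_self _ (hp f).nonneg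
      -- Both sides have the form `Γ C Γᴴ`, so the symmetry of `C` suffices and the square roots at
      -- `f` and `-f` need not be compared.
      have hW : Γ f * CFC.sqrt (C' f) * (Γ f * CFC.sqrt (C' f))ᴴ
          = (Γ (-f) * CFC.sqrt (C' (-f)) * (Γ (-f) * CFC.sqrt (C' (-f)))ᴴ).map (starRingEnd ℂ) := by
        rw [← hsymΓ f]
        have e1 : ∀ (Y : Matrix (Fin N) (Fin M) ℂ) (R : Matrix (Fin M) (Fin M) ℂ),
            Y * R * (Y * R)ᴴ = Y * (R * Rᴴ) * Yᴴ := fun Y R => by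
          simp only [Matrix.conjTranspose_mul, Matrix.mul_assoc]
        have hCn : C' (-f) = (C' f).map (starRingEnd ℂ) := by
          ext i j; exact hsymC f i j
        rw [e1, e1, hsq, hsq, hCn, Matrix.map_mul, Matrix.map_mul]
        congr 1
        · congr 1
          ext i j; simp
      obtain ⟨a₁, ha₁⟩ := exists_mulVec_mul_conjTranspose (Γ f * CFC.sqrt (C' f)) a
      have hnf : C' (-f) ≠ 0 := by
        intro h0
        refine hf ?_
        ext i j
        have := hsymC f i j
        rw [h0] at this
        simpa using this.symm
      obtain ⟨c, hc⟩ := hmain (-f) hnf (by rw [AddCircle.coe_neg]; exact hmemU.1)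
        (by rw [AddCircle.coe_neg]; exact hmemU.2)
        ((Γ (-f) * CFC.sqrt (C' (-f)))ᴴ *ᵥ fun j => (starRingEnd ℂ) (a₁ j))
      refine ⟨fun j => (starRingEnd ℂ) (c j), ?_⟩
      rw [ha₁, hW, map_conj_mulVec, map_conj_mulVec, ← Matrix.mulVec_mulVec, hc]
      simp
    · exact Or.inl ⟨⟨h, hlt⟩, hmain f hf h hlt⟩

/-- If `L = 0`, then `S = 0`, hence `Γ C^{1/2} = 0`, and the isometry makes the best estimate
vanish. -/
theorem IsLinearTask.maxRank_pos {Ω : Type*} [MeasurableSpace Ω] {P : Measure Ω}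
    {x : Fin M → ℝ → Ω → ℝ} {s : Fin N → Ω → ℝ} (hx : IsWSS P x C')
    (hs : IsLinearTask P x C' Γ s) (hC : ∀ i j, Measurable fun f => C' f i j)
    {S : AddCircle fs → Matrix (Fin N) (Fin N) ℂ} {U : Set (AddCircle fs)} {L : ℕ}
    (hSr : ∀ θ, (S θ).rank ≤ L)
    (hrange : ∀ f : ℝ, C' f = 0 ∨
        ((f : AddCircle fs) ∈ U ∧ ∀ a, ∃ c, (Γ f * CFC.sqrt (C' f)) *ᵥ a = S f *ᵥ c) ∨
        (-(f : AddCircle fs) ∈ U ∧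
          ∀ a, ∃ c, (Γ f * CFC.sqrt (C' f)) *ᵥ a = ((S (-f)).map (starRingEnd ℂ)) *ᵥ c))
    (hne : ∃ i, ¬ (P[s i | signalSigma x] =ᵐ[P] 0)) : 1 ≤ L := by
  by_contra hL
  have hS0 : ∀ θ c, S θ *ᵥ c = 0 := fun θ c => by
    have h0 : (S θ).rank = 0 := by have := hSr θ; omega
    have h1 : LinearMap.range (S θ).mulVecLin = ⊥ := Submodule.finrank_eq_zero.1 h0
    have h2 : (S θ).mulVecLin c ∈ LinearMap.range (S θ).mulVecLin := ⟨c, rfl⟩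
    rwa [h1, Submodule.mem_bot] at h2
  have hz : ∀ f, Γ f * CFC.sqrt (C' f) = 0 := by
    intro f
    have : ∀ a, (Γ f * CFC.sqrt (C' f)) *ᵥ a = 0 := by
      intro a
      rcases hrange f with h | ⟨-, h⟩ | ⟨-, h⟩
      · simp [h]
      · obtain ⟨c, hc⟩ := h a; rw [hc, hS0]
      · obtain ⟨c, hc⟩ := h a; rw [hc, map_conj_mulVec, hS0]; funext i; simp
    ext i j
    have := congrFun (this (Pi.single j 1)) i
    rwa [Matrix.mulVec_single_one] at this
  obtain ⟨i, hi⟩ := hne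
  refine hi ?_
  have h1 := (isSpec_task hx hs i).eLpNorm_eq hx hC fun m => hs.measurable_filter i m
  have h2 : specVec C' (fun f => Γ f i) = 0 := by
    funext f
    have : (Γ f i) ᵥ* CFC.sqrt (C' f) = 0 := by
      funext m
      have := congrFun (congrFun (hz f) i) m
      rwa [Matrix.mul_apply_eq_vecMul] at this
    simp [specVec, this]
  rw [h2, eLpNorm_zero] at h1
  exact (eLpNorm_eq_zero_iff (isSpec_task hx hs i).memLp.1 (by norm_num)).1 h1

end

/-! ### Equalizing the diagonal of a matrix by an orthogonal transformation -/

section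

variable {L : ℕ}

/-- The reflection in the hyperplane orthogonal to the unit vector `cos φ e_i + sin φ e_j`. -/
def planeReflection (i j : Fin L) (φ : ℝ) : Matrix (Fin L) (Fin L) ℝ :=
  1 - (2 : ℝ) • Matrix.vecMulVec (Pi.single i (Real.cos φ) + Pi.single j (Real.sin φ))
    (Pi.single i (Real.cos φ) + Pi.single j (Real.sin φ))

theorem planeReflection_mul_transpose {i j : Fin L} (hij : i ≠ j) (φ : ℝ) :
    planeReflection i j φ * (planeReflection i j φ)ᵀ = 1 := by
  set v : Fin L → ℝ := Pi.single i (Real.cos φ) + Pi.single j (Real.sin φ) with hv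
  have hvv : v ⬝ᵥ v = 1 := by
    have : v ⬝ᵥ v = Real.cos φ ^ 2 + Real.sin φ ^ 2 := by
      simp only [hv, add_dotProduct, single_dotProduct, Pi.add_apply, Pi.single_eq_same,
        Pi.single_eq_of_ne hij, Pi.single_eq_of_ne hij.symm]
      ring
    rw [this]; exact Real.cos_sq_add_sin_sq φ
  have ht : (planeReflection i j φ)ᵀ = planeReflection i j φ := by
    simp only [planeReflection, Matrix.transpose_sub, Matrix.transpose_one, Matrix.transpose_smul,
      Matrix.transpose_vecMulVec]
  rw [ht, planeReflection, ← hv]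
  have h2 : Matrix.vecMulVec v v * Matrix.vecMulVec v v = Matrix.vecMulVec v v := by
    rw [Matrix.vecMulVec_mul_vecMulVec, hvv, one_smul]
  simp only [sub_mul, mul_sub, one_mul, mul_one, Matrix.smul_mul, Matrix.mul_smul, h2]
  ext a b
  simp only [Matrix.sub_apply, Matrix.smul_apply, smul_eq_mul]
  ring

theorem mul_mul_transpose_apply_self (U Q : Matrix (Fin L) (Fin L) ℝ) (k : Fin L) :
    (U * Q * Uᵀ) k k = U k ⬝ᵥ (Q *ᵥ U k) := by
  rw [Matrix.mul_assoc, Matrix.mul_apply]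
  rfl

/-- Induction on the number of diagonal entries different from `c`. As `c` is their mean, one entry
lies below it and one above; a reflection in the plane of these two coordinates moves one of them to
`c` and leaves all other diagonal entries alone. -/
theorem exists_orthogonal_diag_eq_const (c : ℝ) : ∀ (n : ℕ) (Q : Matrix (Fin L) (Fin L) ℝ),
    Q.trace = L * c → (Finset.univ.filter fun l => Q l l ≠ c).card ≤ n →
    ∃ U : Matrix (Fin L) (Fin L) ℝ, U * Uᵀ = 1 ∧ ∀ l, (U * Q * Uᵀ) l l = c := by
  intro n
  induction n with
  | zero =>
    intro Q _ hn
    refine ⟨1, by simp, fun l => ?_⟩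
    have h := Finset.card_eq_zero.1 (Nat.le_zero.1 hn)
    have : l ∉ Finset.univ.filter fun l => Q l l ≠ c := by rw [h]; simp
    simpa using this
  | succ n ih =>
    intro Q htr hn
    by_cases hall : ∀ l, Q l l = c
    · exact ⟨1, by simp, fun l => by simpa using hall l⟩
    push Not at hall
    have hsum : ∑ l, (Q l l - c) = 0 := by
      rw [Finset.sum_sub_distrib]
      have : ∑ l, Q l l = L * c := htr
      rw [this]; simp
    obtain ⟨l₀, hl₀⟩ := hall
    obtain ⟨i, hi⟩ : ∃ i, Q i i < c := by
      by_contra! h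
      have := (Finset.sum_eq_zero_iff_of_nonneg fun l _ => sub_nonneg.2 (h l)).1 hsum l₀
        (Finset.mem_univ _)
      exact hl₀ (sub_eq_zero.1 this)
    obtain ⟨j, hj⟩ : ∃ j, c < Q j j := by
      by_contra! h
      have := (Finset.sum_eq_zero_iff_of_nonpos fun l _ => sub_nonpos.2 (h l)).1 hsum l₀
        (Finset.mem_univ _)
      exact hl₀ (sub_eq_zero.1 this)
    have hij : i ≠ j := by rintro rfl; linarith
    have hcont : Continuous fun φ =>
        (planeReflection i j φ * Q * (planeReflection i j φ)ᵀ) i i := by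
      have h1 : Continuous (planeReflection i j) := by
        have h2 : Continuous fun φ : ℝ =>
            (Pi.single i (Real.cos φ) + Pi.single j (Real.sin φ) : Fin L → ℝ) :=
          continuous_pi fun l => by
            simp only [Pi.add_apply, Pi.single_apply]
            split_ifs <;> fun_prop
        exact continuous_const.sub ((h2.matrix_vecMulVec h2).const_smul (2 : ℝ))
      exact ((h1.matrix_mul continuous_const).matrix_mul h1.matrix_transpose).matrix_elem i i
    -- At `π / 2` the reflection fixes `e_i`, at `π / 4` it sends `e_i` to `-e_j`. The entry thus
    -- varies continuously between `Q i i < c` and `Q j j > c`.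
    obtain ⟨φ, hφ⟩ := mem_range_of_exists_le_of_exists_ge (c := c) hcont ⟨Real.pi / 2, by
        have : planeReflection i j (Real.pi / 2) i = Pi.single i 1 := by
          funext l
          simp [planeReflection, Matrix.vecMulVec_apply, hij, Matrix.one_apply, Pi.single_apply,
            eq_comm]
        rw [mul_mul_transpose_apply_self, this]
        simpa using hi.le⟩ ⟨Real.pi / 4, by
        have : planeReflection i j (Real.pi / 4) i = -Pi.single j 1 := by
          funext l
          have h2 : √2 / 2 * (√2 / 2) = (1 / 2 : ℝ) := by
            have := Real.mul_self_sqrt (show (0 : ℝ) ≤ 2 by norm_num)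
            linarith
          simp only [planeReflection, Matrix.sub_apply, Matrix.smul_apply, Matrix.vecMulVec_apply,
            Pi.add_apply, Pi.neg_apply, Real.cos_pi_div_four, Real.sin_pi_div_four, smul_eq_mul,
            Pi.single_eq_same, Pi.single_eq_of_ne hij, Matrix.one_apply]
          by_cases h3 : l = i
          · subst h3
            simp only [Pi.single_eq_same, Pi.single_eq_of_ne hij, if_true]
            linarith
          · by_cases h4 : l = j
            · subst h4
              simp only [Pi.single_eq_same, Pi.single_eq_of_ne h3, if_neg hij]
              linarith
            · simp [Pi.single_eq_of_ne h4, Ne.symm h3]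
        rw [mul_mul_transpose_apply_self, this]
        simpa [Matrix.mulVec_neg] using hj.le⟩
    set V := planeReflection i j φ with hV
    have hVi : (V * Q * Vᵀ) i i = c := hφ
    have hVV : V * Vᵀ = 1 := planeReflection_mul_transpose hij φ
    have hVV' : Vᵀ * V = 1 := mul_eq_one_comm.1 hVV
    have hrow : ∀ k, k ≠ i → k ≠ j → (V * Q * Vᵀ) k k = Q k k := by
      intro k hki hkj
      have : V k = Pi.single k 1 := by
        funext l
        simp [hV, planeReflection, Matrix.vecMulVec_apply, hki, hkj, Matrix.one_apply,
          Pi.single_apply, eq_comm]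
      rw [mul_mul_transpose_apply_self, this]
      simp
    obtain ⟨U, hU, hUc⟩ := ih (V * Q * Vᵀ) (by
        rw [Matrix.trace_mul_comm, ← Matrix.mul_assoc, hVV', Matrix.one_mul, htr]) (by
        have hsub : (Finset.univ.filter fun l => (V * Q * Vᵀ) l l ≠ c)
            ⊂ Finset.univ.filter fun l => Q l l ≠ c := by
          refine Finset.ssubset_iff_of_subset (fun k hk => ?_) |>.2 ⟨i, by simp [hi.ne], by simp [hVi]⟩
          simp only [Finset.mem_filter, Finset.mem_univ, true_and] at hk ⊢
          by_cases h1 : k = i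
          · subst h1; exact hi.ne
          · by_cases h2 : k = j
            · subst h2; exact hj.ne'
            · rwa [hrow k h1 h2] at hk
        have := Finset.card_lt_card hsub
        omega)
    refine ⟨U * V, ?_, fun l => ?_⟩
    · rw [Matrix.transpose_mul, Matrix.mul_assoc, ← Matrix.mul_assoc V, hVV, Matrix.one_mul, hU]
    · rw [← hUc l, Matrix.transpose_mul]
      simp only [Matrix.mul_assoc]

theorem exists_orthogonal_diag_eq (hL : 1 ≤ L) (Q : Matrix (Fin L) (Fin L) ℝ) :
    ∃ U : Matrix (Fin L) (Fin L) ℝ, U * Uᵀ = 1 ∧ ∀ l, (U * Q * Uᵀ) l l = Q.trace / L := by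
  have : (L : ℝ) ≠ 0 := by positivity
  exact exists_orthogonal_diag_eq_const _ _ Q (by field_simp) le_rfl

end

/-! ### The mean-square error of a system with a finite digital filter -/

section

variable {Ω : Type*} [MeasurableSpace Ω] {P : Measure Ω} {M N K : ℕ}
  {x : Fin M → ℝ → Ω → ℝ} {C : ℝ → Matrix (Fin M) (Fin M) ℂ} {Γ : ℝ → Matrix (Fin N) (Fin M) ℂ}
  {s : Fin N → Ω → ℝ} {w : ℕ → ℤ → Ω → ℝ}

/-- The taps in a finite set of instants of the digital filter `G`, as used in `∑ n, G[-n] z[n]`. -/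
def taps (G : ℤ → Matrix (Fin N) (Fin K) ℝ) (F : Finset ℤ) (i : Fin N) (k : Fin K) : ℤ →₀ ℝ :=
  Finsupp.indicator F fun n _ => G (-n) i k

theorem coefSq_taps (G : ℤ → Matrix (Fin N) (Fin K) ℝ) (F : Finset ℤ) (i : Fin N) (k : Fin K) :
    coefSq (taps G F i k) = ∑ n ∈ F, G (-n) i k ^ 2 := by
  rw [coefSq, taps, Finsupp.sum_indicator_index_eq_sum_attach, Finset.sum_attach F
    fun n => G (-n) i k ^ 2]
  simp

theorem trig_taps {T : ℝ} (G : ℤ → Matrix (Fin N) (Fin K) ℝ) (F : Finset ℤ) (i : Fin N) (k : Fin K)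
    (f : ℝ) : trig T (taps G F i k) (f : AddCircle T)
      = ∑ n ∈ F, (G (-n) i k : ℂ) * Complex.exp (2 * Real.pi * Complex.I * f * ((n * T⁻¹ : ℝ) : ℂ)) := by
  rw [trig_coe, taps, Finsupp.sum_indicator_index_eq_sum_attach, Finset.sum_attach F
    fun n => (G (-n) i k : ℂ) * Complex.exp (2 * Real.pi * Complex.I * f * ((n * T⁻¹ : ℝ) : ℂ))]
  simp

/-- The outputs `Z k n` are the samples at the instants `n / fs` of the output of the analog filter
with response `A`. -/
def IsSampled (P : Measure Ω) (x : Fin M → ℝ → Ω → ℝ) (C : ℝ → Matrix (Fin M) (Fin M) ℂ)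
    (fs : ℝ) (A : ℝ → Matrix (Fin K) (Fin M) ℂ) (Z : Fin K → ℤ → Ω → ℝ) : Prop :=
  ∀ (k : Fin K) (n : ℤ), IsSpec P x C (fun f m =>
    Complex.exp (2 * Real.pi * Complex.I * f * ((n * fs⁻¹ : ℝ) : ℂ)) * A f k m) (Z k n)

/-- The error of the best estimate from the signals. -/
def minError (P : Measure Ω) (x : Fin M → ℝ → Ω → ℝ) (s : Fin N → Ω → ℝ) : ℝ :=
  ∑ i, ∫ ω, (s i ω - (P[s i | signalSigma x]) ω) ^ 2 ∂P

theorem minError_nonneg : 0 ≤ minError P x s :=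
  Finset.sum_nonneg fun _ _ => integral_nonneg fun _ => sq_nonneg _

theorem lintegral_ofReal_froSq_mul_sqrt (hC : ∀ i j, Measurable fun f => C f i j)
    (hp : ∀ f, (C f).PosSemidef) {X : ℝ → Matrix (Fin K) (Fin M) ℂ}
    (hX : ∀ i j, Measurable fun f => X f i j) :
    ∫⁻ f, ENNReal.ofReal (froSq (X f * CFC.sqrt (C f)))
      = ∑ k, eLpNorm (specVec C fun f => X f k) 2 volume ^ 2 := by
  have h : ∀ f, ENNReal.ofReal (froSq (X f * CFC.sqrt (C f)))
      = ∑ k, ‖specVec C (fun f => X f k) f‖ₑ ^ 2 := by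
    intro f
    rw [froSq, ENNReal.ofReal_sum_of_nonneg fun i _ => Finset.sum_nonneg fun j _ => sq_nonneg _]
    refine Finset.sum_congr rfl fun k _ => ?_
    rw [← ofReal_norm, ← ENNReal.ofReal_pow (norm_nonneg _), EuclideanSpace.norm_sq_eq]
    rfl
  simp_rw [h]
  rw [lintegral_finsetSum _ fun k _ =>
    (measurable_specVec hC hp (fun m => hX k m)).enorm.pow_const 2]
  refine Finset.sum_congr rfl fun k _ => ?_
  rw [← specNormSq_eq_lintegral hp, specNormSq_eq hp]

theorem IsSpec.ofReal_integral_sq (hx : IsWSS P x C) (hC : ∀ i j, Measurable fun f => C f i j)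
    {v : ℝ → Fin M → ℂ} {Y : Ω → ℝ} (hv : ∀ m, Measurable fun f => v f m)
    (h : IsSpec P x C v Y) :
    ENNReal.ofReal (∫ ω, Y ω ^ 2 ∂P) = eLpNorm (specVec C v) 2 volume ^ 2 := by
  rw [← h.eLpNorm_eq hx hC hv, ofReal_integral_eq_lintegral_ofReal h.memLp.integrable_sq
    (.of_forall fun _ => sq_nonneg _), eLpNorm_eq_lintegral_rpow_enorm_toReal (by simp) (by simp),
    ← ENNReal.rpow_natCast, ← ENNReal.rpow_mul]
  simp only [ENNReal.toReal_ofNat, ENNReal.rpow_ofNat, Nat.cast_ofNat]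
  norm_num
  refine lintegral_congr fun ω => ?_
  rw [← sq_abs, ENNReal.ofReal_pow (abs_nonneg _), ← Real.norm_eq_abs, ofReal_norm]

theorem memLp_midRise [IsProbabilityMeasure P] (hw : IsDither P x s w) {Δ : ℝ} (hΔ : Δ ≠ 0)
    {Y : Ω → ℝ} (hY : MemLp Y 2 P) (k : ℕ) (n : ℤ) :
    MemLp (fun ω => midRise Δ (Y ω + Δ * w k n ω)) 2 P := by
  simp_rw [midRise_eq hΔ]
  exact hY.add ((memLp_ditherError (hw.measurable k n) (hw.law k n)
    (hY.1.aemeasurable.div_const Δ)).const_mul Δ)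

theorem mse_eq_ofReal {sHat : Fin N → Ω → ℝ} (h : ∀ i, MemLp (fun ω => s i ω - sHat i ω) 2 P) :
    mse P s sHat = ENNReal.ofReal (∑ i, ∫ ω, (s i ω - sHat i ω) ^ 2 ∂P) := by
  rw [mse, ← integral_finsetSum _ fun i _ => (h i).integrable_sq,
    ofReal_integral_eq_lintegral_ofReal (integrable_finsetSum _ fun i _ => (h i).integrable_sq)
    (.of_forall fun _ => Finset.sum_nonneg fun _ _ => sq_nonneg _)]

theorem measurable_trigMat_mul {T : ℝ} {A : ℝ → Matrix (Fin K) (Fin M) ℂ}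
    (hA : ∀ i j, Measurable fun f => A f i j) (g : Fin N → Fin K → ℤ →₀ ℝ) (i : Fin N) (j : Fin M) :
    Measurable fun f : ℝ => (trigMat T g f * A f) i j :=
  measurable_mul_apply (X := fun f : ℝ => trigMat T g f)
    (fun i j => (measurable_trigMat g i j).comp AddCircle.measurable_mk') hA i j

theorem IsSampled.isSpec_taps (hx : IsWSS P x C) (hC : ∀ i j, Measurable fun f => C f i j)
    {fs : ℝ} {A : ℝ → Matrix (Fin K) (Fin M) ℂ} (hA : ∀ i j, Measurable fun f => A f i j)
    {Z : Fin K → ℤ → Ω → ℝ} (hZ : IsSampled P x C fs A Z) (G : ℤ → Matrix (Fin N) (Fin K) ℝ)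
    (F : Finset ℤ) (i : Fin N) :
    IsSpec P x C (fun f m => (trigMat fs (taps G F) f * A f) i m)
      (fun ω => ∑ n ∈ F, ∑ k : Fin K, G (-n) i k * Z k n ω) := by
  have h1 := IsSpec.sum hx hC (F ×ˢ (Finset.univ : Finset (Fin K)))
    (fun p => G (-p.1) i p.2) (fun p m => measurable_exp_mul (fun m => hA p.2 m) (p.1 * fs⁻¹) m)
    (fun p _ => hZ p.2 p.1)
  have e1 : (∑ p ∈ F ×ˢ (Finset.univ : Finset (Fin K)), G (-p.1) i p.2 • Z p.2 p.1)
      = fun ω => ∑ n ∈ F, ∑ k : Fin K, G (-n) i k * Z k n ω := by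
    funext ω
    rw [Finset.sum_apply, Finset.sum_product]
    rfl
  have e2 : (fun (f : ℝ) m => ∑ p ∈ F ×ˢ (Finset.univ : Finset (Fin K)), (G (-p.1) i p.2 : ℂ) *
      (Complex.exp (2 * Real.pi * Complex.I * f * ((p.1 * fs⁻¹ : ℝ) : ℂ)) * A f p.2 m))
      = fun (f : ℝ) m => (trigMat fs (taps G F) f * A f) i m := by
    funext f m
    rw [Matrix.mul_apply, Finset.sum_product_right]
    refine Finset.sum_congr rfl fun k _ => ?_
    rw [trigMat, Matrix.of_apply, trig_taps, Finset.sum_mul]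
    refine Finset.sum_congr rfl fun n _ => ?_
    exact (mul_assoc _ _ _).symm
  rw [e1, e2] at h1
  exact h1

/-- Two orthogonal splittings: the quantization errors separate from the data, and the error of the
best estimate separates from functions of the signals. The isometry turns what is left into the
spectral integral. -/
theorem mse_finite [IsProbabilityMeasure P] (hx : IsWSS P x C)
    (hC : ∀ i j, Measurable fun f => C f i j) (hs : IsLinearTask P x C Γ s)
    (hw : IsDither P x s w) {fs : ℝ} {A : ℝ → Matrix (Fin K) (Fin M) ℂ}
    (hA : ∀ i j, Measurable fun f => A f i j) {Z : Fin K → ℤ → Ω → ℝ}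
    (hZ : IsSampled P x C fs A Z) {Δ : ℝ} (hΔ : Δ ≠ 0) (G : ℤ → Matrix (Fin N) (Fin K) ℝ)
    (F : Finset ℤ) :
    mse P s (fun i ω => ∑ n ∈ F, (G (-n) *ᵥ fun k => midRise Δ (Z k n ω + Δ * w k n ω)) i)
      = ENNReal.ofReal (minError P x s)
        + (∫⁻ f : ℝ, ENNReal.ofReal (froSq ((Γ f - trigMat fs (taps G F) f * A f) *
            CFC.sqrt (C f))))
        + ENNReal.ofReal (Δ ^ 2 / 4 * coefSqMat (taps G F)) := by
  classical
  -- The dither is indexed by all of `ℕ`, so the channels are padded with zeros.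
  set Y : ℕ × ℤ → Ω → ℝ := fun p => if h : p.1 < K then Z ⟨p.1, h⟩ p.2 else 0 with hY
  set c : Fin N → ℕ × ℤ → ℝ := fun i p => if h : p.1 < K then G (-p.2) i ⟨p.1, h⟩ else 0 with hc
  have hYD : ∀ p, IsData P x s (Y p) := by
    intro p
    simp only [hY]
    split_ifs with h
    · exact (hZ ⟨p.1, h⟩ p.2).isData hx s
    · exact isSpec_zero.isData hx s
  have hsum : ∀ (i : Fin N) (φ : ℕ × ℤ → ℝ),
      ∑ p ∈ Finset.range K ×ˢ F, c i p * φ p = ∑ n ∈ F, ∑ k : Fin K, G (-n) i k * φ (k, n) := by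
    intro i φ
    rw [Finset.sum_product_right]
    refine Finset.sum_congr rfl fun n _ => ?_
    rw [Finset.sum_range]
    refine Finset.sum_congr rfl fun k _ => ?_
    simp [hc]
  have hYk : ∀ (k : Fin K) n, Y (k, n) = Z k n := fun k n => by simp [hY]
  have hq : ∀ i ω, ∑ n ∈ F, (G (-n) *ᵥ fun k => midRise Δ (Z k n ω + Δ * w k n ω)) i
      = ∑ p ∈ Finset.range K ×ˢ F, c i p * midRise Δ (Y p ω + Δ * w p.1 p.2 ω) := by
    intro i ω
    rw [hsum i fun p => midRise Δ (Y p ω + Δ * w p.1 p.2 ω)]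
    simp only [hYk]
    rfl
  set V : Fin N → Ω → ℝ := fun i ω => ∑ n ∈ F, ∑ k : Fin K, G (-n) i k * Z k n ω with hV
  have hVs : ∀ i ω, ∑ p ∈ Finset.range K ×ˢ F, c i p * Y p ω = V i ω := by
    intro i ω
    rw [hsum i fun p => Y p ω]
    simp only [hYk, hV]
  have hTm : ∀ i j, Measurable fun f : ℝ => (trigMat fs (taps G F) f * A f) i j :=
    measurable_trigMat_mul hA _
  have hVspec : ∀ i, IsSpec P x C (fun f m => (trigMat fs (taps G F) f * A f) i m) (V i) := fun i =>
    hZ.isSpec_taps hx hC hA G F i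
  have hZ2 : ∀ i, MemLp (fun ω => s i ω -
      ∑ n ∈ F, (G (-n) *ᵥ fun k => midRise Δ (Z k n ω + Δ * w k n ω)) i) 2 P := by
    intro i
    refine (hs.memLp i).sub (memLp_finsetSum _ fun n _ => ?_)
    exact memLp_finsetSum (f := fun k ω => G (-n) i k * midRise Δ (Z k n ω + Δ * w k n ω))
      Finset.univ fun k _ => (memLp_midRise hw hΔ (hZ k n).memLp k n).const_mul _
  rw [mse_eq_ofReal hZ2]
  have hi : ∀ i, ∫ ω, (s i ω -
      ∑ n ∈ F, (G (-n) *ᵥ fun k => midRise Δ (Z k n ω + Δ * w k n ω)) i) ^ 2 ∂P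
      = ∫ ω, (s i ω - (P[s i | signalSigma x]) ω) ^ 2 ∂P
        + ∫ ω, ((P[s i | signalSigma x]) ω - V i ω) ^ 2 ∂P
        + Δ ^ 2 / 4 * ∑ k, coefSq (taps G F i k) := by
    intro i
    simp_rw [hq]
    rw [integral_sub_midRise_sq hx hs hw hΔ hYD (isData_task hs i)]
    simp_rw [hVs]
    rw [integral_sub_sq_of_isSpec hx hs i (hVspec i)]
    congr 2
    simp_rw [sq (c i _)]
    rw [hsum i fun p => c i p, Finset.sum_comm]
    refine Finset.sum_congr rfl fun k _ => ?_
    rw [coefSq_taps]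
    refine Finset.sum_congr rfl fun n _ => ?_
    simp [hc, sq]
  simp_rw [hi, Finset.sum_add_distrib]
  have hnn : ∀ i, 0 ≤ ∫ ω, ((P[s i | signalSigma x]) ω - V i ω) ^ 2 ∂P := fun i =>
    integral_nonneg fun _ => sq_nonneg _
  rw [← Finset.mul_sum]
  change ENNReal.ofReal (minError P x s + _ + Δ ^ 2 / 4 * coefSqMat (taps G F)) = _
  rw [ENNReal.ofReal_add (add_nonneg minError_nonneg
      (Finset.sum_nonneg fun i _ => hnn i))
      (mul_nonneg (by positivity) (coefSqMat_nonneg (taps G F))),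
    ENNReal.ofReal_add minError_nonneg (Finset.sum_nonneg fun i _ => hnn i)]
  congr 2
  rw [lintegral_ofReal_froSq_mul_sqrt (X := fun f : ℝ => Γ f - trigMat fs (taps G F) f * A f) hC
    hx.posSemidef fun i j => (hs.measurable_filter i j).sub (hTm i j),
    ENNReal.ofReal_sum_of_nonneg fun i _ => hnn i]
  refine Finset.sum_congr rfl fun i _ => ?_
  have h1 := (isSpec_task hx hs i).sub hx hC (fun m => hs.measurable_filter i m)
    (fun m => hTm i m) (hVspec i)
  exact h1.ofReal_integral_sq hx hC fun m => (hs.measurable_filter i m).sub (hTm i m)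

end

/-! ### Front ends -/

/-- The quantization noise variance per unit of signal power, `Δ² / 4 = κ max_k E y_k²`. -/
def kappa (η b : ℝ) : ℝ := η ^ 2 / (2 ^ (2 * b) - 2 * η ^ 2 / 3)

theorem two_rpow_sq (b : ℝ) : ((2 : ℝ) ^ b) ^ 2 = 2 ^ (2 * b) := by
  rw [← Real.rpow_natCast, ← Real.rpow_mul (by norm_num), mul_comm]; norm_num

theorem Admissible.lt {M K : ℕ} {η b : ℝ} (h : Admissible M η K b) :
    2 * η ^ 2 / 3 < 2 ^ (2 * b) := by
  have h1 := h.2.2.2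
  have h2 : (0 : ℝ) < 2 ^ (2 * b) := by positivity
  rw [div_lt_one (by positivity)] at h1
  linarith

theorem kappa_pos {η b : ℝ} (hη : 0 < η) (hb : 2 * η ^ 2 / 3 < 2 ^ (2 * b)) : 0 < kappa η b :=
  div_pos (by positivity) (by linarith)

theorem step_sq (b γ : ℝ) : step b γ ^ 2 / 4 = γ ^ 2 / 2 ^ (2 * b) := by
  rw [step, div_pow, two_rpow_sq]; ring

section

variable {Ω : Type*} [MeasurableSpace Ω] {P : Measure Ω} {M N K L : ℕ}
  {x : Fin M → ℝ → Ω → ℝ} {C : ℝ → Matrix (Fin M) (Fin M) ℂ} {Γ : ℝ → Matrix (Fin N) (Fin M) ℂ}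
  {s : Fin N → Ω → ℝ} {w : ℕ → ℤ → Ω → ℝ}

theorem IsSpec.ofReal_sum_integral_sq (hx : IsWSS P x C) (hC : ∀ i j, Measurable fun f => C f i j)
    {A : ℝ → Matrix (Fin K) (Fin M) ℂ} (hA : ∀ i j, Measurable fun f => A f i j)
    {Y : Fin K → Ω → ℝ} (hY : ∀ k, IsSpec P x C (fun f => A f k) (Y k)) :
    ∫⁻ f, ENNReal.ofReal (froSq (A f * CFC.sqrt (C f)))
      = ENNReal.ofReal (∑ k, ∫ ω, Y k ω ^ 2 ∂P) := by
  rw [lintegral_ofReal_froSq_mul_sqrt hC hx.posSemidef hA,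
    ENNReal.ofReal_sum_of_nonneg fun k _ => integral_nonneg fun _ => sq_nonneg _]
  exact Finset.sum_congr rfl fun k _ => ((hY k).ofReal_integral_sq hx hC fun m => hA k m).symm

theorem IsSampled.isSpec_zero {fs : ℝ} {A : ℝ → Matrix (Fin K) (Fin M) ℂ} {Z : Fin K → ℤ → Ω → ℝ}
    (hZ : IsSampled P x C fs A Z) (k : Fin K) : IsSpec P x C (fun f => A f k) (Z k 0) := by
  simpa using hZ k 0

theorem IsSampled.integral_sq (hx : IsWSS P x C) (hC : ∀ i j, Measurable fun f => C f i j)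
    {fs : ℝ} {A : ℝ → Matrix (Fin K) (Fin M) ℂ} (hA : ∀ i j, Measurable fun f => A f i j)
    {Z : Fin K → ℤ → Ω → ℝ} (hZ : IsSampled P x C fs A Z) (k : Fin K) (n : ℤ) {Y : Ω → ℝ}
    (hY : IsSpec P x C (fun f => A f k) Y) :
    ∫ ω, Z k n ω ^ 2 ∂P = ∫ ω, Y ω ^ 2 ∂P := by
  have h1 := (hZ k n).ofReal_integral_sq hx hC (measurable_exp_mul (fun m => hA k m) _)
  have h2 := hY.ofReal_integral_sq hx hC (fun m => hA k m)
  rw [eLpNorm_specVec_exp_mul (fun f => A f k), ← h2] at h1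
  exact (ENNReal.ofReal_eq_ofReal_iff (integral_nonneg fun _ => sq_nonneg _)
    (integral_nonneg fun _ => sq_nonneg _)).1 h1

/-- With `m = max_k E Z_k²` the range condition reads `γ² = η² (m + Δ² / 6)`, and `γ² = 4^b Δ² / 4`.
Solving for the step gives `Δ² / 4 = κ m`, and the maximum is at least the average `e / K`. The
factor `T_s` goes into `A`. -/
theorem IsFrontEnd.exists_isSampled [IsProbabilityMeasure P] (hx : IsWSS P x C)
    (hC : ∀ i j, Measurable fun f => C f i j) (hs : IsLinearTask P x C Γ s)
    (hw : IsDither P x s w) {η fs b γ : ℝ} (hb : 2 * η ^ 2 / 3 < 2 ^ (2 * b))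
    {H : ℝ → Matrix (Fin K) (Fin M) ℂ} {y : Fin K → ℝ → Ω → ℝ}
    (h : IsFrontEnd P x C w η fs b H y γ) :
    ∃ (A : ℝ → Matrix (Fin K) (Fin M) ℂ) (Z : Fin K → ℤ → Ω → ℝ) (e : ℝ),
      (∀ i j, Measurable fun f => A f i j) ∧ IsSampled P x C fs A Z ∧ 0 ≤ e ∧
      ∫⁻ f, ENNReal.ofReal (froSq (A f * CFC.sqrt (C f))) = ENNReal.ofReal e ∧
      (∀ k n ω, quantOutput w fs b γ y k n ω
        = midRise (step b γ) (Z k n ω + step b γ * w k n ω)) ∧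
      step b γ ≠ 0 ∧ kappa η b * e ≤ K * (step b γ ^ 2 / 4) := by
  set Δ := step b γ with hΔ
  have hΔ0 : Δ ≠ 0 := by
    have := h.range_pos
    rw [hΔ, step]; positivity
  set A : ℝ → Matrix (Fin K) (Fin M) ℂ := fun f => (fs⁻¹ : ℂ) • H f with hAdef
  have hA : ∀ i j, Measurable fun f => A f i j := fun i j =>
    (h.measurable_filter i j).const_mul (fs⁻¹ : ℂ)
  set Z : Fin K → ℤ → Ω → ℝ := fun k n => fs⁻¹ • y k (n * fs⁻¹) with hZdef
  have hZ : IsSampled P x C fs A Z := by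
    intro k n
    have h1 := ((isFilterOutput_iff_isSpec hx.posSemidef).1 (h.output k (n * fs⁻¹))).const_mul fs⁻¹
    have e1 : (fun (f : ℝ) m => Complex.exp (2 * Real.pi * Complex.I * f * ((n * fs⁻¹ : ℝ) : ℂ))
        * A f k m) = fun (f : ℝ) m => ((fs⁻¹ : ℝ) : ℂ) *
          (Complex.exp (2 * Real.pi * Complex.I * f * ((n * fs⁻¹ : ℝ) : ℂ)) * H f k m) := by
      funext f m
      simp only [hAdef, Matrix.smul_apply, smul_eq_mul, Complex.ofReal_inv]
      ring
    rw [e1]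
    exact h1
  have hZ0 := hZ.isSpec_zero
  refine ⟨A, Z, ∑ k, ∫ ω, Z k 0 ω ^ 2 ∂P, hA, hZ,
    Finset.sum_nonneg fun k _ => integral_nonneg fun _ => sq_nonneg _,
    IsSpec.ofReal_sum_integral_sq hx hC hA hZ0, fun k n ω => rfl, hΔ0, ?_⟩
  have hq : ∀ k, ∫ ω, quantInput w fs b γ y k 0 ω ^ 2 ∂P
      = ∫ ω, Z k 0 ω ^ 2 ∂P + Δ ^ 2 / 6 := fun k =>
    integral_add_dither_sq_of_isData hx hs hw ((hZ0 k).isData hx s) k 0 Δ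
  have hγ := h.range_eq 0
  have hΔ4 := step_sq b γ
  have hB : (0 : ℝ) < 2 ^ (2 * b) := by positivity
  have hden : 0 < (2 : ℝ) ^ (2 * b) - 2 * η ^ 2 / 3 := by linarith
  have hk : ∀ k, kappa η b * ∫ ω, Z k 0 ω ^ 2 ∂P ≤ Δ ^ 2 / 4 := by
    intro k
    have h1 : ∫ ω, Z k 0 ω ^ 2 ∂P + Δ ^ 2 / 6
        ≤ ⨆ k : Fin K, ∫ ω, quantInput w fs b γ y k 0 ω ^ 2 ∂P := by
      rw [← hq k]
      exact le_ciSup (f := fun k => ∫ ω, quantInput w fs b γ y k 0 ω ^ 2 ∂P)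
        (Set.finite_range _).bddAbove k
    have h2 : η ^ 2 * (∫ ω, Z k 0 ω ^ 2 ∂P + Δ ^ 2 / 6) ≤ γ ^ 2 := by
      rw [hγ]
      exact mul_le_mul_of_nonneg_left h1 (sq_nonneg η)
    have h3 : γ ^ 2 = Δ ^ 2 / 4 * 2 ^ (2 * b) := by rw [hΔ4]; field_simp
    rw [kappa, div_mul_eq_mul_div, div_le_iff₀ hden]
    rw [h3] at h2
    linarith
  calc kappa η b * ∑ k, ∫ ω, Z k 0 ω ^ 2 ∂P = ∑ k, kappa η b * ∫ ω, Z k 0 ω ^ 2 ∂P :=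
        Finset.mul_sum _ _ _
    _ ≤ ∑ _ : Fin K, Δ ^ 2 / 4 := Finset.sum_le_sum fun k _ => hk k
    _ = K * (Δ ^ 2 / 4) := by simp

/-- With equal channel powers the maximum equals the average, so the lower bound on the noise power
is attained. The range `γ` solves the equation that ties it to the step; the factor `fs` in the
filter cancels `T_s`. -/
theorem exists_isFrontEnd [IsProbabilityMeasure P] (hx : IsWSS P x C)
    (hC : ∀ i j, Measurable fun f => C f i j) (hs : IsLinearTask P x C Γ s)
    (hw : IsDither P x s w) {η fs b : ℝ} (hη : 0 < η) (hfs : 0 < fs)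
    (hb : 2 * η ^ 2 / 3 < 2 ^ (2 * b)) (hL : 1 ≤ L) {A : ℝ → Matrix (Fin L) (Fin M) ℂ}
    (hA : ∀ i j, Measurable fun f => A f i j) {Y : Fin L → Ω → ℝ}
    (hY : ∀ l, IsSpec P x C (fun f => A f l) (Y l)) {v : ℝ} (hv : 0 < v)
    (hYv : ∀ l, ∫ ω, Y l ω ^ 2 ∂P = v) :
    ∃ (H : ℝ → Matrix (Fin L) (Fin M) ℂ) (y : Fin L → ℝ → Ω → ℝ) (γ : ℝ) (Z : Fin L → ℤ → Ω → ℝ),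
      IsFrontEnd P x C w η fs b H y γ ∧ IsSampled P x C fs A Z ∧
      (∀ k n ω, quantOutput w fs b γ y k n ω
        = midRise (step b γ) (Z k n ω + step b γ * w k n ω)) ∧
      step b γ ≠ 0 ∧ step b γ ^ 2 / 4 = kappa η b * v := by
  choose S hS using fun (l : Fin L) (t : ℝ) => (hY l).exists_shift hx t
  have hB : (0 : ℝ) < 2 ^ (2 * b) := by positivity
  have hden : 0 < (2 : ℝ) ^ (2 * b) - 2 * η ^ 2 / 3 := by linarith
  set γ : ℝ := √(2 ^ (2 * b) * (kappa η b * v)) with hγ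
  have hγ0 : 0 < 2 ^ (2 * b) * (kappa η b * v) := by
    have := kappa_pos hη hb
    positivity
  have hγpos : 0 < γ := Real.sqrt_pos.2 hγ0
  have hγ2 : γ ^ 2 = 2 ^ (2 * b) * (kappa η b * v) := Real.sq_sqrt hγ0.le
  have hstep : step b γ ^ 2 / 4 = kappa η b * v := by
    rw [step_sq, hγ2]; field_simp
  set Z : Fin L → ℤ → Ω → ℝ := fun l n => S l (n * fs⁻¹) with hZdef
  have hZ : IsSampled P x C fs A Z := fun l n => hS l (n * fs⁻¹)
  have hsamp : ∀ k n ω, samples fs (fun l t => fs • S l t) k n ω = Z k n ω := by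
    intro k n ω
    simp only [samples, hZdef, Pi.smul_apply, smul_eq_mul]
    field_simp
  refine ⟨fun f => (fs : ℂ) • A f, fun l t => fs • S l t, γ, Z,
    ⟨fun k m => (hA k m).const_mul (fs : ℂ), fun k t => ?_, hγpos, fun n => ?_⟩, hZ,
    fun k n ω => ?_, ?_, hstep⟩
  · rw [isFilterOutput_iff_isSpec hx.posSemidef]
    have h1 := (hS k t).const_mul fs
    have e1 : (fun (f : ℝ) m => Complex.exp (2 * Real.pi * Complex.I * f * t)
        * ((fs : ℂ) • A f) k m) = fun (f : ℝ) m => (fs : ℂ) *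
          (Complex.exp (2 * Real.pi * Complex.I * f * t) * A f k m) := by
      funext f m
      simp only [Matrix.smul_apply, smul_eq_mul]
      ring
    rw [e1]
    exact h1
  · have hq : ∀ k, ∫ ω, quantInput w fs b γ (fun l t => fs • S l t) k n ω ^ 2 ∂P
        = v + step b γ ^ 2 / 6 := by
      intro k
      simp only [quantInput, hsamp]
      rw [integral_add_dither_sq_of_isData hx hs hw ((hZ k n).isData hx s),
        hZ.integral_sq hx hC hA k n (hY k), hYv]
    -- Over an empty index set the supremum would be zero by convention.
    have : Nonempty (Fin L) := ⟨⟨0, hL⟩⟩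
    simp_rw [hq]
    rw [ciSup_const, hγ2]
    have h1 : step b γ ^ 2 / 6 = 2 / 3 * (kappa η b * v) := by rw [← hstep]; ring
    have h2 : kappa η b * (2 ^ (2 * b) - 2 * η ^ 2 / 3) = η ^ 2 := by
      rw [kappa, div_mul_cancel₀ _ hden.ne']
    rw [h1]
    linear_combination v * h2
  · rw [quantOutput, quantInput, hsamp]
  · rw [step]; positivity

/-! ### Systems with finite digital filters and their error bounds -/

theorem isDigitalEstimate_finite {z : Fin K → ℤ → Ω → ℝ} (hz : ∀ k n, MemLp (z k n) 2 P)
    {G : ℤ → Matrix (Fin N) (Fin K) ℝ} {F : Finset ℤ} (hG : ∀ n ∉ F, G (-n) = 0) :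
    IsDigitalEstimate P z G (fun i ω => ∑ n ∈ F, (G (-n) *ᵥ fun k => z k n ω) i) := by
  intro i
  refine ⟨memLp_finsetSum _ fun n _ => memLp_finsetSum (f := fun k ω => G (-n) i k * z k n ω)
    Finset.univ fun k _ => (hz k n).const_mul _, tendsto_const_nhds.congr' ?_⟩
  filter_upwards [eventually_ge_atTop F] with F' hF'
  have : (fun ω => ∑ n ∈ F, (G (-n) *ᵥ fun k => z k n ω) i
      - ∑ n ∈ F', (G (-n) *ᵥ fun k => z k n ω) i) = 0 := by
    funext ω
    rw [Finset.sum_subset hF' fun n _ hn => by rw [hG n hn]; simp]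
    simp
  rw [this, eLpNorm_zero]

theorem exists_taps_eq (g : Fin N → Fin K → ℤ →₀ ℝ) :
    ∃ (G : ℤ → Matrix (Fin N) (Fin K) ℝ) (F : Finset ℤ), taps G F = g ∧ ∀ n ∉ F, G (-n) = 0 := by
  classical
  set F : Finset ℤ := Finset.univ.biUnion fun p : Fin N × Fin K => (g p.1 p.2).support with hF
  have hmem : ∀ n ∉ F, ∀ i k, g i k n = 0 := by
    intro n hn i k
    by_contra h
    exact hn (Finset.mem_biUnion.2 ⟨(i, k), Finset.mem_univ _, Finsupp.mem_support_iff.2 h⟩)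
  refine ⟨fun n => Matrix.of fun i k => g i k (-n), F, ?_, fun n hn => ?_⟩
  · funext i k
    ext n
    rw [taps, Finsupp.indicator_apply]
    split_ifs with h
    · simp
    · exact (hmem n h i k).symm
  · ext i k
    simpa using hmem n hn i k

theorem minMSE_le_of_equal_power [IsProbabilityMeasure P] (hx : IsWSS P x C)
    (hC : ∀ i j, Measurable fun f => C f i j) (hs : IsLinearTask P x C Γ s)
    (hw : IsDither P x s w) {η fs b : ℝ} (hη : 0 < η) (hfs : 0 < fs)
    (hb : 2 * η ^ 2 / 3 < 2 ^ (2 * b)) (hL : 1 ≤ L) {A : ℝ → Matrix (Fin L) (Fin M) ℂ}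
    (hA : ∀ i j, Measurable fun f => A f i j) {Y : Fin L → Ω → ℝ}
    (hY : ∀ l, IsSpec P x C (fun f => A f l) (Y l)) {v : ℝ} (hv : 0 < v)
    (hYv : ∀ l, ∫ ω, Y l ω ^ 2 ∂P = v) (G : ℤ → Matrix (Fin N) (Fin L) ℝ) (F : Finset ℤ)
    (hG : ∀ n ∉ F, G (-n) = 0) :
    minMSE P x C s w η fs L b ≤ ENNReal.ofReal (minError P x s)
        + (∫⁻ f : ℝ, ENNReal.ofReal (froSq ((Γ f - trigMat fs (taps G F) f * A f) *
            CFC.sqrt (C f))))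
        + ENNReal.ofReal (kappa η b * v * coefSqMat (taps G F)) := by
  obtain ⟨H, y, γ, Z, hFE, hZ, hq, hΔ, hΔ2⟩ :=
    exists_isFrontEnd hx hC hs hw hη hfs hb hL hA hY hv hYv
  refine sInf_le ⟨H, y, γ, G, _, hFE, isDigitalEstimate_finite (F := F) (fun k n => ?_) hG, ?_⟩
  · have : quantOutput w fs b γ y k n
        = fun ω => midRise (step b γ) (Z k n ω + step b γ * w k n ω) := funext fun ω => hq k n ω
    rw [this]
    exact memLp_midRise hw hΔ (hZ k n).memLp k n
  · simp_rw [hq]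
    rw [mse_finite hx hC hs hw hA hZ hΔ G F, hΔ2]

theorem mse_eq_sum_eLpNorm {sHat : Fin N → Ω → ℝ}
    (h : ∀ i, MemLp (fun ω => s i ω - sHat i ω) 2 P) :
    mse P s sHat = ∑ i, eLpNorm (fun ω => s i ω - sHat i ω) 2 P ^ 2 := by
  rw [mse_eq_ofReal h, ENNReal.ofReal_sum_of_nonneg fun i _ => integral_nonneg fun _ => sq_nonneg _]
  refine Finset.sum_congr rfl fun i _ => ?_
  rw [ofReal_integral_eq_lintegral_ofReal (h i).integrable_sq (.of_forall fun _ => sq_nonneg _)]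
  have := lintegral_ofReal_norm_sq P fun ω => ((s i ω - sHat i ω : ℝ) : ℂ)
  simp only [Complex.norm_real, Real.norm_eq_abs, sq_abs] at this
  rw [this]
  congr 1
  exact eLpNorm_congr_norm_ae (.of_forall fun ω => Complex.norm_real _)

theorem exists_finite_mse_le [IsProbabilityMeasure P] (hs : IsLinearTask P x C Γ s)
    {z : Fin K → ℤ → Ω → ℝ} (hz : ∀ k n, MemLp (z k n) 2 P) {G : ℤ → Matrix (Fin N) (Fin K) ℝ}
    {sHat : Fin N → Ω → ℝ} (h : IsDigitalEstimate P z G sHat) {ε : ℝ} (hε : 0 < ε) :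
    ∃ F : Finset ℤ, mse P s (fun i ω => ∑ n ∈ F, (G (-n) *ᵥ fun k => z k n ω) i)
      ≤ mse P s sHat + ENNReal.ofReal ε := by
  have h1 : ∀ i, MemLp (fun ω => s i ω - sHat i ω) 2 P := fun i => (hs.memLp i).sub (h i).1
  have h2 : ∀ (F : Finset ℤ) i, MemLp (fun ω => ∑ n ∈ F, (G (-n) *ᵥ fun k => z k n ω) i) 2 P :=
    fun F i => memLp_finsetSum _ fun n _ => memLp_finsetSum (f := fun k ω => G (-n) i k * z k n ω)
      Finset.univ fun k _ => (hz k n).const_mul _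
  have hfin : mse P s sHat ≠ ⊤ := by rw [mse_eq_ofReal h1]; exact ENNReal.ofReal_ne_top
  have hlim : Tendsto (fun F : Finset ℤ => ∑ i, (eLpNorm (fun ω => s i ω - sHat i ω) 2 P
      + eLpNorm (fun ω => sHat i ω - ∑ n ∈ F, (G (-n) *ᵥ fun k => z k n ω) i) 2 P) ^ 2) atTop
      (𝓝 (mse P s sHat)) := by
    rw [mse_eq_sum_eLpNorm h1]
    refine tendsto_finsetSum _ fun i _ => ?_
    have := ((tendsto_const_nhds (x := eLpNorm (fun ω => s i ω - sHat i ω) 2 P)).add (h i).2)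
    rw [add_zero] at this
    exact ENNReal.Tendsto.pow this
  have hlt : mse P s sHat < mse P s sHat + ENNReal.ofReal ε :=
    ENNReal.lt_add_right hfin (ENNReal.ofReal_pos.2 hε).ne'
  obtain ⟨F, hF⟩ := (hlim.eventually_lt_const hlt).exists
  refine ⟨F, le_trans ?_ hF.le⟩
  rw [mse_eq_sum_eLpNorm fun i => (hs.memLp i).sub (h2 F i)]
  refine Finset.sum_le_sum fun i _ => pow_le_pow_left' ?_ 2
  have e : (fun ω => s i ω - ∑ n ∈ F, (G (-n) *ᵥ fun k => z k n ω) i)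
      = (fun ω => s i ω - sHat i ω)
        + fun ω => sHat i ω - ∑ n ∈ F, (G (-n) *ᵥ fun k => z k n ω) i := by
    funext ω; simp
  rw [e]
  exact eLpNorm_add_le (h1 i).1 ((h i).1.sub (h2 F i)).1 (by norm_num)

/-- Truncating the digital filter costs at most `ε`, and the noise term is bounded below through the
average channel power. -/
theorem exists_finite_system [IsProbabilityMeasure P] (hx : IsWSS P x C)
    (hC : ∀ i j, Measurable fun f => C f i j) (hs : IsLinearTask P x C Γ s)
    (hw : IsDither P x s w) {η fs b γ : ℝ} (hb : 2 * η ^ 2 / 3 < 2 ^ (2 * b)) (hK : 1 ≤ K)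
    {H : ℝ → Matrix (Fin K) (Fin M) ℂ} {y : Fin K → ℝ → Ω → ℝ}
    (hFE : IsFrontEnd P x C w η fs b H y γ) {G : ℤ → Matrix (Fin N) (Fin K) ℝ}
    {sHat : Fin N → Ω → ℝ} (hDE : IsDigitalEstimate P (quantOutput w fs b γ y) G sHat) {ε : ℝ}
    (hε : 0 < ε) :
    ∃ (A : ℝ → Matrix (Fin K) (Fin M) ℂ) (Z : Fin K → ℤ → Ω → ℝ) (g : Fin N → Fin K → ℤ →₀ ℝ)
      (d e : ℝ), (∀ i j, Measurable fun f => A f i j) ∧ IsSampled P x C fs A Z ∧ 0 ≤ d ∧ 0 ≤ e ∧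
      ∫⁻ f : ℝ, ENNReal.ofReal (froSq ((Γ f - trigMat fs g f * A f) * CFC.sqrt (C f)))
        = ENNReal.ofReal d ∧
      ∫⁻ f : ℝ, ENNReal.ofReal (froSq (A f * CFC.sqrt (C f))) = ENNReal.ofReal e ∧
      ENNReal.ofReal (minError P x s + (d + kappa η b / K * (e * coefSqMat g)))
        ≤ mse P s sHat + ENNReal.ofReal ε := by
  obtain ⟨A, Z, e, hA, hZ, he0, he, hq, hΔ, hκ⟩ := hFE.exists_isSampled hx hC hs hw hb
  have hz : ∀ k n, MemLp (quantOutput w fs b γ y k n) 2 P := fun k n => by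
    have : quantOutput w fs b γ y k n
        = fun ω => midRise (step b γ) (Z k n ω + step b γ * w k n ω) := funext fun ω => hq k n ω
    rw [this]
    exact memLp_midRise hw hΔ (hZ k n).memLp k n
  obtain ⟨F, hF⟩ := exists_finite_mse_le hs hz hDE hε
  simp_rw [hq] at hF
  rw [mse_finite hx hC hs hw hA hZ hΔ G F] at hF
  set I := ∫⁻ f : ℝ, ENNReal.ofReal (froSq ((Γ f - trigMat fs (taps G F) f * A f) *
    CFC.sqrt (C f))) with hI
  have hfin : mse P s sHat ≠ ⊤ := by
    rw [mse_eq_ofReal fun i => (hs.memLp i).sub (hDE i).1]; exact ENNReal.ofReal_ne_top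
  have hItop : I ≠ ⊤ := by
    intro h
    rw [h] at hF
    have : mse P s sHat + ENNReal.ofReal ε = ⊤ := by simpa using hF
    simp [hfin] at this
  obtain ⟨d, hd0, hd⟩ : ∃ d : ℝ, 0 ≤ d ∧ I = ENNReal.ofReal d :=
    ⟨I.toReal, ENNReal.toReal_nonneg, (ENNReal.ofReal_toReal hItop).symm⟩
  refine ⟨A, Z, taps G F, d, e, hA, hZ, hd0, he0, hd, he, le_trans ?_ hF⟩
  rw [hd, ← ENNReal.ofReal_add minError_nonneg hd0,
    ← ENNReal.ofReal_add (add_nonneg minError_nonneg hd0)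
      (mul_nonneg (by positivity) (coefSqMat_nonneg _)), ← add_assoc]
  refine ENNReal.ofReal_le_ofReal (add_le_add le_rfl ?_)
  have hK' : (0 : ℝ) < K := by exact_mod_cast hK
  rw [← mul_assoc]
  refine mul_le_mul_of_nonneg_right ?_ (coefSqMat_nonneg _)
  rw [div_mul_eq_mul_div, div_le_iff₀ hK']
  linarith

end

/-! ### Fewer channels with a higher resolution -/

section

variable {Ω : Type*} [MeasurableSpace Ω] {P : Measure Ω} {M N K L : ℕ}
  {x : Fin M → ℝ → Ω → ℝ} {C : ℝ → Matrix (Fin M) (Fin M) ℂ} {Γ : ℝ → Matrix (Fin N) (Fin M) ℂ}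
  {s : Fin N → Ω → ℝ} {w : ℕ → ℤ → Ω → ℝ}

theorem trigMat_taps_mul {T : ℝ} (G : ℤ → Matrix (Fin N) (Fin K) ℝ) (B : Matrix (Fin K) (Fin L) ℝ)
    (F : Finset ℤ) (f : ℝ) : trigMat T (taps (fun n => G n * B) F) (f : AddCircle T)
      = trigMat T (taps G F) f * B.map (fun a : ℝ => (a : ℂ)) := by
  ext i l
  rw [Matrix.mul_apply]
  simp only [trigMat, Matrix.of_apply, trig_taps, Matrix.map_apply, Finset.sum_mul]
  rw [Finset.sum_comm]
  refine Finset.sum_congr rfl fun n _ => ?_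
  rw [Matrix.mul_apply]
  push_cast
  rw [Finset.sum_mul]
  exact Finset.sum_congr rfl fun k _ => by ring

theorem sum_sq_mul_of_orthogonal {B : Matrix (Fin L) (Fin L) ℝ} (hB : B * Bᵀ = 1)
    (a : Fin L → ℝ) : ∑ l, (a ᵥ* B) l ^ 2 = ∑ l, a l ^ 2 := by
  have h : ∀ v : Fin L → ℝ, ∑ l, v l ^ 2 = v ⬝ᵥ v := fun v => by simp [dotProduct, sq]
  rw [h, h]
  conv_lhs => rw [← Matrix.mulVec_transpose B a]
  rw [Matrix.mulVec_transpose, ← Matrix.dotProduct_mulVec, ← Matrix.mulVec_transpose,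
    Matrix.mulVec_mulVec, hB, Matrix.one_mulVec]

theorem coefSqMat_taps_mul {B : Matrix (Fin L) (Fin L) ℝ} (hB : B * Bᵀ = 1)
    (G : ℤ → Matrix (Fin N) (Fin L) ℝ) (F : Finset ℤ) :
    coefSqMat (taps (fun n => G n * B) F) = coefSqMat (taps G F) := by
  simp only [coefSqMat, coefSq_taps]
  refine Finset.sum_congr rfl fun i _ => ?_
  rw [Finset.sum_comm, Finset.sum_comm (s := Finset.univ)]
  exact Finset.sum_congr rfl fun n _ => sum_sq_mul_of_orthogonal hB (G (-n) i)

/-- An orthogonal `U` makes the diagonal of the Gram matrix of the outputs constant, equal to `e /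
L`. Mixing the analog channels by `U` and the digital filter by `Uᵀ` preserves both the overall
response and the sum of squared taps. -/
theorem minMSE_le_of_power [IsProbabilityMeasure P] (hx : IsWSS P x C)
    (hC : ∀ i j, Measurable fun f => C f i j) (hs : IsLinearTask P x C Γ s)
    (hw : IsDither P x s w) {η fs b : ℝ} (hη : 0 < η) (hfs : 0 < fs)
    (hb : 2 * η ^ 2 / 3 < 2 ^ (2 * b)) (hL : 1 ≤ L) {A : ℝ → Matrix (Fin L) (Fin M) ℂ}
    (hA : ∀ i j, Measurable fun f => A f i j) {Y : Fin L → Ω → ℝ}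
    (hY : ∀ l, IsSpec P x C (fun f => A f l) (Y l)) {e : ℝ} (he : 0 < e)
    (hYe : ∑ l, ∫ ω, Y l ω ^ 2 ∂P = e) (g : Fin N → Fin L → ℤ →₀ ℝ) :
    minMSE P x C s w η fs L b ≤ ENNReal.ofReal (minError P x s)
        + (∫⁻ f : ℝ, ENNReal.ofReal (froSq ((Γ f - trigMat fs g f * A f) * CFC.sqrt (C f))))
        + ENNReal.ofReal (kappa η b / L * (e * coefSqMat g)) := by
  obtain ⟨G, F, rfl, hG⟩ := exists_taps_eq g
  set Q : Matrix (Fin L) (Fin L) ℝ := Matrix.of fun l l' => ∫ ω, Y l ω * Y l' ω ∂P with hQ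
  obtain ⟨U, hU, hUQ⟩ := exists_orthogonal_diag_eq hL Q
  have hU' : Uᵀ * U = 1 := mul_eq_one_comm.1 hU
  have htr : Q.trace = e := by
    rw [← hYe, Matrix.trace]
    refine Finset.sum_congr rfl fun l _ => integral_congr_ae (.of_forall fun ω => ?_)
    simp [sq]
  have hint : ∀ l l', Integrable (fun ω => Y l ω * Y l' ω) P := fun l l' =>
    (hY l).memLp.integrable_mul (hY l').memLp
  set A' : ℝ → Matrix (Fin L) (Fin M) ℂ := fun f => U.map (fun a : ℝ => (a : ℂ)) * A f with hA'
  have hA'm : ∀ i j, Measurable fun f => A' f i j :=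
    measurable_mul_apply (X := fun _ : ℝ => U.map (fun a : ℝ => (a : ℂ)))
      (fun i j => measurable_const) hA
  have hY' : ∀ l, IsSpec P x C (fun f => A' f l) (∑ l', U l l' • Y l') := fun l =>
    IsSpec.sum hx hC Finset.univ (fun l' => U l l') (fun l' m => hA l' m) fun l' _ => hY l'
  have hYv : ∀ l, ∫ ω, (∑ l', U l l' • Y l') ω ^ 2 ∂P = e / L := by
    intro l
    rw [← htr, ← hUQ l, mul_mul_transpose_apply_self]
    have e1 : ∀ ω, (∑ l', U l l' • Y l') ω ^ 2
        = ∑ a, ∑ b, U l a * (U l b * (Y a ω * Y b ω)) := by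
      intro ω
      simp only [Finset.sum_apply, Pi.smul_apply, smul_eq_mul]
      rw [sq, Finset.sum_mul_sum]
      exact Finset.sum_congr rfl fun a _ => Finset.sum_congr rfl fun b _ => by ring
    simp_rw [e1]
    rw [integral_finsetSum _ fun a _ => integrable_finsetSum _ fun b _ =>
      ((hint a b).const_mul _).const_mul _]
    refine Finset.sum_congr rfl fun a _ => ?_
    rw [integral_finsetSum _ fun b _ => ((hint a b).const_mul _).const_mul _, Matrix.mulVec,
      dotProduct, Finset.mul_sum]
    refine Finset.sum_congr rfl fun b _ => ?_
    rw [integral_const_mul, integral_const_mul, hQ, Matrix.of_apply]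
    ring
  have hLpos : (0 : ℝ) < L := by exact_mod_cast hL
  have := minMSE_le_of_equal_power hx hC hs hw hη hfs hb hL hA'm hY' (div_pos he hLpos) hYv
    (fun n => G n * Uᵀ) F fun n hn => by rw [hG n hn, Matrix.zero_mul]
  have e1 : ∀ f : ℝ, trigMat fs (taps (fun n => G n * Uᵀ) F) f * A' f
      = trigMat fs (taps G F) f * A f := by
    intro f
    have h1 : Uᵀ.map (fun a : ℝ => (a : ℂ)) * U.map (fun a : ℝ => (a : ℂ)) = 1 := by
      have h2 : Uᵀ.map Complex.ofRealHom * U.map Complex.ofRealHom = 1 := by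
        rw [← Matrix.map_mul, hU']
        simp
      exact h2
    rw [trigMat_taps_mul, hA', Matrix.mul_assoc, ← Matrix.mul_assoc (Uᵀ.map _), h1, Matrix.one_mul]
  simp_rw [e1] at this
  rw [coefSqMat_taps_mul (by rwa [Matrix.transpose_transpose])] at this
  refine this.trans (le_of_eq ?_)
  congr 2
  ring

/-- All channels carry the best estimate of component `i`, and one of them is read with a single tap
`t` at time zero. The error of that component exceeds its minimum by `σ ((1 - t)² + κ t²)`, whose
least value, at `t = 1 / (1 + κ)`, is `σ - σ / (1 + κ)`. -/
theorem minMSE_le_of_component [IsProbabilityMeasure P] (hx : IsWSS P x C)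
    (hC : ∀ i j, Measurable fun f => C f i j) (hs : IsLinearTask P x C Γ s)
    (hw : IsDither P x s w) {η fs b : ℝ} (hη : 0 < η) (hfs : 0 < fs)
    (hb : 2 * η ^ 2 / 3 < 2 ^ (2 * b)) (hL : 1 ≤ L) (i : Fin N)
    (hi : 0 < ∫ ω, (P[s i | signalSigma x]) ω ^ 2 ∂P) :
    minMSE P x C s w η fs L b ≤ ENNReal.ofReal (minError P x s
      + (∑ j, ∫ ω, (P[s j | signalSigma x]) ω ^ 2 ∂P
        - (∫ ω, (P[s i | signalSigma x]) ω ^ 2 ∂P) / (1 + kappa η b))) := by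
  classical
  set κ := kappa η b with hκ
  have hκ0 : 0 < κ := kappa_pos hη hb
  set E : Fin N → Ω → ℝ := fun j => P[s j | signalSigma x] with hE
  set σ : ℝ := ∫ ω, E i ω ^ 2 ∂P with hσ
  have hσ0 : 0 < σ := hi
  set t : ℝ := 1 / (1 + κ) with ht
  set l₀ : Fin L := ⟨0, hL⟩ with hl₀
  have hLpos : (0 : ℝ) < L := by exact_mod_cast hL
  set A : ℝ → Matrix (Fin L) (Fin M) ℂ := fun f => Matrix.of fun _ m => Γ f i m with hA
  have hAm : ∀ l m, Measurable fun f => A f l m := fun l m => hs.measurable_filter i m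
  set g : Fin N → Fin L → ℤ →₀ ℝ := fun j l =>
    if j = i ∧ l = l₀ then Finsupp.single 0 t else 0 with hg
  have h1 := minMSE_le_of_power hx hC hs hw hη hfs hb hL hAm (Y := fun _ => E i)
    (fun l => isSpec_task hx hs i) (e := L * σ) (by positivity) (by simp [hσ]) g
  have hG : coefSqMat g = t ^ 2 := by
    rw [coefSqMat, Finset.sum_eq_single i, Finset.sum_eq_single l₀]
    · simp [hg, coefSq]
    · intro l _ hl; simp [hg, hl, coefSq]
    · simp
    · intro j _ hj; simp [hg, hj, coefSq]
    · simp
  set Y : Fin N → Ω → ℝ := fun j => if j = i then (1 - t) • E i else E j with hY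
  have hXm : ∀ j m, Measurable fun f : ℝ => (Γ f - trigMat fs g f * A f) j m := fun j m =>
    (hs.measurable_filter j m).sub (measurable_trigMat_mul hAm g j m)
  have hrow : ∀ j (f : ℝ), (Γ f - trigMat fs g f * A f) j
      = if j = i then fun m => ((1 - t : ℝ) : ℂ) * Γ f i m else Γ f j := by
    intro j f
    funext m
    rw [Matrix.sub_apply, Matrix.mul_apply, Finset.sum_eq_single l₀]
    · by_cases hj : j = i
      · subst hj
        simp [hA, hg, trigMat, trig]
        ring
      · simp [hg, hj, trigMat, trig]
    · intro l _ hl; simp [hg, hl, trigMat, trig]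
    · simp
  have hYs : ∀ j, IsSpec P x C (fun f => (Γ f - trigMat fs g f * A f) j) (Y j) := by
    intro j
    simp only [hrow, hY]
    by_cases hj : j = i
    · simp only [hj, if_true]
      exact (isSpec_task hx hs i).const_mul (1 - t)
    · simp only [hj, if_false]
      exact isSpec_task hx hs j
  rw [IsSpec.ofReal_sum_integral_sq hx hC hXm hYs, hG] at h1
  have hsum : ∑ j, ∫ ω, Y j ω ^ 2 ∂P
      = ∑ j, ∫ ω, E j ω ^ 2 ∂P - σ + (1 - t) ^ 2 * σ := by
    rw [← Finset.add_sum_erase _ _ (Finset.mem_univ i),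
      ← Finset.add_sum_erase _ (fun j => ∫ ω, E j ω ^ 2 ∂P) (Finset.mem_univ i)]
    have e1 : ∫ ω, Y i ω ^ 2 ∂P = (1 - t) ^ 2 * σ := by
      simp only [hY, if_true, Pi.smul_apply, smul_eq_mul, mul_pow]
      rw [integral_const_mul]
    have e2 : ∑ j ∈ Finset.univ.erase i, ∫ ω, Y j ω ^ 2 ∂P
        = ∑ j ∈ Finset.univ.erase i, ∫ ω, E j ω ^ 2 ∂P := by
      refine Finset.sum_congr rfl fun j hj => ?_
      simp [hY, Finset.ne_of_mem_erase hj]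
    rw [e1, e2]
    ring
  have hYnn : 0 ≤ ∑ j, ∫ ω, Y j ω ^ 2 ∂P :=
    Finset.sum_nonneg fun j _ => integral_nonneg fun _ => sq_nonneg _
  rw [← ENNReal.ofReal_add minError_nonneg hYnn,
    ← ENNReal.ofReal_add (add_nonneg minError_nonneg hYnn) (by positivity), hsum] at h1
  refine h1.trans (le_of_eq ?_)
  congr 1
  rw [ht]
  field_simp
  ring

theorem lintegral_froSq_sub_of_power_eq_zero (hC : ∀ i j, Measurable fun f => C f i j)
    (hp : ∀ f, (C f).PosSemidef) {A : ℝ → Matrix (Fin L) (Fin M) ℂ}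
    (hA : ∀ i j, Measurable fun f => A f i j)
    (h : ∫⁻ f, ENNReal.ofReal (froSq (A f * CFC.sqrt (C f))) = 0)
    (X : ℝ → Matrix (Fin N) (Fin L) ℂ) :
    ∫⁻ f, ENNReal.ofReal (froSq ((Γ f - X f * A f) * CFC.sqrt (C f)))
      = ∫⁻ f, ENNReal.ofReal (froSq (Γ f * CFC.sqrt (C f))) := by
  rw [lintegral_eq_zero_iff
    (measurable_froSq (measurable_mul_apply hA (measurable_sqrt_apply hC hp))).ennreal_ofReal] at h
  refine lintegral_congr_ae ?_
  filter_upwards [h] with f hf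
  have h0 : A f * CFC.sqrt (C f) = 0 := by
    ext i j
    have h1 := norm_sq_le_froSq (A f * CFC.sqrt (C f)) i j
    have h2 : froSq (A f * CFC.sqrt (C f)) ≤ 0 := ENNReal.ofReal_eq_zero.1 hf
    have h3 : ‖(A f * CFC.sqrt (C f)) i j‖ ^ 2 ≤ 0 := h1.trans h2
    have h4 : ‖(A f * CFC.sqrt (C f)) i j‖ = 0 := by nlinarith [norm_nonneg ((A f * CFC.sqrt (C f)) i j)]
    simpa using norm_eq_zero.1 h4
  rw [Matrix.sub_mul, Matrix.mul_assoc, h0, Matrix.mul_zero, sub_zero]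

/-- Every system with `K` channels loses by a fixed `gap`. If its `d` is well below `Φ`, compression
keeps `d`, `e` and `g` up to small errors, and the smaller factor `κ / L` saves at least `(a - a')
ρ`. Otherwise the one-component system is better by at least `δ`. -/
theorem minMSE_lt_minMSE [IsProbabilityMeasure P] (hx : IsWSS P x C)
    (hC : ∀ i j, Measurable fun f => C f i j) (hs : IsLinearTask P x C Γ s)
    (hw : IsDither P x s w) {η fs b b' : ℝ} (hη : 0 < η) (hfs : 0 < fs)
    {W : ℝ} (hW : ∀ f, W < |f| → C f = 0)
    {S : AddCircle fs → Matrix (Fin N) (Fin N) ℂ} (hSm : ∀ i j, Measurable fun θ => S θ i j)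
    (hSr : ∀ θ, (S θ).rank ≤ L) {U : Set (AddCircle fs)} (hU : MeasurableSet U)
    (hUneg : ∀ θ ∈ U, -θ ∉ U)
    (hrange : ∀ f : ℝ, C f = 0 ∨
      ((f : AddCircle fs) ∈ U ∧ ∀ a, ∃ c, (Γ f * CFC.sqrt (C f)) *ᵥ a = S f *ᵥ c) ∨
      (-(f : AddCircle fs) ∈ U ∧
        ∀ a, ∃ c, (Γ f * CFC.sqrt (C f)) *ᵥ a = ((S (-f)).map (starRingEnd ℂ)) *ᵥ c))
    (hne : ∃ i, ¬ (P[s i | signalSigma x] =ᵐ[P] 0)) (hL : 1 ≤ L) (hK : 1 ≤ K)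
    (hb : 2 * η ^ 2 / 3 < 2 ^ (2 * b)) (hb' : 2 * η ^ 2 / 3 < 2 ^ (2 * b'))
    (hκ : kappa η b' / L < kappa η b / K) :
    minMSE P x C s w η fs L b' < minMSE P x C s w η fs K b := by
  have : Fact (0 < fs) := ⟨hfs⟩
  obtain ⟨i, hi⟩ := hne
  have hN : 0 < N := i.pos
  have hEs := isSpec_task hx hs
  set E : Fin N → Ω → ℝ := fun j => P[s j | signalSigma x] with hE
  have hσ : 0 < ∫ ω, E i ω ^ 2 ∂P := by
    refine lt_of_le_of_ne (integral_nonneg fun _ => sq_nonneg _) fun h => hi ?_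
    have := (integral_eq_zero_iff_of_nonneg (fun _ => sq_nonneg _)
      (hEs i).memLp.integrable_sq).1 h.symm
    filter_upwards [this] with ω hω using pow_eq_zero_iff two_ne_zero |>.1 hω
  set Φ : ℝ := ∑ j, ∫ ω, E j ω ^ 2 ∂P with hΦdef
  have hΦ : ∫⁻ f, ENNReal.ofReal (froSq (Γ f * CFC.sqrt (C f))) = ENNReal.ofReal Φ :=
    IsSpec.ofReal_sum_integral_sq hx hC hs.measurable_filter hEs
  have hcomp := minMSE_le_of_component hx hC hs hw (fs := fs) hη hfs hb' hL i hσ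
  have hκ' : 0 < kappa η b' := kappa_pos hη hb'
  have hLpos : (0 : ℝ) < L := by exact_mod_cast hL
  set c₀ := minError P x s with hc₀
  have hc₀0 : 0 ≤ c₀ := minError_nonneg
  -- Half the gain of the one-component system: one half decides between the cases, the other is the
  -- margin left in the second case.
  set δ : ℝ := (∫ ω, E i ω ^ 2 ∂P) / (1 + kappa η b') / 2 with hδ
  have hδ0 : 0 < δ := by positivity
  have hcomp' : minMSE P x C s w η fs L b' ≤ ENNReal.ofReal (c₀ + (Φ - 2 * δ)) := by
    refine hcomp.trans (le_of_eq ?_)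
    congr 3
    rw [hδ]; ring
  obtain ⟨ρ, hρ0, hρ⟩ := exists_le_power_mul_coefSqMat (T := fs) hC hx.posSemidef hW
    hs.measurable_filter hΦ hδ0
  set a := kappa η b / K with ha
  set a' := kappa η b' / L with ha'
  have ha'0 : 0 < a' := div_pos hκ' hLpos
  set gap : ℝ := min δ ((a - a') * ρ) with hgap
  have hgap0 : 0 < gap := lt_min hδ0 (mul_pos (sub_pos.2 hκ) hρ0)
  have hle : minMSE P x C s w η fs L b' + ENNReal.ofReal gap ≤ minMSE P x C s w η fs K b := by
    refine le_sInf ?_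
    rintro _ ⟨H, y, γ, G, sHat, hFE, hDE, rfl⟩
    refine ENNReal.le_of_forall_pos_le_add fun ε₀ hε₀ _ => ?_
    have hε : (0 : ℝ) < ε₀ / 2 := half_pos hε₀
    obtain ⟨A, Z, g, d, e, hA, hZ, hd0, he0, hd, he, hmse⟩ :=
      exists_finite_system hx hC hs hw hb hK hFE hDE hε
    set ε : ℝ := ε₀ / 2 with hεdef
    have hG0 := coefSqMat_nonneg g
    set g₂ := coefSqMat g with hg₂
    have ha0 : 0 < a := ha'0.trans hκ
    have hsplit : mse P s sHat + (ε₀ : ℝ≥0∞) = mse P s sHat + ENNReal.ofReal ε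
        + ENNReal.ofReal ε := by
      rw [add_assoc, ← ENNReal.ofReal_add hε.le hε.le, hεdef, add_halves]
      simp
    rw [hsplit]
    refine le_trans ?_ (add_le_add_left hmse _)
    rw [← ENNReal.ofReal_add (by positivity) hε.le]
    by_cases hdΦ : d ≤ Φ - δ
    · have hρ' := hρ K A hA g d e hd0 he0 hd.le he.le hdΦ
      -- The last bound absorbs the error of `d` and of the product `e g`, where `ε₁² ≤ ε₁` is used;
      -- `δ / 2` keeps the compressed power positive.
      set ε₁ : ℝ := min (min (δ / 2) 1) (ε / (1 + a' * (e + g₂ + 1))) with hε₁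
      have hden : 0 < 1 + a' * (e + g₂ + 1) := by positivity
      have hε₁0 : 0 < ε₁ := lt_min (lt_min (half_pos hδ0) one_pos) (div_pos hε hden)
      have hε₁1 : ε₁ ≤ 1 := (min_le_left _ _).trans (min_le_right _ _)
      have hε₁δ : ε₁ ≤ δ / 2 := (min_le_left _ _).trans (min_le_left _ _)
      have hε₁ε : ε₁ * (1 + a' * (e + g₂ + 1)) ≤ ε := by
        rw [← le_div_iff₀ hden]; exact min_le_right _ _
      obtain ⟨p, β, hdist, hpow, hcoef⟩ := exists_compression (L := L) hN hC hx.posSemidef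
        hs.measurable_filter hSm hSr hU hUneg hrange hA g hd0 he0 hd.le he.le hε₁0
      obtain ⟨Gp, Fp, rfl, -⟩ := exists_taps_eq p
      have hA' := measurable_trigMat_mul (T := fs) hA (taps Gp Fp)
      set A' : ℝ → Matrix (Fin L) (Fin M) ℂ := fun f => trigMat fs (taps Gp Fp) f * A f with hA'def
      have hY := hZ.isSpec_taps hx hC hA Gp Fp
      set Y : Fin L → Ω → ℝ := fun l ω => ∑ n ∈ Fp, ∑ k : Fin K, Gp (-n) l k * Z k n ω with hYdef
      have hpow' := IsSpec.ofReal_sum_integral_sq hx hC hA' hY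
      set e' : ℝ := ∑ l, ∫ ω, Y l ω ^ 2 ∂P with he'
      have he'0 : 0 ≤ e' := Finset.sum_nonneg fun l _ => integral_nonneg fun _ => sq_nonneg _
      have he'e : e' ≤ e + ε₁ := by
        rw [hpow', ENNReal.ofReal_le_ofReal_iff (by positivity)] at hpow
        exact hpow
      -- Zero power would force the error back to `Φ`, above `d + ε₁`. Positivity is needed for a
      -- positive dynamic range.
      have he'pos : 0 < e' := by
        refine lt_of_le_of_ne he'0 fun h => ?_
        rw [← h, ENNReal.ofReal_zero] at hpow'
        rw [lintegral_froSq_sub_of_power_eq_zero (Γ := Γ) hC hx.posSemidef hA' hpow', hΦ,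
          ENNReal.ofReal_le_ofReal_iff (by positivity)] at hdist
        linarith
      have hfin := minMSE_le_of_power hx hC hs hw hη hfs hb' hL hA' hY he'pos rfl β
      have hβ0 := coefSqMat_nonneg β
      have h1 : minMSE P x C s w η fs L b' ≤ ENNReal.ofReal
          (c₀ + (d + ε₁) + a' * ((e + ε₁) * (g₂ + ε₁))) := by
        refine hfin.trans ?_
        rw [ENNReal.ofReal_add (by positivity) (by positivity),
          ENNReal.ofReal_add hc₀0 (by positivity)]
        refine add_le_add (add_le_add le_rfl hdist) (ENNReal.ofReal_le_ofReal ?_)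
        gcongr
      refine (add_le_add h1 le_rfl).trans ?_
      rw [← ENNReal.ofReal_add (by positivity) hgap0.le]
      refine ENNReal.ofReal_le_ofReal ?_
      have h2 : gap ≤ (a - a') * (e * g₂) :=
        (min_le_right _ _).trans (mul_le_mul_of_nonneg_left hρ' (sub_pos.2 hκ).le)
      have h3 : a' * ((e + ε₁) * (g₂ + ε₁)) ≤ a' * (e * g₂) + ε₁ * (a' * (e + g₂ + 1)) := by
        have h4 : (e + ε₁) * (g₂ + ε₁) ≤ e * g₂ + ε₁ * (e + g₂ + 1) := by nlinarith
        have := mul_le_mul_of_nonneg_left h4 ha'0.le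
        linarith
      nlinarith
    · refine (add_le_add hcomp' le_rfl).trans ?_
      have hΦδ : 0 ≤ Φ - 2 * δ := by
        have h1 : ∫ ω, E i ω ^ 2 ∂P ≤ Φ :=
          Finset.single_le_sum (f := fun j => ∫ ω, E j ω ^ 2 ∂P)
            (fun j _ => integral_nonneg fun _ => sq_nonneg _) (Finset.mem_univ i)
        have h2 : 2 * δ ≤ ∫ ω, E i ω ^ 2 ∂P := by
          have : 2 * δ = (∫ ω, E i ω ^ 2 ∂P) / (1 + kappa η b') := by rw [hδ]; ring
          rw [this]
          exact div_le_self hσ.le (by linarith)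
        linarith
      rw [← ENNReal.ofReal_add (add_nonneg hc₀0 hΦδ) hgap0.le]
      refine ENNReal.ofReal_le_ofReal ?_
      have h1 : gap ≤ δ := min_le_left _ _
      have h2 : 0 ≤ a * (e * g₂) := by positivity
      linarith [not_le.1 hdΦ]
  have hlt : minMSE P x C s w η fs L b' < ⊤ := hcomp.trans_lt ENNReal.ofReal_lt_top
  exact (ENNReal.lt_add_right hlt.ne (ENNReal.ofReal_pos.2 hgap0).ne').trans_le hle

end

/-! ### Comparison of the rules for the resolution -/

section

/-- With `c = 2 η² / 3` the claim is `K (4^b - c) < L (4^{b'} - c)`. It becomes strict because `K c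
> L c`. -/
theorem kappa_div_lt {η b b' : ℝ} {K L : ℕ} (hη : 0 < η) (hL : 1 ≤ L) (hLK : L < K)
    (hb : 2 * η ^ 2 / 3 < 2 ^ (2 * b))
    (h : K * (2 : ℝ) ^ (2 * b) ≤ L * 2 ^ (2 * b')) :
    kappa η b' / L < kappa η b / K := by
  have hL' : (0 : ℝ) < L := by exact_mod_cast hL
  have hLK' : (L : ℝ) < K := by exact_mod_cast hLK
  rw [kappa, kappa, div_div, div_div]
  refine div_lt_div_of_pos_left (by positivity)
    (mul_pos (sub_pos.2 hb) (hL'.trans hLK')) ?_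
  have : 0 < 2 * η ^ 2 / 3 := by positivity
  nlinarith

theorem one_add_le_two_rpow {u : ℝ} (hu : 0 ≤ u) : 1 + u ≤ (2 : ℝ) ^ (2 * u) := by
  rw [Real.rpow_def_of_pos two_pos]
  have h1 := Real.add_one_le_exp (Real.log 2 * (2 * u))
  have h2 := Real.log_two_gt_d9
  nlinarith

/-- With `K = L (1 + u)` the resolution grows from `b` to `b (1 + u)`. Since `b ≥ 1`, the gain is at
least the factor `4^u ≥ 1 + u`. -/
theorem mul_two_rpow_le_exact {R fs : ℝ} {K L : ℕ} (hfs : 0 < fs) (hL : 1 ≤ L) (hLK : L < K)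
    (hb : 1 ≤ R / (K * fs)) :
    K * (2 : ℝ) ^ (2 * (R / (K * fs))) ≤ L * 2 ^ (2 * (R / (L * fs))) := by
  have hL' : (0 : ℝ) < L := by exact_mod_cast hL
  have hLK' : (L : ℝ) < K := by exact_mod_cast hLK
  have hK' : (0 : ℝ) < K := hL'.trans hLK'
  set b := R / (K * fs) with hbdef
  set u : ℝ := K / L - 1 with hu
  have hu0 : 0 ≤ u := by
    rw [hu, sub_nonneg, le_div_iff₀ hL']; linarith
  have h1 : R / (L * fs) = b + b * u := by
    rw [hbdef, hu]; field_simp; ring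
  have h2 : (2 : ℝ) ^ (2 * u) ≤ 2 ^ (2 * (b * u)) :=
    Real.rpow_le_rpow_of_exponent_le one_le_two (by nlinarith)
  have h3 := one_add_le_two_rpow hu0
  have h4 : (K : ℝ) = L * (1 + u) := by rw [hu]; field_simp; ring
  rw [h1, mul_add, Real.rpow_add two_pos, h4]
  have h5 : (0 : ℝ) < 2 ^ (2 * b) := by positivity
  have h6 : 1 + u ≤ (2 : ℝ) ^ (2 * (b * u)) := h3.trans h2
  calc L * (1 + u) * (2 : ℝ) ^ (2 * b) = L * (2 ^ (2 * b) * (1 + u)) := by ring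
    _ ≤ _ := by gcongr

theorem mul_two_rpow_le_floor {R fs : ℝ} {K L : ℕ} (hfs : 0 < fs) (hL : 1 ≤ L) (hLK : L < K)
    (hb : 1 ≤ ⌊R / (K * fs)⌋₊) (hne : ⌊R / (K * fs)⌋₊ < ⌊R / (L * fs)⌋₊) :
    K * (2 : ℝ) ^ (2 * (⌊R / (K * fs)⌋₊ : ℝ)) ≤ L * 2 ^ (2 * (⌊R / (L * fs)⌋₊ : ℝ)) := by
  have hL' : (0 : ℝ) < L := by exact_mod_cast hL
  have hK' : (0 : ℝ) < K := hL'.trans (by exact_mod_cast hLK)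
  obtain ⟨d, hd⟩ : ∃ d, ⌊R / (L * fs)⌋₊ = ⌊R / (K * fs)⌋₊ + (d + 1) :=
    ⟨⌊R / (L * fs)⌋₊ - ⌊R / (K * fs)⌋₊ - 1, by omega⟩
  have h1 : (⌊R / (K * fs)⌋₊ : ℝ) ≤ R / (K * fs) :=
    Nat.floor_le (zero_le_one.trans (Nat.floor_pos.1 hb))
  have h2 : R / (L * fs) < ⌊R / (L * fs)⌋₊ + 1 := Nat.lt_floor_add_one _
  rw [hd] at h2 ⊢
  set b := ⌊R / (K * fs)⌋₊ with hbdef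
  have hb1 : (1 : ℝ) ≤ b := by exact_mod_cast hb
  rw [le_div_iff₀ (by positivity)] at h1
  rw [div_lt_iff₀ (by positivity)] at h2
  push_cast at h2
  have h3 : (K : ℝ) * b < L * (b + (d + 1) + 1) := by
    have : (K * b : ℝ) * fs < (L * (b + (d + 1) + 1)) * fs := by linarith
    exact lt_of_mul_lt_mul_right this hfs.le
  -- From `K b < L (b + d + 2)` and `b ≥ 1`. The resolution gains `d + 1` bits, a factor `4^{d+1} ≥
  -- d + 3`.
  have h4 : (K : ℝ) ≤ L * (d + 3) := by
    by_contra h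
    have h5 := mul_lt_mul_of_pos_right (not_le.1 h) (zero_lt_one.trans_le hb1)
    have h6 : (L : ℝ) * (d + 2) ≤ L * (d + 2) * b :=
      le_mul_of_one_le_right (by positivity) hb1
    nlinarith
  have h5 : ((d : ℝ) + 3) ≤ 4 ^ (d + 1) := by
    have : d + 3 ≤ 4 ^ (d + 1) := by
      induction d with
      | zero => norm_num
      | succ d _ =>
        have : d + 1 < 4 ^ (d + 1) := Nat.lt_pow_self (by norm_num)
        rw [pow_succ]; omega
    exact_mod_cast this
  have h6 : (2 : ℝ) ^ (2 * ((d + 1 : ℕ) : ℝ)) = 4 ^ (d + 1) := by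
    rw [Real.rpow_mul two_pos.le, Real.rpow_natCast]; norm_num
  rw [Nat.cast_add, mul_add, Real.rpow_add two_pos, h6]
  have h7 : (0 : ℝ) < 2 ^ (2 * (b : ℝ)) := by positivity
  calc (K : ℝ) * 2 ^ (2 * (b : ℝ)) ≤ L * (4 ^ (d + 1)) * 2 ^ (2 * (b : ℝ)) := by
        gcongr
        exact h4.trans (mul_le_mul_of_nonneg_left h5 hL'.le)
    _ = _ := by ring

theorem Admissible.mono {M K L : ℕ} {η b b' : ℝ} (h : Admissible M η K b) (hL : 1 ≤ L)
    (hLK : L ≤ K) (hb : b ≤ b') : Admissible M η L b' := by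
  refine ⟨hL, hLK.trans h.2.1, h.2.2.1.trans hb, ?_⟩
  have h1 := h.lt
  have h2 : (2 : ℝ) ^ (2 * b) ≤ 2 ^ (2 * b') :=
    Real.rpow_le_rpow_of_exponent_le one_le_two (by linarith)
  rw [div_lt_one (by positivity)]
  linarith

/-- The comparison is run with the regular version `C'`, which has the same minimal errors, while
the rank bound remains the one of `C`. -/
theorem IsMSEMinimizing.not_mul_two_rpow_le {Ω : Type*} [MeasurableSpace Ω] {P : Measure Ω}
    [IsProbabilityMeasure P] {M N : ℕ} {x : Fin M → ℝ → Ω → ℝ}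
    {C : ℝ → Matrix (Fin M) (Fin M) ℂ} {Γ : ℝ → Matrix (Fin N) (Fin M) ℂ} {s : Fin N → Ω → ℝ}
    {w : ℕ → ℤ → Ω → ℝ} {η fs : ℝ} {Υ : ℕ} (hη : 0 < η) (hfs : 0 < fs) (hx : IsWSS P x C)
    (hs : IsLinearTask P x C Γ s) (hw : IsDither P x s w)
    (hband : ∀ f : ℝ, ((Υ : ℝ) + 1 / 2) * fs < |f| → C f = 0)
    (hne : ∃ i, ¬ (P[s i | signalSigma x] =ᵐ[P] 0)) :
    1 ≤ maxRank C Γ fs Υ ∧ ∀ {b : ℕ → ℝ} {K : ℕ}, IsMSEMinimizing P x C s w η fs b K →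
      maxRank C Γ fs Υ < K → b K ≤ b (maxRank C Γ fs Υ) →
      ¬ K * (2 : ℝ) ^ (2 * b K) ≤ maxRank C Γ fs Υ * 2 ^ (2 * b (maxRank C Γ fs Υ)) := by
  have : Fact (0 < fs) := ⟨hfs⟩
  obtain ⟨C', hC'C, hae, hC', hsymC, hsymΓ, hhalf⟩ := exists_regular_psd hx hs fs
  have hp' : ∀ f, (C' f).PosSemidef := fun f => by
    rcases hC'C f with h | h
    · rw [h]; exact Matrix.PosSemidef.zero
    · rw [h]; exact hx.posSemidef f
  have hband' : ∀ f : ℝ, ((Υ : ℝ) + 1 / 2) * fs < |f| → C' f = 0 := fun f hf => by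
    rcases hC'C f with h | h
    · exact h
    · rw [h, hband f hf]
  have hx' := hx.congr hae hp'
  have hs' := hs.congr hae
  obtain ⟨S, U, hSm, hSr, hU, hUneg, hrange⟩ := exists_aliased_psd hC' hp' hs.measurable_filter
    hC'C hsymC hsymΓ hhalf hband'
  have hL : 1 ≤ maxRank C Γ fs Υ := IsLinearTask.maxRank_pos hx' hs' hC' hSr hrange hne
  refine ⟨hL, fun {b K} hmin hLK hbb hle => ?_⟩
  have hadm := hmin.1.mono hL hLK.le hbb
  have hlt := minMSE_lt_minMSE hx' hC' hs' hw hη hfs hband' hSm hSr hU hUneg hrange hne hL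
    hmin.1.1 hmin.1.lt hadm.lt (kappa_div_lt hη hL hLK hmin.1.lt hle)
  rw [← minMSE_congr hae, ← minMSE_congr hae] at hlt
  exact absurd (hmin.2 _ hadm) (not_le.2 hlt)

end

end

end TaskADC

theorem corollary2 {Ω : Type*} [MeasurableSpace Ω] (P : Measure Ω) [IsProbabilityMeasure P]
    {M N : ℕ} (x : Fin M → ℝ → Ω → ℝ) (C : ℝ → Matrix (Fin M) (Fin M) ℂ)
    (Γ : ℝ → Matrix (Fin N) (Fin M) ℂ) (s : Fin N → Ω → ℝ) (w : ℕ → ℤ → Ω → ℝ)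
    (η fs R : ℝ) (Υ : ℕ)
    (hη : 0 < η) (hfs : 0 < fs)
    (hx : IsWSS P x C) (hs : IsLinearTask P x C Γ s) (hw : IsDither P x s w)
    (hband : ∀ f : ℝ, ((Υ : ℝ) + 1 / 2) * fs < |f| → C f = 0)
    (hne : ∃ i, ¬ (P[s i | signalSigma x] =ᵐ[P] 0)) :
    -- the resolution that exactly exhausts the rate budget, `R = K * fs * b`
    (∀ K : ℕ, IsMSEMinimizing P x C s w η fs (fun K' => R / (K' * fs)) K →
      K ≤ maxRank C Γ fs Υ) ∧
    -- the resolution rounded down to an integer number of bits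
    (∀ K : ℕ, IsMSEMinimizing P x C s w η fs (fun K' => (⌊R / (K' * fs)⌋₊ : ℝ)) K →
      K ≤ maxRank C Γ fs Υ ∨
        ⌊R / (K * fs)⌋₊ = ⌊R / (maxRank C Γ fs Υ * fs)⌋₊) := by
  obtain ⟨hL, hmin⟩ := IsMSEMinimizing.not_mul_two_rpow_le hη hfs hx hs hw hband hne
  have hL' : (0 : ℝ) < maxRank C Γ fs Υ := by exact_mod_cast hL
  have hdiv : ∀ {K : ℕ}, maxRank C Γ fs Υ < K → 0 ≤ R / (K * fs) →
      R / (K * fs) ≤ R / (maxRank C Γ fs Υ * fs) := by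
    intro K hK h0
    have hK' : (maxRank C Γ fs Υ : ℝ) < K := by exact_mod_cast hK
    have hR : 0 ≤ R := by
      have := mul_nonneg h0 (by positivity : 0 ≤ (K : ℝ) * fs)
      rwa [div_mul_cancel₀ _ (mul_pos (hL'.trans hK') hfs).ne'] at this
    gcongr
  refine ⟨fun K hK => not_lt.1 fun hLK => ?_, fun K hK => or_iff_not_imp_left.2 fun hLK => ?_⟩
  · have hb : 1 ≤ R / (K * fs) := hK.1.2.2.1
    exact hmin hK hLK (hdiv hLK (zero_le_one.trans hb)) (mul_two_rpow_le_exact hfs hL hLK hb)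
  · rw [not_le] at hLK
    have hb' : (1 : ℝ) ≤ (⌊R / (K * fs)⌋₊ : ℝ) := hK.1.2.2.1
    have hb : 1 ≤ ⌊R / (K * fs)⌋₊ := by exact_mod_cast hb'
    have hle : ⌊R / (K * fs)⌋₊ ≤ ⌊R / (maxRank C Γ fs Υ * fs)⌋₊ :=
      Nat.floor_le_floor (hdiv hLK (zero_le_one.trans (Nat.floor_pos.1 hb)))
    by_contra hne'
    exact hmin hK hLK (Nat.cast_le.2 hle)
      (mul_two_rpow_le_floor hfs hL hLK hb (lt_of_le_of_ne hle hne'))
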